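/- Let $k>0$. There is a constant $C=C(k)\ge 0$, depending only on $k$, with the following property. Let $M$ be a smooth $3$-manifold and let $(g_t)_{|t|<\varepsilon}$ be a smooth family of complete hyperbolic metrics on $M$ (complete Riemannian metrics locally isometric to $\mathbb H^3$). Let $\eta$ be its strain field at $t=0$, that is, the field of endomorphisms of $TM$ with $\frac{\partial}{\partial t}\big|_{t=0}g_t(x,y)=2g_0(\eta(x),y)$, and let $\nabla$ be the Levi-Civita connection of $g_0$. Let $f:\Sigma\to M$ be a closed, smoothly immersed, transversally oriented surface, let $\mathbf n_t$ be its $g_t$-unit normal field, and let $B_t=\nabla^t\mathbf n_t$ be its shape operator for $g_t$. Suppose that all eigenvalues of $B_0$, at all points of $\Sigma$, lie in $[-1+1/k,\,k]$. Then, for all $t$ near $0$, $\Sigma$ has a conformal structure at infinity $\omega_t$ for $g_t$: the $g_t$-geodesic flow $F_{t,r}:\Sigma\to M$ along $\mathbf n_t$ is an immersion for all $r\ge 0$, and the conformal structures of $F_{t,r}^*g_t$ converge to $\omega_t$ as $r\to\infty$. The $\omega_t$ are the conformal classes of a smooth family of Riemannian metrics on $\Sigma$, and $$\|\dot\omega\|_{\mathcal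 T}\;\le\; C\,\max\Big(\sup_{p\in f(\Sigma)}\|\eta_p\|,\ \sup_{p\in f(\Sigma)}\|(\nabla\eta)_p\|\Big).$$ Here $\|\eta_p\|=\sup_{\|x\|=1}\|\eta(x)\|$ and $\|(\nabla\eta)_p\|=\sup_{\|x\|=\|y\|=1}\|(\nabla_x\eta)(y)\|$ over $x,y\in T_pM$, with lengths for $g_0$. The norm $\|\dot\omega\|_{\mathcal T}$ is the Teichmüller norm of the time-zero derivative of $t\mapsto\omega_t$, that is, the speed $\limsup_{t\to0}d_{\mathcal T}(\omega_0,\omega_t)/|t|$ of this path for the Teichmüller distance $d_{\mathcal T}(\omega,\omega')=\inf_\varphi\frac12\log\frac{1+\|\mu_\varphi\|_\infty}{1-\|\mu_\varphi\|_\infty}$, where $\varphi$ runs over the diffeomorphisms of $\Sigma$ isotopic to the identity and $\mu_\varphi$ is the Beltrami differential of $\varphi:(\Sigma,\omega)\to(\Sigma,\omega')$. -/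

import Mathlib

open Set Filter Topology Manifold Bundle
open scoped Manifold ContDiff ENNReal NNReal RealInnerProductSpace

set_option maxSynthPendingDepth 3

noncomputable section

namespace HypSurf

/-- Euclidean `n`-space, the model space of all manifolds below. -/
abbrev E (n : ℕ) : Type := EuclideanSpace ℝ (Fin n)

/-- Bilinear forms on `E n`. -/
abbrev Bil (n : ℕ) : Type := E n →L[ℝ] E n →L[ℝ] ℝ

/-- Smooth Riemannian metrics on a smooth `n`-manifold. -/
abbrev RMetric (n : ℕ) (M : Type*) [TopologicalSpace M] [ChartedSpace (E n) M]
    [IsManifold (𝓡 n) ∞ M] : Type _ :=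
  ContMDiffRiemannianMetric (𝓡 n) ∞ (E n) (fun p : M => TangentSpace (𝓡 n) p)

section Riemannian

variable {n : ℕ} {M : Type*} [TopologicalSpace M] [ChartedSpace (E n) M]
  [IsManifold (𝓡 n) ∞ M]

/-- The family `g t`, `t ∈ J`, of Riemannian metrics is smooth, jointly in `t` and in the point. -/
def IsSmoothFamilyOn (J : Set ℝ) (g : ℝ → RMetric n M) : Prop :=
  ContMDiffOn (𝓘(ℝ, ℝ).prod (𝓡 n)) ((𝓡 n).prod 𝓘(ℝ, Bil n)) ∞
    (fun q : ℝ × M => (TotalSpace.mk' (Bil n) q.2 ((g q.1).inner q.2) :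
      TotalSpace (Bil n) (fun p : M =>
        TangentSpace (𝓡 n) p →L[ℝ] TangentSpace (𝓡 n) p →L[ℝ] ℝ)))
    (J ×ˢ univ)

/-- The metric `g` in the preferred chart at `p`, as a function of the chart coordinate `y`.
It is meaningful for `y` in the (open) target of the chart. -/
def chartMetric (g : RMetric n M) (p : M) (y : E n) : Bil n :=
  let A : E n →L[ℝ] E n := mfderiv 𝓘(ℝ, E n) (𝓡 n) (extChartAt (𝓡 n) p).symm y
  let G : Bil n := g.inner ((extChartAt (𝓡 n) p).symm y)
  G.bilinearComp A A

/-- The Christoffel symbols `Γ_y(u, v)` of a Riemannian metric `G` on an open set of `E n`,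
through the Koszul formula
`2 G_y(Γ_y(u, v), w) = (D_u G)(v, w) + (D_v G)(u, w) - (D_w G)(u, v)`. -/
def christoffel (G : E n → Bil n) (y u v : E n) : E n :=
  (G y).inverse ((1 / 2 : ℝ) •
    (fderiv ℝ G y u v + fderiv ℝ G y v u - ((fderiv ℝ G y).flip u).flip v))

/-- The Christoffel symbols at `p` of `g` in the preferred chart at `p`.  (The differential at
`p` of that chart is the identification of `TangentSpace (𝓡 n) p` with `E n`.) -/
def christoffelAt (g : RMetric n M) (p : M) (u v : E n) : E n :=
  christoffel (chartMetric g p) (extChartAt (𝓡 n) p p) u v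

/-- `γ` is a geodesic of `g`, parametrized by all of `ℝ`: `γ'' + Γ(γ', γ') = 0`, at each time `s`
in the preferred chart at `γ s`. -/
def IsGeodesic (g : RMetric n M) (γ : ℝ → M) : Prop :=
  ContMDiff 𝓘(ℝ, ℝ) (𝓡 n) ∞ γ ∧
  ∀ s : ℝ, let c : ℝ → E n := fun τ => extChartAt (𝓡 n) (γ s) (γ τ)
    deriv (deriv c) s + christoffelAt g (γ s) (deriv c s) (deriv c s) = 0

/-- The velocity of a curve at time `s`, as a point of the tangent bundle. -/
def velocity (γ : ℝ → M) (s : ℝ) : TangentBundle (𝓡 n) M :=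
  ⟨γ s, mfderiv 𝓘(ℝ, ℝ) (𝓡 n) γ s (1 : ℝ)⟩

/-- Completeness: each tangent vector is the initial velocity of a geodesic defined on `ℝ`. -/
def IsCompleteMetric (g : RMetric n M) : Prop :=
  ∀ v : TangentBundle (𝓡 n) M, ∃ γ : ℝ → M, IsGeodesic g γ ∧ velocity γ 0 = v

/-- The Lorentz form on `ℝ × E n`. -/
def lorentz (a b : ℝ × E n) : ℝ := ⟪a.2, b.2⟫ - a.1 * b.1

/-- Hyperbolic `n`-space, as the upper sheet of the hyperboloid; its Riemannian metric is the
restriction of the Lorentz form. -/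
def hyperboloid (n : ℕ) : Set (ℝ × E n) := {a | lorentz a a = -1 ∧ 0 < a.1}

/-- `g` is a hyperbolic metric: the Riemannian manifold `(M, g)` is locally isometric to
hyperbolic space. -/
def IsHyperbolicMetric (g : RMetric n M) : Prop :=
  ∀ p : M, ∃ U : Set M, IsOpen U ∧ p ∈ U ∧ ∃ Φ : M → ℝ × E n,
    ContMDiffOn (𝓡 n) 𝓘(ℝ, ℝ × E n) ∞ Φ U ∧
    ∀ q ∈ U, Φ q ∈ hyperboloid n ∧ ∀ u v : TangentSpace (𝓡 n) q,
      g.inner q u v =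
        lorentz (mfderiv (𝓡 n) 𝓘(ℝ, ℝ × E n) Φ q u : ℝ × E n)
          (mfderiv (𝓡 n) 𝓘(ℝ, ℝ × E n) Φ q v : ℝ × E n)

/-- The strain endomorphism at time `t` of a time-dependent inner product `b` on `E n`: the
endomorphism `η` with `(d/dt) b_t(u, v) = 2 b_t(η u, v)`. -/
def strainOf (b : ℝ → Bil n) (t : ℝ) : E n →L[ℝ] E n :=
  (b t).inverse ∘L ((1 / 2 : ℝ) • deriv b t)

/-- The strain field `η_t` of the family `g` at the point `p`. -/
def strainField (g : ℝ → RMetric n M) (t : ℝ) (p : M) :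
    TangentSpace (𝓡 n) p →L[ℝ] TangentSpace (𝓡 n) p :=
  strainOf (fun s => ((g s).inner p : Bil n)) t

/-- The strain field in the preferred chart at `p`, as a function of the chart coordinate. -/
def chartStrain (g : ℝ → RMetric n M) (t : ℝ) (p : M) (y : E n) : E n →L[ℝ] E n :=
  strainOf (fun s => chartMetric (g s) p y) t

/-- The covariant derivative `(∇_u η) v` of the strain field at time `t`, with respect to the
Levi-Civita connection of `g t`, at the point `p`:
`(∇_u η) v = (D_u η) v + Γ(u, η v) - η (Γ(u, v))`. -/
def strainGrad (g : ℝ → RMetric n M) (t : ℝ) (p : M) (u v : TangentSpace (𝓡 n) p) :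
    TangentSpace (𝓡 n) p :=
  let y₀ : E n := extChartAt (𝓡 n) p p
  let η : E n → (E n →L[ℝ] E n) := chartStrain g t p
  (fderiv ℝ η y₀ u v + christoffelAt (g t) p u (η y₀ v)
    - η y₀ (christoffelAt (g t) p u v) : E n)

/-- The length of a tangent vector. -/
def vnorm (g : RMetric n M) (p : M) (v : TangentSpace (𝓡 n) p) : ℝ :=
  √(g.inner p v v)

/-- The norm of `η_t` over a set `A`: the supremum over `p ∈ A` of the operator norm at `p`. -/
def strainNorm (g : ℝ → RMetric n M) (t : ℝ) (A : Set M) : ℝ≥0∞ :=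
  ⨆ p ∈ A, ⨆ (u : TangentSpace (𝓡 n) p) (_ : vnorm (g t) p u = 1),
    ENNReal.ofReal (vnorm (g t) p (strainField g t p u))

/-- The norm of `∇ η_t` over a set `A`: the supremum over `p ∈ A` of the operator norm at `p`. -/
def strainGradNorm (g : ℝ → RMetric n M) (t : ℝ) (A : Set M) : ℝ≥0∞ :=
  ⨆ p ∈ A, ⨆ (u : TangentSpace (𝓡 n) p) (_ : vnorm (g t) p u = 1)
    (v : TangentSpace (𝓡 n) p) (_ : vnorm (g t) p v = 1),
    ENNReal.ofReal (vnorm (g t) p (strainGrad g t p u v))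

end Riemannian

section Teichmueller

variable {S : Type*} [TopologicalSpace S] [ChartedSpace (E 2) S] [IsManifold (𝓡 2) ∞ S]

/-- The diffeomorphism `φ` is smoothly isotopic to the identity. -/
def IsIsotopicToId (φ : S ≃ₘ^∞⟮𝓡 2, 𝓡 2⟯ S) : Prop :=
  ∃ H : ℝ → (S ≃ₘ^∞⟮𝓡 2, 𝓡 2⟯ S),
    ContMDiff (𝓘(ℝ, ℝ).prod (𝓡 2)) (𝓡 2) ∞ (fun q : ℝ × S => H q.1 q.2) ∧
    (∀ x, H 0 x = x) ∧ ∀ x, H 1 x = φ x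

/-- The dilatation of `φ : (S, h₀) → (S, h₁)` is at most `K` at each point: the ratio of the
largest to the smallest stretch of `dφ` is at most `K`.  In terms of the Beltrami differential
`μ` of `φ`, this ratio is `(1 + |μ|) / (1 - |μ|)`. -/
def DilatationLE (h₀ h₁ : RMetric 2 S) (φ : S → S) (K : ℝ) : Prop :=
  ∀ (x : S) (u v : TangentSpace (𝓡 2) x),
    vnorm h₁ (φ x) (mfderiv (𝓡 2) (𝓡 2) φ x u) * vnorm h₀ x v ≤
      K * (vnorm h₁ (φ x) (mfderiv (𝓡 2) (𝓡 2) φ x v) * vnorm h₀ x u)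

/-- The Teichmüller distance between the marked conformal structures of two metrics on `S`: the
infimum of `(1/2) log K`, over all diffeomorphisms isotopic to the identity and all bounds `K`
of their dilatations. -/
def teichDist (h₀ h₁ : RMetric 2 S) : ℝ≥0∞ :=
  ⨅ (φ : S ≃ₘ^∞⟮𝓡 2, 𝓡 2⟯ S) (_ : IsIsotopicToId φ) (K : ℝ) (_ : 1 ≤ K)
    (_ : DilatationLE h₀ h₁ φ K), ENNReal.ofReal (1 / 2 * Real.log K)

/-- The Teichmüller norm of the time-zero derivative of the path in Teichmüller space given by
the conformal structures of the metrics `h t`: the speed at time zero of this path for the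
Teichmüller distance (the Finsler metric of the Teichmüller norm). -/
def teichSpeed (h : ℝ → RMetric 2 S) : ℝ≥0∞ :=
  limsup (fun t : ℝ => teichDist (h 0) (h t) / ENNReal.ofReal |t|) (𝓝[≠] 0)

end Teichmueller

section Surface

variable {M : Type*} [TopologicalSpace M] [ChartedSpace (E 3) M] [IsManifold (𝓡 3) ∞ M]
  {S : Type*} [TopologicalSpace S] [ChartedSpace (E 2) S] [IsManifold (𝓡 2) ∞ S]

/-- A smooth immersion of a surface in a 3-manifold. -/
def IsImmersedSurface (f : S → M) : Prop :=
  ContMDiff (𝓡 2) (𝓡 3) ∞ f ∧ ∀ x, Function.Injective (mfderiv (𝓡 2) (𝓡 3) f x)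

/-- A transverse orientation of the immersed surface `f`, given by a smooth vector field `ν`
along `f` that is nowhere tangent to the surface. -/
def IsTransverseOrientation (f : S → M) (ν : (x : S) → TangentSpace (𝓡 3) (f x)) : Prop :=
  ContMDiff (𝓡 2) (𝓡 3).tangent ∞ (fun x => (⟨f x, ν x⟩ : TangentBundle (𝓡 3) M)) ∧
  ∀ x u, mfderiv (𝓡 2) (𝓡 3) f x u ≠ ν x

/-- `N` is the unit normal vector of the surface `f` at `x`, on the side given by `ν`. -/
def IsUnitNormal (g : RMetric 3 M) (f : S → M) (ν : (x : S) → TangentSpace (𝓡 3) (f x))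
    (x : S) (N : TangentSpace (𝓡 3) (f x)) : Prop :=
  g.inner (f x) N N = 1 ∧ (∀ u, g.inner (f x) N (mfderiv (𝓡 2) (𝓡 3) f x u) = 0) ∧
    0 < g.inner (f x) N (ν x)

/-- The unit normal field of the transversally oriented surface `f` (at each point there is
exactly one unit normal on the given side). -/
def unitNormal (g : RMetric 3 M) (f : S → M) (ν : (x : S) → TangentSpace (𝓡 3) (f x))
    (x : S) : TangentSpace (𝓡 3) (f x) :=
  Classical.epsilon (IsUnitNormal g f ν x)

/-- The covariant derivative at `x`, in the direction `u`, of a vector field `V` along `f`, for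
the Levi-Civita connection of `g`. -/
def covDerivAlong (g : RMetric 3 M) (f : S → M) (V : (x : S) → TangentSpace (𝓡 3) (f x))
    (x : S) (u : TangentSpace (𝓡 2) x) : TangentSpace (𝓡 3) (f x) :=
  let W : S → E 3 := fun z =>
    mfderiv (𝓡 3) 𝓘(ℝ, E 3) (extChartAt (𝓡 3) (f x)) (f z) (V z)
  let DW : E 3 := mfderiv (𝓡 2) 𝓘(ℝ, E 3) W x u
  (DW + christoffelAt g (f x) (mfderiv (𝓡 2) (𝓡 3) f x u) (V x) : E 3)

/-- `B` is the shape operator at `x` of the surface `f` with unit normal field `N`: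
`B u = ∇_u N`, where tangent vectors of the surface are seen in `M` through `df`. -/
def IsShapeOperator (g : RMetric 3 M) (f : S → M) (ν : (x : S) → TangentSpace (𝓡 3) (f x))
    (x : S) (B : TangentSpace (𝓡 2) x →ₗ[ℝ] TangentSpace (𝓡 2) x) : Prop :=
  ∀ u, mfderiv (𝓡 2) (𝓡 3) f x (B u) = covDerivAlong g f (unitNormal g f ν) x u

/-- The shape operator (at each point of an immersed transversally oriented surface there is
exactly one endomorphism of the tangent plane with the defining property). -/
def shapeOperator (g : RMetric 3 M) (f : S → M) (ν : (x : S) → TangentSpace (𝓡 3) (f x))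
    (x : S) : TangentSpace (𝓡 2) x →ₗ[ℝ] TangentSpace (𝓡 2) x :=
  Classical.epsilon (IsShapeOperator g f ν x)

/-- `F` is the normal flow of the surface `f`: `r ↦ F r x` is the geodesic that starts at `f x`
with the unit normal as its initial velocity. -/
def IsNormalFlow (g : RMetric 3 M) (f : S → M) (ν : (x : S) → TangentSpace (𝓡 3) (f x))
    (F : ℝ → S → M) : Prop :=
  ContMDiff (𝓘(ℝ, ℝ).prod (𝓡 2)) (𝓡 3) ∞ (fun q : ℝ × S => F q.1 q.2) ∧
  ∀ x, IsGeodesic g (fun r => F r x) ∧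
    velocity (fun r => F r x) 0 = (⟨f x, unitNormal g f ν x⟩ : TangentBundle (𝓡 3) M)

/-- The pullback `I_r(u, u)`, to the surface, of the metric `g` by the map `F r`. -/
def pullbackSq (g : RMetric 3 M) (F : ℝ → S → M) (r : ℝ) (x : S) (u : TangentSpace (𝓡 2) x) :
    ℝ :=
  g.inner (F r x) (mfderiv (𝓡 2) (𝓡 3) (F r) x u) (mfderiv (𝓡 2) (𝓡 3) (F r) x u)

/-- The conformal class of the metric `h` on `S` is the conformal structure at infinity of the
surface `f`: the normal flow `F r` is an immersion for all `r ≥ 0`, and the conformal structures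
of the pullbacks of `g` by `F r` converge, as `r → ∞`, to the conformal structure of `h`.
Convergence of conformal structures at `x` is convergence of all ratios of squared lengths of
tangent vectors at `x`. -/
def IsConformalStructureAtInfinity (g : RMetric 3 M) (f : S → M)
    (ν : (x : S) → TangentSpace (𝓡 3) (f x)) (h : RMetric 2 S) : Prop :=
  ∃ F : ℝ → S → M, IsNormalFlow g f ν F ∧
    (∀ r : ℝ, 0 ≤ r → ∀ x, Function.Injective (mfderiv (𝓡 2) (𝓡 3) (F r) x)) ∧
    ∀ (x : S) (u v : TangentSpace (𝓡 2) x), v ≠ 0 →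
      Tendsto (fun r => pullbackSq g F r x u / pullbackSq g F r x v) atTop
        (𝓝 (h.inner x u u / h.inner x v v))

end Surface

end HypSurf

end

/-! ### Linear algebra of metrics, Christoffel symbols and Gauss' formula in Lorentz space -/

noncomputable section

namespace HypSurf

variable {n : ℕ}

/-! In the hyperboloid model a unit speed geodesic is cosh(r) A + sinh(r) A'. A local isometry Φ
turns the unit normal n into a field dΦ(n) of Lorentz vectors along the surface. By `gauss_formula`
its derivative along u is dΦ(∇_u n) plus ⟨df u, n⟩ Φ, and the last term is zero, so its differential
is dΦ ∘ df ∘ B. Differentiating the formula for geodesics gives (`NormalFlow.pullback_eq`) F_r^* g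
(u, u) = |df(cosh r u + sinh r Bu)|², that is, cosh² r times |df(1 + tanh(r) B)u|². Eigenvalues of B
above -1 make 1 + τB injective for τ in [0, 1]. So F_r is an immersion, and its conformal structures
converge to that of q(u) = |df(1 + B)u|² (`infSq`). As Σ is compact, the injectivity persists for t
near 0, and q_t depends smoothly on t.

The strain controls the derivative of q_t (`variation_bound`). Differentiating |n_t| = 1 and n_t ⟂
df gives n' = -2ηn + ⟨ηn, n⟩n. In coordinates the product of ∇_u n_t with df(v) is -⟨n_t, D²f(u, v)
+ Γ_t(df u, df v)⟩. Its time derivative involves that of Γ_t, which is a combination of three values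
of ∇η (`christoffel_dot`), while the second derivatives of f can be eliminated. So q' is bounded by
η and ∇η, times products of |u| and |(1 + B)u|. As B is self-adjoint with eigenvalues at least -1 +
1/k, |u| ≤ k|(1 + B)u| (`norm_le_stretch`), and therefore |q'| ≤ (8 + 12k) N q at time zero, where N
is the maximum of the two norms.

For every c > (8 + 12k) N the bound |q_t'| ≤ c q_t then holds for all t near 0
(`eventually_abs_deriv_infSq_le`). Integrating it, q_t(u)/q_0(u) lies between exp(-c|t|) and
exp(c|t|). So the identity of Σ has dilatation at most exp(c|t|) from ω_0 to ω_t, the Teichmüller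
distance is at most c|t|/2, and the speed is at most c/2. Letting c decrease gives C = 4 + 6k. Any
family of metrics that represents the ω_t has the same ratios of squared lengths as q_t, so the
choice of representatives does not matter.

Two points need care. Completeness provides each normal geodesic separately, without smooth
dependence on its starting point; `contMDiff_flow` recovers this by continuation through local
isometries. Unit normals and shape operators are arbitrary choices of objects with a defining
property; they become smooth through the explicit expressions `normalVec` and `covCoord`. -/

/-- The Euclidean inner product, as a bilinear form. -/
def innerBil (n : ℕ) : Bil n := innerSL ℝ

@[simp] lemma innerBil_apply (u v : E n) : innerBil n u v = ⟪u, v⟫ := rfl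

lemma two_le_infty : (2 : ℕ∞ω) ≤ (∞ : ℕ∞ω) :=
  WithTop.coe_le_coe.2 (le_top (a := (2 : ℕ∞)))

lemma one_add_one_le_infty : (1 + 1 : ℕ∞ω) ≤ (∞ : ℕ∞ω) :=
  WithTop.coe_le_coe.2 (le_top (a := (1 + 1 : ℕ∞)))

/-- The Lorentz form, as a continuous bilinear form. -/
def lorentzL (n : ℕ) : (ℝ × E n) →L[ℝ] (ℝ × E n) →L[ℝ] ℝ :=
  (innerBil n).bilinearComp (.snd ℝ ℝ (E n)) (.snd ℝ ℝ (E n)) -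
    (ContinuousLinearMap.mul ℝ ℝ).bilinearComp (.fst ℝ ℝ (E n)) (.fst ℝ ℝ (E n))

lemma lorentzL_apply (a b : ℝ × E n) : lorentzL n a b = lorentz a b := by
  simp [lorentzL, lorentz]

lemma lorentzL_comm (a b : ℝ × E n) : lorentzL n a b = lorentzL n b a := by
  simp only [lorentzL_apply, lorentz, real_inner_comm, mul_comm]

/-- A symmetric positive definite bilinear form. -/
structure IsInner (b : Bil n) : Prop where
  symm : ∀ u v, b u v = b v u
  pos : ∀ u, u ≠ 0 → 0 < b u u

lemma IsInner.nonneg {b : Bil n} (h : IsInner b) (u : E n) : 0 ≤ b u u := by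
  by_cases hu : u = 0
  · simp [hu]
  · exact (h.pos u hu).le

lemma IsInner.eq_zero {b : Bil n} (h : IsInner b) {u : E n} (hu : b u u = 0) : u = 0 := by
  by_contra hne
  exact (h.pos u hne).ne' hu

lemma IsInner.eq_of_forall {b : Bil n} (h : IsInner b) {u v : E n} (huv : ∀ w, b u w = b v w) :
    u = v := by
  rw [← sub_eq_zero]
  apply h.eq_zero
  rw [b.map_sub, sub_apply, huv, sub_self]

lemma IsInner.cauchy_schwarz {b : Bil n} (h : IsInner b) (u v : E n) :
    |b u v| ≤ √(b u u) * √(b v v) := by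
  rw [← Real.sqrt_mul (h.nonneg u)]
  apply Real.abs_le_sqrt
  have h0 : ∀ s : ℝ, 0 ≤ b v v * (s * s) + (2 * b u v) * s + b u u := by
    intro s
    have := h.nonneg (u + s • v)
    simp only [map_add, map_smul, add_apply, smul_apply, smul_eq_mul, h.symm v u] at this
    linarith
  have := discrim_le_zero h0
  rw [discrim] at this
  nlinarith

/-- `ContinuousLinearMap.inverse` is zero on maps that are not invertible, so `christoffel` and
`strainOf` have their intended meaning only through this fact. -/
lemma IsInner.isInvertible {b : Bil n} (h : IsInner b) : b.IsInvertible := by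
  have hinj : Function.Injective ((b : E n →L[ℝ] (E n →L[ℝ] ℝ)) : E n →ₗ[ℝ] (E n →L[ℝ] ℝ)) := by
    intro u v huv
    exact h.eq_of_forall fun w => by
      have := congrArg (fun l : E n →L[ℝ] ℝ => l w) huv
      exact this
  have hfr : Module.finrank ℝ (E n) = Module.finrank ℝ (E n →L[ℝ] ℝ) :=
    ((InnerProductSpace.toDual ℝ (E n)).toLinearEquiv.finrank_eq)
  let e := LinearEquiv.ofInjectiveOfFinrankEq _ hinj hfr
  exact ⟨e.toContinuousLinearEquiv, by ext u v; rfl⟩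

lemma IsInner.apply_inverse {b : Bil n} (h : IsInner b) (l : E n →L[ℝ] ℝ) (w : E n) :
    b (b.inverse l) w = l w := by
  rw [h.isInvertible.self_apply_inverse]

/-- The defining property of the Christoffel symbols. -/
lemma christoffel_spec {G : E n → Bil n} {y : E n} (h : IsInner (G y)) (u v w : E n) :
    G y (christoffel G y u v) w =
      1 / 2 * (fderiv ℝ G y u v w + fderiv ℝ G y v u w - fderiv ℝ G y w u v) := by
  rw [christoffel, h.apply_inverse]
  simp

lemma fderiv_symm {G : E n → Bil n} {y : E n} (hd : DifferentiableAt ℝ G y)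
    (hs : ∀ᶠ z in 𝓝 y, ∀ u v, G z u v = G z v u) (w u v : E n) :
    fderiv ℝ G y w u v = fderiv ℝ G y w v u := by
  have h1 : ∀ u v, HasFDerivAt (fun z => G z u v)
      (((ContinuousLinearMap.apply ℝ ℝ v).comp
        (ContinuousLinearMap.apply ℝ (E n →L[ℝ] ℝ) u)).comp (fderiv ℝ G y)) y := fun u v =>
    ((ContinuousLinearMap.apply ℝ ℝ v).comp
        (ContinuousLinearMap.apply ℝ (E n →L[ℝ] ℝ) u)).hasFDerivAt.comp y hd.hasFDerivAt
  have h2 := (h1 v u).congr_of_eventuallyEq (hs.mono fun z hz => hz u v)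
  have := congrArg (fun l : E n →L[ℝ] ℝ => l w) ((h1 u v).unique h2)
  simpa using this

lemma christoffel_symm {G : E n → Bil n} {y : E n} (h : IsInner (G y))
    (hd : DifferentiableAt ℝ G y) (hs : ∀ᶠ z in 𝓝 y, ∀ u v, G z u v = G z v u) (u v : E n) :
    christoffel G y u v = christoffel G y v u := by
  refine h.eq_of_forall fun w => ?_
  rw [christoffel_spec h, christoffel_spec h, fderiv_symm hd hs w u v]
  ring

/-- The Levi-Civita connection is metric: in the sum of the two Koszul expressions all derivatives
of G cancel in pairs, except D_u G(v, w). -/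
lemma metric_compat {G : E n → Bil n} {y : E n} (h : IsInner (G y))
    (hd : DifferentiableAt ℝ G y) (hs : ∀ᶠ z in 𝓝 y, ∀ u v, G z u v = G z v u) (u v w : E n) :
    fderiv ℝ G y u v w = G y (christoffel G y u v) w + G y v (christoffel G y u w) := by
  rw [h.symm v, christoffel_spec h, christoffel_spec h, fderiv_symm hd hs w u v,
    fderiv_symm hd hs u w v, fderiv_symm hd hs v u w]
  ring

/-- A vector of Lorentz space is determined by its products with a point of the hyperboloid and
with the tangent vectors at that point. -/
lemma lorentz_nondegenerate {a : ℝ × E n} (ha : lorentz a a = -1) {A : E n →L[ℝ] ℝ × E n}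
    (hA : ∀ w, w ≠ 0 → 0 < lorentzL n (A w) (A w)) (hperp : ∀ w, lorentzL n (A w) a = 0)
    {X : ℝ × E n} (hXa : lorentzL n X a = 0) (hXA : ∀ w, lorentzL n X (A w) = 0) : X = 0 := by
  rw [← lorentzL_apply] at ha
  let T : (ℝ × E n) →ₗ[ℝ] (ℝ × E n) :=
    { toFun := fun p => p.1 • a + A p.2
      map_add' := fun p q => by simp [add_smul]; abel
      map_smul' := fun c p => by simp [mul_smul] }
  have hinj : Function.Injective T := by
    rw [← LinearMap.ker_eq_bot, LinearMap.ker_eq_bot']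
    rintro ⟨s, w⟩ h
    have h' : s • a + A w = 0 := h
    have h1 := congrArg (fun b => lorentzL n b a) h'
    simp only [map_add, map_smul, add_apply, smul_apply, smul_eq_mul, ha, hperp, map_zero,
      zero_apply] at h1
    have hs : s = 0 := by linarith
    subst hs
    rw [zero_smul, zero_add] at h'
    have hw : w = 0 := by
      by_contra hw
      have := hA w hw
      simp [h'] at this
    simp [hw]
  have hsurj : Function.Surjective T := LinearMap.injective_iff_surjective.1 hinj
  have hall : ∀ Z, lorentzL n X Z = 0 := by
    intro Z
    obtain ⟨p, rfl⟩ := hsurj Z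
    change lorentzL n X (p.1 • a + A p.2) = 0
    simp [hXa, hXA]
  -- Reflecting the time coordinate turns the Lorentz product with X into the Euclidean square of X,
  -- which forces X = 0.
  have h1 := hall (-X.1, X.2)
  rw [lorentzL_apply, lorentz] at h1
  have h2 : ⟪X.2, X.2⟫ + X.1 * X.1 = 0 := by simpa using h1
  have h3 : 0 ≤ ⟪X.2, X.2⟫ := real_inner_self_nonneg
  have h4 : X.1 = 0 := by nlinarith [mul_self_nonneg X.1]
  have h5 : X.2 = 0 := by
    apply inner_self_eq_zero (𝕜 := ℝ).1
    nlinarith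
  exact Prod.ext h4 h5

/-- Gauss' formula for a local parametrization of hyperbolic space. -/
lemma gauss_formula {Ψ : E n → ℝ × E n} {G : E n → Bil n} {y : E n}
    (hΨ : ContDiffAt ℝ ∞ Ψ y) (hhyp : ∀ᶠ z in 𝓝 y, lorentz (Ψ z) (Ψ z) = -1)
    (hd : DifferentiableAt ℝ G y)
    (hG : ∀ᶠ z in 𝓝 y, ∀ u v, G z u v = lorentzL n (fderiv ℝ Ψ z u) (fderiv ℝ Ψ z v))
    (hpos : IsInner (G y)) (u v : E n) :
    fderiv ℝ (fderiv ℝ Ψ) y u v =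
      fderiv ℝ Ψ y (christoffel G y u v) + G y u v • Ψ y := by
  have hΨd : ∀ᶠ z in 𝓝 y, DifferentiableAt ℝ Ψ z := by
    have h1 : ContDiffAt ℝ 1 Ψ y := hΨ.of_le (by simp)
    filter_upwards [h1.eventually (by decide)] with z hz
    exact hz.differentiableAt (by simp)
  have hD : DifferentiableAt ℝ (fderiv ℝ Ψ) y :=
    (hΨ.fderiv_right (m := 1) one_add_one_le_infty).differentiableAt (by simp)
  have hDu : ∀ u, HasFDerivAt (fun z => fderiv ℝ Ψ z u)
      ((fderiv ℝ (fderiv ℝ Ψ) y).flip u) y := fun u => by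
    have := (ContinuousLinearMap.apply ℝ (ℝ × E n) u).hasFDerivAt.comp y hD.hasFDerivAt
    exact this
  have hsymm : ∀ u v, fderiv ℝ (fderiv ℝ Ψ) y u v = fderiv ℝ (fderiv ℝ Ψ) y v u := fun u v =>
    hΨ.isSymmSndFDerivAt (by simpa using two_le_infty) u v
  -- first-order relation
  have horth : ∀ᶠ z in 𝓝 y, ∀ u, lorentzL n (fderiv ℝ Ψ z u) (Ψ z) = 0 := by
    filter_upwards [hhyp.eventually_nhds, hΨd] with z hz hzd u
    have h1 := ((lorentzL n).hasFDerivAt_of_bilinear hzd.hasFDerivAt hzd.hasFDerivAt)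
    have h2 : HasFDerivAt (fun z => lorentzL n (Ψ z) (Ψ z)) (0 : E n →L[ℝ] ℝ) z :=
      (hasFDerivAt_const (-1 : ℝ) z).congr_of_eventuallyEq
        (hz.mono fun x hx => (lorentzL_apply _ _).trans hx)
    have h3 := congrArg (fun l : E n →L[ℝ] ℝ => l u) (h1.unique h2)
    simp [lorentzL_comm (Ψ z)] at h3
    linarith
  have h2nd : ∀ u v, lorentzL n (fderiv ℝ (fderiv ℝ Ψ) y u v) (Ψ y) = - G y u v := by
    intro u v
    have h1 := (lorentzL n).hasFDerivAt_of_bilinear (hDu v) hΨd.self_of_nhds.hasFDerivAt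
    have h2 : HasFDerivAt (fun z => lorentzL n (fderiv ℝ Ψ z v) (Ψ z)) (0 : E n →L[ℝ] ℝ) y :=
      (hasFDerivAt_const (0 : ℝ) y).congr_of_eventuallyEq (horth.mono fun x hx => hx v)
    have h3 := congrArg (fun l : E n →L[ℝ] ℝ => l u) (h1.unique h2)
    simp at h3
    rw [hG.self_of_nhds, lorentzL_comm (fderiv ℝ Ψ y u)]
    linarith
  have hGd : ∀ w u v, fderiv ℝ G y w u v =
      lorentzL n (fderiv ℝ (fderiv ℝ Ψ) y w u) (fderiv ℝ Ψ y v) +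
      lorentzL n (fderiv ℝ Ψ y u) (fderiv ℝ (fderiv ℝ Ψ) y w v) := by
    intro w u v
    have h1 := (lorentzL n).hasFDerivAt_of_bilinear (hDu u) (hDu v)
    have h2 : HasFDerivAt (fun z => G z u v)
      (((ContinuousLinearMap.apply ℝ ℝ v).comp
        (ContinuousLinearMap.apply ℝ (E n →L[ℝ] ℝ) u)).comp (fderiv ℝ G y)) y :=
      ((ContinuousLinearMap.apply ℝ ℝ v).comp
        (ContinuousLinearMap.apply ℝ (E n →L[ℝ] ℝ) u)).hasFDerivAt.comp y hd.hasFDerivAt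
    have h3 := h2.congr_of_eventuallyEq (f₁ := fun z =>
      lorentzL n (fderiv ℝ Ψ z u) (fderiv ℝ Ψ z v)) (hG.mono fun x hx => (hx u v).symm)
    have h4 := congrArg (fun l : E n →L[ℝ] ℝ => l w) (h3.unique h1)
    simp at h4
    linarith
  -- The difference of the two sides is Lorentz orthogonal to Ψ y by the differentiated relation
  -- ⟨DΨ, Ψ⟩ = 0, and to the tangent vectors by Koszul's formula applied to G = ⟨DΨ, DΨ⟩.
  rw [← sub_eq_zero]
  have hy := horth.self_of_nhds
  have hG' := hG.self_of_nhds
  have hhy := hhyp.self_of_nhds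
  apply lorentz_nondegenerate (A := fderiv ℝ Ψ y) hhy
  · intro w hw
    rw [← hG']
    exact hpos.pos w hw
  · exact hy
  · simp only [map_sub, map_add, map_smul, sub_apply, add_apply, smul_apply, h2nd, hy,
      smul_eq_mul, lorentzL_apply, hhy]
    ring
  · intro w
    simp only [map_sub, map_add, map_smul, sub_apply, add_apply, smul_apply,
      smul_eq_mul, lorentzL_comm (Ψ y), hy]
    rw [← hG', christoffel_spec hpos, hGd, hGd, hGd, hsymm v u, hsymm w u, hsymm w v,
      lorentzL_comm (fderiv ℝ Ψ y v), lorentzL_comm (fderiv ℝ Ψ y u) (fderiv ℝ (fderiv ℝ Ψ) y v w)]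
    ring

end HypSurf

end

/-! ### Strain and the variation of the Christoffel symbols -/

noncomputable section

namespace HypSurf

variable {n : ℕ}

lemma strainOf_spec {b : ℝ → Bil n} {t : ℝ} (h : IsInner (b t)) (u v : E n) :
    b t (strainOf b t u) v = 1 / 2 * deriv b t u v := by
  simp [strainOf, h.apply_inverse]

lemma IsInner.contDiffAt_inverse {b : Bil n} (h : IsInner b) {m : ℕ∞ω} :
    ContDiffAt ℝ m ContinuousLinearMap.inverse b := by
  obtain ⟨e, he⟩ := h.isInvertible
  rw [← he]
  exact contDiffAt_map_inverse e

/-- A family of continuous linear maps on a finite-dimensional space is smooth at a point if all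
its applications are. -/
lemma contDiffAt_clm_of_apply {D X Y : Type*} [NormedAddCommGroup D] [NormedSpace ℝ D]
    [NormedAddCommGroup X] [NormedSpace ℝ X] [FiniteDimensional ℝ X]
    [NormedAddCommGroup Y] [NormedSpace ℝ Y] {m : ℕ∞ω} {f : D → X →L[ℝ] Y} {x : D}
    (h : ∀ u, ContDiffAt ℝ m (fun z => f z u) x) : ContDiffAt ℝ m f x := by
  let e₁ := ContinuousLinearEquiv.ofFinrankEq
    (Module.finrank_fin_fun ℝ (n := Module.finrank ℝ X)).symm
  let e₂ := (e₁.arrowCongr (1 : Y ≃L[ℝ] Y)).trans (ContinuousLinearEquiv.piRing _)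
  have h1 : ContDiffAt ℝ m (fun z => e₂ (f z)) x := contDiffAt_pi.2 fun i => h _
  have h2 : f = fun z => e₂.symm (e₂ (f z)) := by
    ext z : 1
    simp
  rw [h2]
  exact e₂.symm.contDiff.contDiffAt.comp x h1

section Family

variable {G : ℝ → E n → Bil n} {t₀ : ℝ} {y : E n}

lemma eventually_differentiableAt_of_infty {X Y : Type*} [NormedAddCommGroup X] [NormedSpace ℝ X]
    [NormedAddCommGroup Y] [NormedSpace ℝ Y] {f : X → Y} {x : X} (h : ContDiffAt ℝ ∞ f x) :
    ∀ᶠ z in 𝓝 x, DifferentiableAt ℝ f z := by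
  have h1 : ContDiffAt ℝ 1 f x := h.of_le (by simp)
  filter_upwards [h1.eventually (by decide)] with z hz
  exact hz.differentiableAt (by simp)

lemma fderiv_slice {X Y : Type*} [NormedAddCommGroup X] [NormedSpace ℝ X]
    [NormedAddCommGroup Y] [NormedSpace ℝ Y] {f : ℝ → X → Y} {t : ℝ} {x : X}
    (h : DifferentiableAt ℝ (fun q : ℝ × X => f q.1 q.2) (t, x)) (w : X) :
    HasFDerivAt (f t) ((fderiv ℝ (fun q : ℝ × X => f q.1 q.2) (t, x)).comp
      (ContinuousLinearMap.inr ℝ ℝ X)) x ∧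
    fderiv ℝ (f t) x w = fderiv ℝ (fun q : ℝ × X => f q.1 q.2) (t, x) (0, w) := by
  have h1 : HasFDerivAt (f t) ((fderiv ℝ (fun q : ℝ × X => f q.1 q.2) (t, x)).comp
      (ContinuousLinearMap.inr ℝ ℝ X)) x :=
    h.hasFDerivAt.comp x (hasFDerivAt_prodMk_right t x)
  exact ⟨h1, by rw [h1.fderiv]; rfl⟩

lemma deriv_slice {X Y : Type*} [NormedAddCommGroup X] [NormedSpace ℝ X]
    [NormedAddCommGroup Y] [NormedSpace ℝ Y] {f : ℝ → X → Y} {t : ℝ} {x : X}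
    (h : DifferentiableAt ℝ (fun q : ℝ × X => f q.1 q.2) (t, x)) :
    HasDerivAt (fun s => f s x) (fderiv ℝ (fun q : ℝ × X => f q.1 q.2) (t, x) (1, 0)) t := by
  have h1 : HasFDerivAt (fun s => f s x) ((fderiv ℝ (fun q : ℝ × X => f q.1 q.2) (t, x)).comp
      (ContinuousLinearMap.inl ℝ ℝ X)) t :=
    HasFDerivAt.comp (g := fun q : ℝ × X => f q.1 q.2) (f := fun e : ℝ => (e, x)) t h.hasFDerivAt
      (hasFDerivAt_prodMk_left t x)
  exact h1.hasDerivAt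

/-- The Christoffel symbols of a smooth family of metrics are smooth. -/
lemma ContDiffAt.christoffel {X : Type*} [NormedAddCommGroup X] [NormedSpace ℝ X] {x : X}
    {τ : X → ℝ} {p u v : X → E n}
    (hG : ContDiffAt ℝ ∞ (fun q : ℝ × E n => G q.1 q.2) (τ x, p x)) (hin : IsInner (G (τ x) (p x)))
    (hτ : ContDiffAt ℝ ∞ τ x) (hp : ContDiffAt ℝ ∞ p x) (hu : ContDiffAt ℝ ∞ u x)
    (hv : ContDiffAt ℝ ∞ v x) :
    ContDiffAt ℝ ∞ (fun z => christoffel (G (τ z)) (p z) (u z) (v z)) x := by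
  set 𝒢 := fun q : ℝ × E n => G q.1 q.2 with h𝒢
  have hq : ContDiffAt ℝ ∞ (fun z => (τ z, p z)) x := hτ.prodMk hp
  have hD : ContDiffAt ℝ ∞ (fun z => (fderiv ℝ 𝒢 (τ z, p z)).comp
      (ContinuousLinearMap.inr ℝ ℝ (E n))) x := by
    have h1 : ContDiffAt ℝ ∞ (fderiv ℝ 𝒢) (τ x, p x) := hG.fderiv_right (by simp)
    exact (h1.comp x hq).clm_comp contDiffAt_const
  have hinv : ContDiffAt ℝ ∞ (fun z => (𝒢 (τ z, p z)).inverse) x := by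
    have h1 : ContDiffAt ℝ ∞ (fun z => 𝒢 (τ z, p z)) x :=
      ContDiffAt.comp (g := 𝒢) x hG hq
    exact ContDiffAt.comp x (hin.contDiffAt_inverse) h1
  set D := fun z => (fderiv ℝ 𝒢 (τ z, p z)).comp (ContinuousLinearMap.inr ℝ ℝ (E n)) with hDdef
  have hDapp : ∀ (a b c : X → E n), ContDiffAt ℝ ∞ a x → ContDiffAt ℝ ∞ b x →
      ContDiffAt ℝ ∞ c x → ContDiffAt ℝ ∞ (fun z => D z (a z) (b z) (c z)) x :=
    fun a b c ha hb hc => ((hD.clm_apply ha).clm_apply hb).clm_apply hc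
  -- The differential of a slice of the family is the total differential restricted to spatial
  -- directions, and the latter is visibly smooth in all variables.
  have hnice : ∀ᶠ z in 𝓝 x, fderiv ℝ (G (τ z)) (p z) = D z := by
    have h1 : Tendsto (fun z => (τ z, p z)) (𝓝 x) (𝓝 (τ x, p x)) := hq.continuousAt
    filter_upwards [h1.eventually (eventually_differentiableAt_of_infty hG)] with z hz
    exact (fderiv_slice hz 0).1.fderiv
  have hl : ContDiffAt ℝ ∞ (fun z => (1 / 2 : ℝ) • (D z (u z) (v z) + D z (v z) (u z) -
      ((D z).flip (u z)).flip (v z))) x := by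
    apply contDiffAt_clm_of_apply
    intro w
    simp only [smul_apply, sub_apply, add_apply, ContinuousLinearMap.flip_apply, smul_eq_mul]
    exact contDiffAt_const.mul (((hDapp _ _ _ hu hv contDiffAt_const).add
      (hDapp _ _ _ hv hu contDiffAt_const)).sub (hDapp _ _ _ contDiffAt_const hu hv))
  refine (hinv.clm_apply hl).congr_of_eventuallyEq ?_
  filter_upwards [hnice] with z hz
  simp only [HypSurf.christoffel, hz, h𝒢]

/-- The covariant derivative `(∇_u η) v` of the strain of a family of metrics on an open set. -/
def covStrain (G : ℝ → E n → Bil n) (t : ℝ) (y u v : E n) : E n :=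
  fderiv ℝ (fun z => strainOf (fun s => G s z) t) y u v +
    christoffel (G t) y u (strainOf (fun s => G s y) t v) -
    strainOf (fun s => G s y) t (christoffel (G t) y u v)

variable (hG : ContDiffAt ℝ ∞ (fun q : ℝ × E n => G q.1 q.2) (t₀, y))
  (hin : ∀ᶠ q in 𝓝 (t₀, y), IsInner (G q.1 q.2))

include hG in
lemma hasDerivAt_family : HasDerivAt (fun t => G t y) (deriv (fun t => G t y) t₀) t₀ :=
  (deriv_slice (hG.differentiableAt (by simp))).differentiableAt.hasDerivAt

-- Differentiate G(ηu, v) = ½ ∂_t G(u, v) in the direction w. The symmetry of second derivatives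
-- then lets the time derivative of D_w G be expressed by η and Dη.
include hG hin in
lemma fderiv_deriv_eq (u v w : E n) :
    1 / 2 * fderiv ℝ (fderiv ℝ (fun q : ℝ × E n => G q.1 q.2)) (t₀, y) (1, 0) (0, w) u v =
      fderiv ℝ (G t₀) y w (strainOf (fun s => G s y) t₀ u) v +
      G t₀ y (fderiv ℝ (fun z => strainOf (fun s => G s z) t₀) y w u) v := by
  set 𝒢 := fun q : ℝ × E n => G q.1 q.2 with h𝒢
  have hsl : Tendsto (fun z : E n => (t₀, z)) (𝓝 y) (𝓝 (t₀, y)) :=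
    (Continuous.prodMk_right t₀).tendsto y
  have hsl' : ContDiffAt ℝ ∞ (fun z : E n => (t₀, z)) y := contDiffAt_const.prodMk contDiffAt_id
  have hiny : ∀ᶠ z in 𝓝 y, IsInner (G t₀ z) := hsl.eventually hin
  have hdG : DifferentiableAt ℝ 𝒢 (t₀, y) := hG.differentiableAt (by simp)
  have hD2 : ContDiffAt ℝ ∞ (fderiv ℝ 𝒢) (t₀, y) := hG.fderiv_right (by simp)
  have hdD : DifferentiableAt ℝ (fderiv ℝ 𝒢) (t₀, y) := hD2.differentiableAt (by simp)
  have hdot : ∀ᶠ z in 𝓝 y, deriv (fun s => G s z) t₀ = fderiv ℝ 𝒢 (t₀, z) (1, 0) := by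
    filter_upwards [hsl.eventually (eventually_differentiableAt_of_infty hG)] with z hz
    exact (deriv_slice hz).deriv
  have hη : DifferentiableAt ℝ (fun z => strainOf (fun s => G s z) t₀) y := by
    have h1 : ContDiffAt ℝ ∞ (fun z => (G t₀ z).inverse.comp
        ((1 / 2 : ℝ) • fderiv ℝ 𝒢 (t₀, z) (1, 0))) y := by
      have h2 : ContDiffAt ℝ ∞ (fun z => G t₀ z) y := hG.comp y hsl'
      have h3 : ContDiffAt ℝ ∞ (fun z => (G t₀ z).inverse) y :=
        ContDiffAt.comp y (hin.self_of_nhds.contDiffAt_inverse) h2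
      have h4 : ContDiffAt ℝ ∞ (fun z => fderiv ℝ 𝒢 (t₀, z) (1, 0)) y :=
        (ContDiffAt.comp y hD2 hsl').clm_apply contDiffAt_const
      exact h3.clm_comp (h4.const_smul (1 / 2 : ℝ))
    refine (h1.congr_of_eventuallyEq ?_).differentiableAt (by simp)
    filter_upwards [hdot] with z hz
    simp only [strainOf, hz]
  have hη' : HasFDerivAt (fun z => strainOf (fun s => G s z) t₀ u)
      ((fderiv ℝ (fun z => strainOf (fun s => G s z) t₀) y).flip u) y :=
    (ContinuousLinearMap.apply ℝ (E n) u).hasFDerivAt.comp y hη.hasFDerivAt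
  have hGy := (fderiv_slice hdG 0).1
  have h5 := (hGy.clm_apply hη').clm_apply (hasFDerivAt_const v y)
  have h6 : HasFDerivAt (fun z => fderiv ℝ 𝒢 (t₀, z) (1, 0))
      (((fderiv ℝ (fderiv ℝ 𝒢) (t₀, y)).comp (ContinuousLinearMap.inr ℝ ℝ (E n))).flip (1, 0)) y :=
    (ContinuousLinearMap.apply ℝ (Bil n) ((1 : ℝ), (0 : E n))).hasFDerivAt.comp y
      (hdD.hasFDerivAt.comp y (hasFDerivAt_prodMk_right t₀ y))
  have h7 := (((h6.clm_apply (hasFDerivAt_const u y)).clm_apply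
    (hasFDerivAt_const v y)).const_mul (1 / 2 : ℝ))
  have h8 := h7.congr_of_eventuallyEq (f₁ := fun z => G t₀ z (strainOf (fun s => G s z) t₀ u) v) (by
    filter_upwards [hdot, hiny] with z hz hz'
    rw [strainOf_spec (b := fun s => G s z) hz', hz])
  have h9 := congrArg (fun l : E n →L[ℝ] ℝ => l w) (h5.unique h8)
  have hsymm := hG.isSymmSndFDerivAt (by simpa using two_le_infty) (1, 0) (0, w)
  rw [hGy.fderiv, hsymm]
  simp at h9
  simp
  linarith

include hG hin in
/-- The variation of the Christoffel symbols of a family of metrics. -/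
lemma christoffel_dot (u v w : E n) :
    HasDerivAt (fun t => G t y (christoffel (G t) y u v) w)
      (2 * G t₀ y (strainOf (fun s => G s y) t₀ (christoffel (G t₀) y u v)) w +
        (G t₀ y (covStrain G t₀ y u v) w + G t₀ y (covStrain G t₀ y v u) w -
          G t₀ y (covStrain G t₀ y w u) v)) t₀ := by
  set 𝒢 := fun q : ℝ × E n => G q.1 q.2 with h𝒢
  have hsl : Tendsto (fun s : ℝ => (s, y)) (𝓝 t₀) (𝓝 (t₀, y)) :=
    (Continuous.prodMk_left y).tendsto t₀
  have hsl2 : Tendsto (fun z : E n => (t₀, z)) (𝓝 y) (𝓝 (t₀, y)) :=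
    (Continuous.prodMk_right t₀).tendsto y
  have hint : ∀ᶠ s in 𝓝 t₀, IsInner (G s y) := hsl.eventually hin
  have hI : IsInner (G t₀ y) := hin.self_of_nhds
  have hs0 : ∀ᶠ z in 𝓝 y, ∀ u v, G t₀ z u v = G t₀ z v u :=
    (hsl2.eventually hin).mono fun z hz => hz.symm
  have hd0 : DifferentiableAt ℝ (G t₀) y :=
    (fderiv_slice (hG.differentiableAt (by simp)) 0).1.differentiableAt
  have hD2 : ContDiffAt ℝ ∞ (fderiv ℝ 𝒢) (t₀, y) := hG.fderiv_right (by simp)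
  have hdD : DifferentiableAt ℝ (fderiv ℝ 𝒢) (t₀, y) := hD2.differentiableAt (by simp)
  have hDt : ∀ a b c, HasDerivAt (fun s => fderiv ℝ (G s) y a b c)
      (fderiv ℝ (fderiv ℝ 𝒢) (t₀, y) (1, 0) (0, a) b c) t₀ := by
    intro a b c
    have h1 : HasDerivAt (fun s => fderiv ℝ 𝒢 (s, y)) (fderiv ℝ (fderiv ℝ 𝒢) (t₀, y) (1, 0)) t₀ := by
      have : HasFDerivAt (fun s => fderiv ℝ 𝒢 (s, y))
          ((fderiv ℝ (fderiv ℝ 𝒢) (t₀, y)).comp (ContinuousLinearMap.inl ℝ ℝ (E n))) t₀ :=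
        hdD.hasFDerivAt.comp t₀ (hasFDerivAt_prodMk_left t₀ y)
      exact this.hasDerivAt
    have h2 := ((h1.clm_apply (hasDerivAt_const t₀ ((0 : ℝ), a))).clm_apply
      (hasDerivAt_const t₀ b)).clm_apply (hasDerivAt_const t₀ c)
    simp only [map_zero, add_zero] at h2
    refine h2.congr_of_eventuallyEq ?_
    filter_upwards [hsl.eventually (eventually_differentiableAt_of_infty hG)] with s hs
    rw [(fderiv_slice hs a).2]
  have hmain := (((hDt u v w).add (hDt v u w)).sub (hDt w u v)).const_mul (1 / 2 : ℝ)
  have hmain' := hmain.congr_of_eventuallyEq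
    (f₁ := fun t => G t y (christoffel (G t) y u v) w)
    (hint.mono fun s hs => christoffel_spec hs u v w)
  refine hmain'.congr_deriv ?_
  have hηs : ∀ a b, G t₀ y (strainOf (fun s => G s y) t₀ a) b =
      G t₀ y (strainOf (fun s => G s y) t₀ b) a := by
    intro a b
    rw [strainOf_spec (b := fun s => G s y) hI, strainOf_spec (b := fun s => G s y) hI]
    have h1 := ((hasDerivAt_family hG).clm_apply (hasDerivAt_const t₀ a)).clm_apply
      (hasDerivAt_const t₀ b)
    have h2 := ((hasDerivAt_family hG).clm_apply (hasDerivAt_const t₀ b)).clm_apply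
      (hasDerivAt_const t₀ a)
    have h3 := h1.unique (h2.congr_of_eventuallyEq (hint.mono fun s hs => hs.symm a b))
    simp at h3
    rw [h3]
  -- These are the time derivatives of the three terms of Koszul's formula. `metric_compat` rewrites
  -- their DG parts by Christoffel symbols, which complete Dη to ∇η; what remains is 2⟨ηΓ(u, v), w⟩.
  have e1 := fderiv_deriv_eq hG hin v w u
  have e2 := fderiv_deriv_eq hG hin u w v
  have e3 := fderiv_deriv_eq hG hin u v w
  rw [metric_compat hI hd0 hs0] at e1 e2 e3
  simp only [covStrain, map_add, map_sub, add_apply, sub_apply]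
  rw [christoffel_symm hI hd0 hs0 w v] at e3
  rw [christoffel_symm hI hd0 hs0 w u, hηs (christoffel (G t₀) y u w) v]
  rw [christoffel_symm hI hd0 hs0 v u]
  rw [← h𝒢] at e1 e2 e3
  have e4 := hI.symm (strainOf (fun s => G s y) t₀ v) (christoffel (G t₀) y u w)
  have e5 := hI.symm (strainOf (fun s => G s y) t₀ u) (christoffel (G t₀) y v w)
  have e6 := hηs (christoffel (G t₀) y u w) v
  have e7 := hI.symm (christoffel (G t₀) y u w) (strainOf (fun s => G s y) t₀ v)
  linarith

end Family

end HypSurf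

end

/-! ### First variation of the squared length of (1 + B)u -/

noncomputable section

namespace HypSurf

variable {n : ℕ}

lemma IsInner.sqrt_triangle_sub {b : Bil n} (h : IsInner b) (u v : E n) :
    √(b (u - v) (u - v)) ≤ √(b u u) + √(b v v) := by
  have h1 := (abs_le.1 (h.cauchy_schwarz u v)).1
  have hu := Real.sq_sqrt (h.nonneg u)
  have hv := Real.sq_sqrt (h.nonneg v)
  apply Real.sqrt_le_iff.2
  refine ⟨by positivity, ?_⟩
  simp only [map_sub, sub_apply, h.symm v u]
  nlinarith

variable {G : ℝ → E n → Bil n} {t₀ : ℝ} {y : E n}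

/-- The variation of the pullback of a family of metrics by the "endpoint map" `1 + B` of a
hypersurface with shape operator `B`, in terms of the strain and of its covariant derivative. -/
lemma variation_bound {V : Type*} (hG : ContDiffAt ℝ ∞ (fun q : ℝ × E n => G q.1 q.2) (t₀, y))
    (hin : ∀ᶠ q in 𝓝 (t₀, y), IsInner (G q.1 q.2))
    {A : V → E n} {N : ℝ → E n} {N' : E n} (hN : HasDerivAt N N' t₀)
    (hN1 : ∀ᶠ t in 𝓝 t₀, G t y (N t) (N t) = 1)
    (hNA : ∀ᶠ t in 𝓝 t₀, ∀ v, G t y (N t) (A v) = 0)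
    (hspan : ∀ X, (∀ v, G t₀ y X (A v) = 0) → G t₀ y X (N t₀) = 0 → X = 0)
    {u v : V} {w : ℝ → E n} {w' : E n} (hw : HasDerivAt w w' t₀) {X : V → E n}
    (hII : ∀ᶠ t in 𝓝 t₀, ∀ v, G t y (w t) (A v) =
      - G t y (N t) (X v + christoffel (G t) y (A u) (A v)))
    (huv : A u + w t₀ = A v) {H H' k : ℝ} (hH0 : 0 ≤ H) (hH0' : 0 ≤ H') (hk0 : 0 ≤ k)
    (hH : ∀ x, √(G t₀ y (strainOf (fun s => G s y) t₀ x) (strainOf (fun s => G s y) t₀ x)) ≤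
      H * √(G t₀ y x x))
    (hH' : ∀ x z, √(G t₀ y (covStrain G t₀ y x z) (covStrain G t₀ y x z)) ≤
      H' * (√(G t₀ y x x) * √(G t₀ y z z)))
    (hk : √(G t₀ y (A u) (A u)) ≤ k * √(G t₀ y (A v) (A v))) :
    ∃ Q' : ℝ, HasDerivAt (fun t => G t y (A u + w t) (A u + w t)) Q' t₀ ∧
      |Q'| ≤ ((8 + 6 * k) * H + 6 * k * H') * G t₀ y (A v) (A v) := by
  have hI : IsInner (G t₀ y) := hin.self_of_nhds
  have hsl : Tendsto (fun s : ℝ => (s, y)) (𝓝 t₀) (𝓝 (t₀, y)) :=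
    (Continuous.prodMk_left y).tendsto t₀
  have hint : ∀ᶠ s in 𝓝 t₀, IsInner (G s y) := hsl.eventually hin
  set η := strainOf (fun s => G s y) t₀ with hη
  set G' := deriv (fun t => G t y) t₀ with hG'
  have hGd : HasDerivAt (fun t => G t y) G' t₀ := hasDerivAt_family hG
  have hηG : ∀ a b, G' a b = 2 * G t₀ y (η a) b := by
    intro a b
    rw [hη, strainOf_spec (b := fun s => G s y) hI]
    ring
  have happ : ∀ {a b : ℝ → E n} {a' b' : E n}, HasDerivAt a a' t₀ → HasDerivAt b b' t₀ →
      HasDerivAt (fun t => G t y (a t) (b t))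
        (2 * G t₀ y (η (a t₀)) (b t₀) + G t₀ y a' (b t₀) + G t₀ y (a t₀) b') t₀ := by
    intro a b a' b' ha hb
    refine ((hGd.clm_apply ha).clm_apply hb).congr_deriv ?_
    simp [hηG]
  have hηs : ∀ a b, G t₀ y (η a) b = G t₀ y (η b) a := by
    intro a b
    have h1 := happ (hasDerivAt_const t₀ a) (hasDerivAt_const t₀ b)
    have h2 := happ (hasDerivAt_const t₀ b) (hasDerivAt_const t₀ a)
    have h3 := h1.unique (h2.congr_of_eventuallyEq (hint.mono fun s hs => hs.symm a b))
    simp at h3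
    exact h3
  set N₀ := N t₀ with hN₀
  have hN₀1 : G t₀ y N₀ N₀ = 1 := hN1.self_of_nhds
  have hN₀A : ∀ v, G t₀ y N₀ (A v) = 0 := hNA.self_of_nhds
  -- the variation of the normal
  set c := G t₀ y (η N₀) N₀ with hc
  have hN'N : G t₀ y N' N₀ = - c := by
    have h1 := (happ hN hN).unique ((hasDerivAt_const t₀ (1 : ℝ)).congr_of_eventuallyEq hN1)
    rw [hI.symm (N t₀) N'] at h1
    linarith
  have hN'A : ∀ v, G t₀ y N' (A v) = - 2 * G t₀ y (η N₀) (A v) := by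
    intro v
    have h1 := (happ hN (hasDerivAt_const t₀ (A v))).unique
      ((hasDerivAt_const t₀ (0 : ℝ)).congr_of_eventuallyEq (hNA.mono fun t ht => ht v))
    simp at h1
    linarith
  -- Both sides have the same products with the tangent plane and with N₀, and `hspan` says that
  -- these products determine a vector.
  have hN' : N' = (-2 : ℝ) • η N₀ + c • N₀ := by
    rw [← sub_eq_zero]
    apply hspan
    · intro v
      simp [hN'A, hN₀A]
    · simp [hN'N, hN₀1, ← hc]
      ring
  -- the variation of the second fundamental form
  set a := A u with ha
  set b := A v with hb
  set Γ := christoffel (G t₀) y a b with hΓ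
  set Nt := G t₀ y (covStrain G t₀ y a b) N₀ + G t₀ y (covStrain G t₀ y b a) N₀ -
          G t₀ y (covStrain G t₀ y N₀ a) b with hNt
  have hΓsm : ∃ Γ', HasDerivAt (fun t => christoffel (G t) y a b) Γ' t₀ := by
    have h1 : ContDiffAt ℝ ∞ (fun t => christoffel (G t) y a b) t₀ :=
      ContDiffAt.christoffel (τ := fun t => t) (p := fun _ => y) (u := fun _ => a) (v := fun _ => b)
        hG hI contDiffAt_id contDiffAt_const contDiffAt_const contDiffAt_const
    exact ⟨_, (h1.differentiableAt (by simp)).hasDerivAt⟩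
  obtain ⟨Γ', hΓ'⟩ := hΓsm
  have hΓN : G t₀ y N₀ Γ' = Nt := by
    have h1 := (happ hΓ' (hasDerivAt_const t₀ N₀)).unique (christoffel_dot hG hin a b N₀)
    simp only [map_zero, add_zero, ← hη, ← hΓ] at h1
    rw [hI.symm]
    linarith
  -- In the derivative of the right side of `hII`, the terms 2⟨ηN, ·⟩ + ⟨N', ·⟩ add up to c⟨N, ·⟩ by
  -- `hN'`. This is applied to X v + Γ, so by `hII` it equals -c⟨w, b⟩: the second derivatives X of
  -- the surface, over which there is no control, drop out.
  have hw'b : G t₀ y w' b = c * G t₀ y (w t₀) b - Nt - 2 * G t₀ y (η (w t₀)) b := by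
    have h1 := happ hw (hasDerivAt_const t₀ b)
    have h2 := (happ hN (hΓ'.const_add (X v))).neg
    have h3 := h1.unique (h2.congr_of_eventuallyEq (hII.mono fun t ht => ht v))
    have h4 := hII.self_of_nhds v
    simp only [← hN₀, ← hb, ← hΓ, map_zero, add_zero, hΓN, hN', map_add, map_smul,
      add_apply, smul_apply, smul_eq_mul] at h3 h4
    linear_combination h3 - c * h4
  refine ⟨_, happ (hw.const_add a) (hw.const_add a), ?_⟩
  -- At time t₀ the vector A u + w is the tangent vector b, so w' enters only through its product
  -- with b.
  rw [huv, hI.symm b w', hw'b]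
  have hwb : w t₀ = b - a := eq_sub_of_add_eq' huv
  set β := √(G t₀ y b b) with hβ
  have hβ0 : 0 ≤ β := Real.sqrt_nonneg _
  have hβ2 : G t₀ y b b = β * β := (Real.mul_self_sqrt (hI.nonneg b)).symm
  have hN₀l : √(G t₀ y N₀ N₀) = 1 := by rw [hN₀1, Real.sqrt_one]
  have hwl : √(G t₀ y (w t₀) (w t₀)) ≤ (1 + k) * β := by
    rw [hwb]
    linarith [hI.sqrt_triangle_sub b a]
  have hCS : ∀ {x z : E n} {p q : ℝ}, √(G t₀ y x x) ≤ p → √(G t₀ y z z) ≤ q →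
      |G t₀ y x z| ≤ p * q := fun {x z p q} hx hz =>
    (hI.cauchy_schwarz x z).trans (mul_le_mul hx hz (Real.sqrt_nonneg _)
      ((Real.sqrt_nonneg _).trans hx))
  have b1 : |G t₀ y (η b) b| ≤ H * β * β := hCS (hH b) le_rfl
  have b2 : |c| ≤ H := by
    have := hCS (hH N₀) hN₀l.le
    rwa [hN₀l, mul_one, mul_one] at this
  have b3 : |G t₀ y (w t₀) b| ≤ (1 + k) * β * β := hCS hwl le_rfl
  have b4 : |G t₀ y (η (w t₀)) b| ≤ H * ((1 + k) * β) * β :=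
    hCS ((hH _).trans (mul_le_mul_of_nonneg_left hwl hH0)) le_rfl
  have hkβ : 0 ≤ k * β := by positivity
  have b5 : |G t₀ y (covStrain G t₀ y a b) N₀| ≤ H' * ((k * β) * β) * 1 := by
    refine hCS ((hH' _ _).trans ?_) hN₀l.le
    exact mul_le_mul_of_nonneg_left (mul_le_mul_of_nonneg_right hk hβ0) hH0'
  have b6 : |G t₀ y (covStrain G t₀ y b a) N₀| ≤ H' * (β * (k * β)) * 1 := by
    refine hCS ((hH' _ _).trans ?_) hN₀l.le
    exact mul_le_mul_of_nonneg_left (mul_le_mul_of_nonneg_left hk hβ0) hH0'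
  have b7 : |G t₀ y (covStrain G t₀ y N₀ a) b| ≤ H' * (1 * (k * β)) * β := by
    refine hCS ((hH' _ _).trans ?_) le_rfl
    rw [hN₀l]
    exact mul_le_mul_of_nonneg_left (mul_le_mul_of_nonneg_left hk zero_le_one) hH0'
  have b8 : |c * G t₀ y (w t₀) b| ≤ H * ((1 + k) * β * β) := by
    rw [abs_mul]
    exact mul_le_mul b2 b3 (abs_nonneg _) hH0
  rw [hβ2]
  rw [abs_le] at b1 b4 b5 b6 b7 b8 ⊢
  obtain ⟨b1, b1'⟩ := b1
  obtain ⟨b4, b4'⟩ := b4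
  obtain ⟨b5, b5'⟩ := b5
  obtain ⟨b6, b6'⟩ := b6
  obtain ⟨b7, b7'⟩ := b7
  obtain ⟨b8, b8'⟩ := b8
  -- The constant: 2H from ⟨ηb, b⟩, then 2(1 + k)H from c⟨w, b⟩ and 4(1 + k)H from ⟨ηw, b⟩, then
  -- 2kH' from each of the three values of ∇η.
  constructor
  · linear_combination 2 * b1 + 2 * b8 + 2 * b5' + 2 * b6' + 2 * b7 + 4 * b4'
  · linear_combination 2 * b1' + 2 * b8' + 2 * b5 + 2 * b6 + 2 * b7' + 4 * b4

end HypSurf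

end

/-! ### Metrics and vector fields in charts -/

noncomputable section

namespace HypSurf

variable {n : ℕ} {M : Type*} [TopologicalSpace M] [ChartedSpace (E n) M] [IsManifold (𝓡 n) ∞ M]

lemma isManifold_one (n : ℕ) (M : Type*) [TopologicalSpace M] [ChartedSpace (E n) M]
    [IsManifold (𝓡 n) ∞ M] : IsManifold (𝓡 n) 1 M :=
  IsManifold.of_le (n := ∞) (by simp)

/-- The differential at `q` of the preferred chart at `p`. -/
def dchart (p q : M) : E n →L[ℝ] E n := mfderiv (𝓡 n) 𝓘(ℝ, E n) (extChartAt (𝓡 n) p) q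

/-- The differential at `y` of the inverse of the preferred chart at `p`. -/
def dchartInv (p : M) (y : E n) : E n →L[ℝ] E n :=
  mfderiv 𝓘(ℝ, E n) (𝓡 n) (extChartAt (𝓡 n) p).symm y

/-- The inner product of a Riemannian metric at a point, as a bilinear form on `E n`. -/
def metricAt (g : RMetric n M) (q : M) : Bil n := g.inner q

lemma metricAt_isInner (g : RMetric n M) (q : M) : IsInner (metricAt g q) :=
  ⟨g.symm q, g.pos q⟩

lemma contMDiffAt_chart {p q : M} (hq : q ∈ (extChartAt (𝓡 n) p).source) :
    ContMDiffAt (𝓡 n) 𝓘(ℝ, E n) ∞ (extChartAt (𝓡 n) p) q :=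
  contMDiffAt_extChartAt' (by rwa [← extChartAt_source (𝓡 n)])

lemma contMDiffAt_chartInv {p : M} {y : E n} (hy : y ∈ (extChartAt (𝓡 n) p).target) :
    ContMDiffAt 𝓘(ℝ, E n) (𝓡 n) ∞ (extChartAt (𝓡 n) p).symm y :=
  (contMDiffOn_extChartAt_symm p).contMDiffAt ((isOpen_extChartAt_target p).mem_nhds hy)

lemma dchart_dchartInv {p q : M} (hq : q ∈ (extChartAt (𝓡 n) p).source) (v : E n) :
    dchart p q (dchartInv p (extChartAt (𝓡 n) p q) v) = v := by
  have := isManifold_one n M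
  have h := mfderiv_extChartAt_comp_mfderivWithin_extChartAt_symm' (I := 𝓡 n) hq
  rw [ModelWithCorners.range_eq_univ, mfderivWithin_univ] at h
  exact congrArg (fun l : E n →L[ℝ] E n => l v) h

lemma dchartInv_dchart {p q : M} (hq : q ∈ (extChartAt (𝓡 n) p).source) (v : E n) :
    dchartInv p (extChartAt (𝓡 n) p q) (dchart p q v) = v := by
  have := isManifold_one n M
  have h := mfderivWithin_extChartAt_symm_comp_mfderiv_extChartAt' (I := 𝓡 n) hq
  rw [ModelWithCorners.range_eq_univ, mfderivWithin_univ] at h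
  exact congrArg (fun l : E n →L[ℝ] E n => l v) h

lemma dchartInv_injective {p : M} {y : E n} (hy : y ∈ (extChartAt (𝓡 n) p).target) :
    Function.Injective (dchartInv p y) := by
  have h := (extChartAt (𝓡 n) p).map_target hy
  intro u v huv
  rw [← dchart_dchartInv h u, ← dchart_dchartInv h v, (extChartAt (𝓡 n) p).right_inv hy, huv]

/-- The preferred chart at p is the one that identifies the tangent space at p with `E n`. Pointwise
formulas in preferred charts therefore need no change of basis. -/
lemma dchart_self (p : M) : dchart p p = ContinuousLinearMap.id ℝ (E n) := by
  have := isManifold_one n M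
  exact mfderiv_extChartAt_self (I := 𝓡 n) (x := p)

lemma dchartInv_self (p : M) :
    dchartInv p (extChartAt (𝓡 n) p p) = ContinuousLinearMap.id ℝ (E n) := by
  ext1 v
  have := dchartInv_dchart (mem_extChartAt_source (I := 𝓡 n) p) v
  rwa [dchart_self] at this

lemma chartMetric_apply (g : RMetric n M) (p : M) (y u v : E n) :
    chartMetric g p y u v =
      metricAt g ((extChartAt (𝓡 n) p).symm y) (dchartInv p y u) (dchartInv p y v) := rfl

lemma chartMetric_isInner (g : RMetric n M) {p : M} {y : E n}
    (hy : y ∈ (extChartAt (𝓡 n) p).target) : IsInner (chartMetric g p y) where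
  symm u v := by
    rw [chartMetric_apply, chartMetric_apply]
    exact (metricAt_isInner g _).symm _ _
  pos u hu := by
    rw [chartMetric_apply]
    exact (metricAt_isInner g _).pos _ fun h =>
      hu (dchartInv_injective hy (h.trans (map_zero _).symm))

lemma chartMetric_eq (g : RMetric n M) {p q : M} (hq : q ∈ (extChartAt (𝓡 n) p).source)
    (u v : E n) :
    chartMetric g p (extChartAt (𝓡 n) p q) (dchart p q u) (dchart p q v) = metricAt g q u v := by
  rw [chartMetric_apply, dchartInv_dchart hq, dchartInv_dchart hq,
    (extChartAt (𝓡 n) p).left_inv hq]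

lemma chartMetric_self (g : RMetric n M) (p : M) :
    chartMetric g p (extChartAt (𝓡 n) p p) = metricAt g p := by
  ext u v
  have := chartMetric_eq g (mem_extChartAt_source (I := 𝓡 n) p) u v
  rwa [dchart_self] at this

/-- The coordinates of a tangent vector in the trivialization of the tangent bundle given by the
preferred chart at `p`. -/
lemma trivializationAt_snd {p q : M} (hq : q ∈ (extChartAt (𝓡 n) p).source) (v : E n) :
    (trivializationAt (E n) (TangentSpace (𝓡 n)) p (⟨q, v⟩ : TangentBundle (𝓡 n) M)).2 =
      dchart p q v := by
  have := isManifold_one n M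
  rw [extChartAt_source] at hq
  have h := TangentBundle.continuousLinearMapAt_trivializationAt (I := 𝓡 n) (𝕜 := ℝ) hq
  have h2 := congrArg (fun l : E n →L[ℝ] E n => l v) h
  rw [dchart]
  refine Eq.trans ?_ h2
  exact (Bundle.Trivialization.continuousLinearMapAt_apply_of_mem (R := ℝ)
    (trivializationAt (E n) (TangentSpace (𝓡 n) (M := M)) p) (b := q) (by simpa using hq)
    (v : TangentSpace (𝓡 n) q)).symm

/-- Any chart with b x in its source may be used, so a vector field can be tested in one fixed chart
while the point moves. -/
lemma contMDiffAt_tangentBundle_iff {X : Type*} [TopologicalSpace X] {EX HX : Type*}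
    [NormedAddCommGroup EX] [NormedSpace ℝ EX] [TopologicalSpace HX]
    {I : ModelWithCorners ℝ EX HX} [ChartedSpace HX X] {b : X → M} {V : X → E n} {x : X} {p : M}
    (hb : ContMDiffAt I (𝓡 n) ∞ b x) (hp : b x ∈ (extChartAt (𝓡 n) p).source) :
    ContMDiffAt I (𝓡 n).tangent ∞ (fun z => (⟨b z, V z⟩ : TangentBundle (𝓡 n) M)) x ↔
      ContMDiffAt I 𝓘(ℝ, E n) ∞ (fun z => dchart p (b z) (V z)) x := by
  have := isManifold_one n M
  have hsrc : (⟨b x, V x⟩ : TangentBundle (𝓡 n) M) ∈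
      (trivializationAt (E n) (TangentSpace (𝓡 n)) p).source := by
    rw [extChartAt_source] at hp
    simpa using hp
  have h1 := Bundle.Trivialization.contMDiffAt_iff (n := ∞) (IM := I) (IB := 𝓡 n)
    (e := trivializationAt (E n) (TangentSpace (𝓡 n) (M := M)) p)
    (f := fun z => (⟨b z, V z⟩ : TangentBundle (𝓡 n) M)) hsrc
  refine h1.trans ?_
  have hev : ∀ᶠ z in 𝓝 x, b z ∈ (extChartAt (𝓡 n) p).source :=
    hb.continuousAt.eventually ((isOpen_extChartAt_source p).mem_nhds hp)
  constructor
  · rintro ⟨-, h⟩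
    refine h.congr_of_eventuallyEq ?_
    filter_upwards [hev] with z hz
    exact (trivializationAt_snd hz (V z)).symm
  · intro h
    refine ⟨hb, h.congr_of_eventuallyEq ?_⟩
    filter_upwards [hev] with z hz
    exact trivializationAt_snd hz (V z)

/-- A smooth family of Riemannian metrics has smooth coefficients in a chart. -/
lemma IsSmoothFamilyOn.contDiffAt_chartMetric {J : Set ℝ} (hJ : IsOpen J) {g : ℝ → RMetric n M}
    (hg : IsSmoothFamilyOn J g) {p : M} {t : ℝ} (ht : t ∈ J) {y : E n}
    (hy : y ∈ (extChartAt (𝓡 n) p).target) :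
    ContDiffAt ℝ ∞ (fun q : ℝ × E n => chartMetric (g q.1) p q.2) (t, y) := by
  have := isManifold_one n M
  apply contDiffAt_clm_of_apply
  intro u
  apply contDiffAt_clm_of_apply
  intro v
  rw [← contMDiffAt_iff_contDiffAt]
  have hb : ContMDiffAt 𝓘(ℝ, ℝ × E n) (𝓡 n) ∞
      (fun q : ℝ × E n => (extChartAt (𝓡 n) p).symm q.2) (t, y) :=
    (contMDiffAt_chartInv hy).comp (t, y) contDiff_snd.contMDiff.contMDiffAt
  have hev : ∀ᶠ q : ℝ × E n in 𝓝 (t, y), q.2 ∈ (extChartAt (𝓡 n) p).target :=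
    continuousAt_snd.eventually ((isOpen_extChartAt_target p).mem_nhds hy)
  -- The coordinate vector fields are smooth sections of the tangent bundle, because the chart makes
  -- them constant; the coefficients of the metric are its values on them.
  have hsec : ∀ w : E n, ContMDiffAt 𝓘(ℝ, ℝ × E n) (𝓡 n).tangent ∞
      (fun q : ℝ × E n => (⟨(extChartAt (𝓡 n) p).symm q.2, dchartInv p q.2 w⟩ :
        TangentBundle (𝓡 n) M)) (t, y) := by
    intro w
    rw [contMDiffAt_tangentBundle_iff hb ((extChartAt (𝓡 n) p).map_target hy)]
    refine (contMDiffAt_const (c := w)).congr_of_eventuallyEq ?_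
    filter_upwards [hev] with q hq
    have := dchart_dchartInv ((extChartAt (𝓡 n) p).map_target hq) w
    rwa [(extChartAt (𝓡 n) p).right_inv hq] at this
  have hmetric := (hg.contMDiffAt (x := (t, (extChartAt (𝓡 n) p).symm y))
    ((hJ.prod isOpen_univ).mem_nhds ⟨ht, mem_univ _⟩))
  have hq : ContMDiffAt 𝓘(ℝ, ℝ × E n) (𝓘(ℝ, ℝ).prod (𝓡 n)) ∞
      (fun q : ℝ × E n => (q.1, (extChartAt (𝓡 n) p).symm q.2)) (t, y) :=
    (contDiff_fst.contMDiff.contMDiffAt).prodMk hb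
  have hcomp := hmetric.comp (t, y) hq
  have happ := ContMDiffAt.clm_bundle_apply₂ (F₃ := ℝ) (E₃ := fun _ : M => ℝ) hcomp (hsec u) (hsec v)
  rw [Bundle.contMDiffAt_totalSpace] at happ
  exact happ.2

end HypSurf

end

/-! ### Local isometries with the hyperboloid -/

noncomputable section

namespace HypSurf

variable {n : ℕ}

lemma contDiffAt_deriv {Y : Type*} [NormedAddCommGroup Y] [NormedSpace ℝ Y] {c : ℝ → Y} {s : ℝ}
    (h : ContDiffAt ℝ ∞ c s) : ContDiffAt ℝ ∞ (deriv c) s :=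
  (h.fderiv_right (m := ∞) (by simp)).clm_apply contDiffAt_const

/-- `Ψ` parametrizes a piece of hyperbolic space near `y`, with the metric `G`. -/
structure LocalModel (G : E n → Bil n) (Ψ : E n → ℝ × E n) (y : E n) : Prop where
  smooth : ContDiffAt ℝ ∞ Ψ y
  hyp : ∀ᶠ z in 𝓝 y, lorentz (Ψ z) (Ψ z) = -1
  diff : DifferentiableAt ℝ G y
  isom : ∀ᶠ z in 𝓝 y, ∀ u v, G z u v = lorentzL n (fderiv ℝ Ψ z u) (fderiv ℝ Ψ z v)
  pos : IsInner (G y)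

section LocalModel

variable {G : E n → Bil n} {Ψ : E n → ℝ × E n} {y : E n}

lemma lorentz_fderiv_eq_zero {X : Type*} [NormedAddCommGroup X] [NormedSpace ℝ X]
    {Θ : X → ℝ × E n} {x : X} {r : ℝ} (hd : DifferentiableAt ℝ Θ x)
    (h : ∀ᶠ z in 𝓝 x, lorentz (Θ z) (Θ z) = r) (u : X) :
    lorentzL n (fderiv ℝ Θ x u) (Θ x) = 0 := by
  have h1 := ((lorentzL n).hasFDerivAt_of_bilinear hd.hasFDerivAt hd.hasFDerivAt)
  have h2 : HasFDerivAt (fun z => lorentzL n (Θ z) (Θ z)) (0 : X →L[ℝ] ℝ) x :=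
    (hasFDerivAt_const r x).congr_of_eventuallyEq
      (h.mono fun x hx => (lorentzL_apply _ _).trans hx)
  have h3 := congrArg (fun l : X →L[ℝ] ℝ => l u) (h1.unique h2)
  simp [lorentzL_comm (Θ x)] at h3
  linarith

lemma LocalModel.orth (h : LocalModel G Ψ y) (u : E n) :
    lorentzL n (fderiv ℝ Ψ y u) (Ψ y) = 0 :=
  lorentz_fderiv_eq_zero (h.smooth.differentiableAt (by simp)) h.hyp u

lemma LocalModel.injective (h : LocalModel G Ψ y) : Function.Injective (fderiv ℝ Ψ y) := by
  intro u v huv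
  refine h.pos.eq_of_forall fun w => ?_
  rw [h.isom.self_of_nhds, h.isom.self_of_nhds, huv]

/-- The derivative of the image in Lorentz space of a vector field along a map. -/
lemma LocalModel.fderiv_push (h : LocalModel G Ψ y) {X : Type*} [NormedAddCommGroup X]
    [NormedSpace ℝ X] {c W : X → E n} {x : X} (hy : c x = y) (hc : DifferentiableAt ℝ c x)
    (hW : DifferentiableAt ℝ W x) :
    DifferentiableAt ℝ (fun z => fderiv ℝ Ψ (c z) (W z)) x ∧ ∀ u,
    fderiv ℝ (fun z => fderiv ℝ Ψ (c z) (W z)) x u =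
      fderiv ℝ Ψ y (fderiv ℝ W x u + christoffel G y (fderiv ℝ c x u) (W x)) +
        G y (fderiv ℝ c x u) (W x) • Ψ y := by
  have hD : DifferentiableAt ℝ (fderiv ℝ Ψ) y :=
    (h.smooth.fderiv_right (m := 1) one_add_one_le_infty).differentiableAt (by simp)
  subst hy
  have h1 : HasFDerivAt (fun z => fderiv ℝ Ψ (c z)) ((fderiv ℝ (fderiv ℝ Ψ) (c x)).comp
      (fderiv ℝ c x)) x := HasFDerivAt.comp x hD.hasFDerivAt hc.hasFDerivAt
  have h2 := h1.clm_apply hW.hasFDerivAt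
  refine ⟨h2.differentiableAt, fun u => ?_⟩
  rw [h2.fderiv]
  simp only [add_apply, ContinuousLinearMap.comp_apply, ContinuousLinearMap.flip_apply, map_add]
  rw [gauss_formula h.smooth h.hyp h.diff h.isom h.pos]
  abel

end LocalModel

variable {M : Type*} [TopologicalSpace M] [ChartedSpace (E n) M] [IsManifold (𝓡 n) ∞ M]

/-- The differential of a map from a manifold to Lorentz space. -/
def dmap (Φ : M → ℝ × E n) (q : M) : E n →L[ℝ] ℝ × E n := mfderiv (𝓡 n) 𝓘(ℝ, ℝ × E n) Φ q

/-- `Φ` is an isometric immersion of the open set `U` in the hyperboloid. -/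
structure IsLocalIsom (g : RMetric n M) (U : Set M) (Φ : M → ℝ × E n) : Prop where
  isOpen : IsOpen U
  smooth : ContMDiffOn (𝓡 n) 𝓘(ℝ, ℝ × E n) ∞ Φ U
  hyp : ∀ q ∈ U, Φ q ∈ hyperboloid n
  isom : ∀ q ∈ U, ∀ u v, metricAt g q u v = lorentzL n (dmap Φ q u) (dmap Φ q v)

lemma IsHyperbolicMetric.exists_isLocalIsom {g : RMetric n M} (hg : IsHyperbolicMetric g) (p : M) :
    ∃ U Φ, IsLocalIsom g U Φ ∧ p ∈ U := by
  obtain ⟨U, hU, hp, Φ, hΦ, h⟩ := hg p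
  refine ⟨U, Φ, ⟨hU, hΦ, fun q hq => (h q hq).1, fun q hq u v => ?_⟩, hp⟩
  rw [lorentzL_apply]
  exact (h q hq).2 u v

lemma isSmoothFamilyOn_const (g : RMetric n M) (J : Set ℝ) : IsSmoothFamilyOn J (fun _ => g) :=
  (g.contMDiff.comp contMDiff_snd).contMDiffOn

lemma contDiffAt_chartMetric (g : RMetric n M) {p : M} {y : E n}
    (hy : y ∈ (extChartAt (𝓡 n) p).target) : ContDiffAt ℝ ∞ (chartMetric g p) y := by
  have h1 := (isSmoothFamilyOn_const g univ).contDiffAt_chartMetric isOpen_univ (mem_univ 0) hy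
  exact ContDiffAt.comp (f := fun z : E n => ((0 : ℝ), z)) y h1
    (contDiffAt_const.prodMk contDiffAt_id)

/-- The velocity of a curve at time `s`. -/
def vel (γ : ℝ → M) (s : ℝ) : E n := mfderiv 𝓘(ℝ, ℝ) (𝓡 n) γ s (1 : ℝ)

section IsLocalIsom

variable {g : RMetric n M} {U : Set M} {Φ : M → ℝ × E n} (h : IsLocalIsom g U Φ)

include h

lemma IsLocalIsom.contMDiffAt {q : M} (hq : q ∈ U) : ContMDiffAt (𝓡 n) 𝓘(ℝ, ℝ × E n) ∞ Φ q :=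
  h.smooth.contMDiffAt (h.isOpen.mem_nhds hq)

lemma IsLocalIsom.mdifferentiableAt {q : M} (hq : q ∈ U) :
    MDifferentiableAt (𝓡 n) 𝓘(ℝ, ℝ × E n) Φ q :=
  (h.contMDiffAt hq).mdifferentiableAt (by simp)

lemma IsLocalIsom.contDiffAt {p : M} {y : E n} (hy : y ∈ (extChartAt (𝓡 n) p).target)
    (hU : (extChartAt (𝓡 n) p).symm y ∈ U) :
    ContDiffAt ℝ ∞ (Φ ∘ (extChartAt (𝓡 n) p).symm) y := by
  rw [← contMDiffAt_iff_contDiffAt]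
  exact (h.contMDiffAt hU).comp y (contMDiffAt_chartInv hy)

lemma IsLocalIsom.fderiv_comp {p : M} {y : E n} (hy : y ∈ (extChartAt (𝓡 n) p).target)
    (hU : (extChartAt (𝓡 n) p).symm y ∈ U) (v : E n) :
    fderiv ℝ (Φ ∘ (extChartAt (𝓡 n) p).symm) y v =
      dmap Φ ((extChartAt (𝓡 n) p).symm y) (dchartInv p y v) := by
  rw [← mfderiv_eq_fderiv]
  have h1 := mfderiv_comp y (h.mdifferentiableAt hU)
    ((contMDiffAt_chartInv hy).mdifferentiableAt (by simp))
  rw [h1]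
  rfl

lemma IsLocalIsom.fderiv_dchart {p q : M} (hq : q ∈ U) (hp : q ∈ (extChartAt (𝓡 n) p).source)
    (v : E n) :
    fderiv ℝ (Φ ∘ (extChartAt (𝓡 n) p).symm) (extChartAt (𝓡 n) p q) (dchart p q v) =
      dmap Φ q v := by
  have hl := (extChartAt (𝓡 n) p).left_inv hp
  rw [h.fderiv_comp ((extChartAt (𝓡 n) p).map_source hp) (by rwa [hl]), dchartInv_dchart hp, hl]

lemma IsLocalIsom.localModel {p q : M} (hq : q ∈ U) (hp : q ∈ (extChartAt (𝓡 n) p).source) :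
    LocalModel (chartMetric g p) (Φ ∘ (extChartAt (𝓡 n) p).symm) (extChartAt (𝓡 n) p q) := by
  have hy := (extChartAt (𝓡 n) p).map_source hp
  have hl := (extChartAt (𝓡 n) p).left_inv hp
  have hev : ∀ᶠ z in 𝓝 (extChartAt (𝓡 n) p q), z ∈ (extChartAt (𝓡 n) p).target ∧
      (extChartAt (𝓡 n) p).symm z ∈ U := by
    refine Filter.Eventually.and ((isOpen_extChartAt_target p).mem_nhds hy) ?_
    exact (contMDiffAt_chartInv hy).continuousAt.eventually (by
      rw [hl]; exact h.isOpen.mem_nhds hq)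
  refine ⟨h.contDiffAt hy (by rwa [hl]), ?_, (contDiffAt_chartMetric g hy).differentiableAt (by simp),
    ?_, chartMetric_isInner g hy⟩
  · filter_upwards [hev] with z hz
    exact (h.hyp _ hz.2).1
  · filter_upwards [hev] with z hz u v
    rw [chartMetric_apply, h.isom _ hz.2, h.fderiv_comp hz.1 hz.2, h.fderiv_comp hz.1 hz.2]

lemma IsLocalIsom.dmap_injective {q : M} (hq : q ∈ U) : Function.Injective (dmap Φ q) := by
  intro u v huv
  refine (metricAt_isInner g q).eq_of_forall fun w => ?_
  rw [h.isom q hq, h.isom q hq, huv]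

lemma IsLocalIsom.dmap_orth {q : M} (hq : q ∈ U) (u : E n) :
    lorentzL n (dmap Φ q u) (Φ q) = 0 := by
  have hp := mem_extChartAt_source (I := 𝓡 n) q
  have h1 := (h.localModel hq hp).orth (dchart q q u)
  rw [h.fderiv_dchart hq hp] at h1
  simpa using h1

/-- The image in Lorentz space of a geodesic. -/
lemma IsLocalIsom.geodesic {γ : ℝ → M} (hγ : IsGeodesic g γ) {s : ℝ} (hs : γ s ∈ U) :
    ContDiffAt ℝ ∞ (Φ ∘ γ) s ∧
    deriv (Φ ∘ γ) s = dmap Φ (γ s) (vel γ s) ∧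
    deriv (deriv (Φ ∘ γ)) s = lorentzL n (deriv (Φ ∘ γ) s) (deriv (Φ ∘ γ) s) • Φ (γ s) := by
  have hγs : ContMDiffAt 𝓘(ℝ, ℝ) (𝓡 n) ∞ γ s := hγ.1.contMDiffAt
  set p := γ s with hp
  have hps := mem_extChartAt_source (I := 𝓡 n) p
  set c : ℝ → E n := fun τ => extChartAt (𝓡 n) p (γ τ) with hc
  set Ψ := Φ ∘ (extChartAt (𝓡 n) p).symm with hΨ
  have hcs : ContDiffAt ℝ ∞ c s := by
    rw [← contMDiffAt_iff_contDiffAt]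
    exact (contMDiffAt_chart (p := p) hps).comp s hγs
  have hm := h.localModel hs hps
  have hsm : ContDiffAt ℝ ∞ (Φ ∘ γ) s := by
    rw [← contMDiffAt_iff_contDiffAt]
    exact (h.contMDiffAt hs).comp s hγs
  have hnear : ∀ᶠ τ in 𝓝 s, (Φ ∘ γ) τ = (Ψ ∘ c) τ := by
    filter_upwards [hγs.continuousAt.eventually ((isOpen_extChartAt_source p).mem_nhds hps)]
      with τ hτ
    simp only [hΨ, hc, Function.comp_apply, (extChartAt (𝓡 n) p).left_inv hτ]
  have hcont : ContinuousAt c s := hcs.continuousAt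
  have hder : ∀ᶠ τ in 𝓝 s, deriv (Φ ∘ γ) τ = fderiv ℝ Ψ (c τ) (deriv c τ) := by
    filter_upwards [hnear.eventually_nhds, eventually_differentiableAt_of_infty hcs,
      hcont.eventually (eventually_differentiableAt_of_infty hm.smooth)] with τ h1 h2 h3
    rw [EventuallyEq.deriv_eq h1]
    exact (h3.hasFDerivAt.comp_hasDerivAt τ h2.hasDerivAt).deriv
  have hcd : DifferentiableAt ℝ (deriv c) s :=
    (contDiffAt_deriv hcs).differentiableAt (by simp)
  refine ⟨hsm, ?_, ?_⟩
  · have h1 := mfderiv_comp s (h.mdifferentiableAt hs) (hγs.mdifferentiableAt (by simp))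
    rw [← fderiv_apply_one_eq_deriv, ← mfderiv_eq_fderiv, h1]
    rfl
  · rw [EventuallyEq.deriv_eq hder, hder.self_of_nhds]
    have h1 := (hm.fderiv_push (c := c) (W := deriv c) rfl (hcs.differentiableAt (by simp)) hcd).2 1
    rw [fderiv_apply_one_eq_deriv, fderiv_apply_one_eq_deriv, fderiv_apply_one_eq_deriv] at h1
    rw [h1]
    -- The geodesic equation kills the tangential part of the second derivative, leaving the
    -- multiple of Φ in Gauss' formula.
    have h2 : deriv (deriv c) s +
        christoffel (chartMetric g p) (extChartAt (𝓡 n) p p) (deriv c s) (deriv c s) = 0 := hγ.2 s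
    rw [h2, map_zero, zero_add, hm.isom.self_of_nhds]
    simp only [hΨ, Function.comp_apply, (extChartAt (𝓡 n) p).left_inv hps]
    rfl

end IsLocalIsom

end HypSurf

end

/-! ### Explicit geodesics and local inverses -/

noncomputable section

namespace HypSurf

/-- Solutions of `c'' = c` on an interval. -/
lemma eq_cosh_add_sinh {V : Type*} [NormedAddCommGroup V] [NormedSpace ℝ V] {c : ℝ → V} {a b : ℝ}
    (hc : ∀ s ∈ Ioo a b, ContDiffAt ℝ ∞ c s ∧ deriv (deriv c) s = c s) {r s : ℝ}
    (hr : r ∈ Ioo a b) (hs : s ∈ Ioo a b) :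
    c s = Real.cosh (s - r) • c r + Real.sinh (s - r) • deriv c r := by
  have h1 : ∀ s ∈ Ioo a b, HasDerivAt c (deriv c s) s := fun s hs =>
    ((hc s hs).1.differentiableAt (by simp)).hasDerivAt
  have h2 : ∀ s ∈ Ioo a b, HasDerivAt (deriv c) (c s) s := fun s hs => by
    have := ((contDiffAt_deriv (hc s hs).1).differentiableAt (by simp)).hasDerivAt
    rwa [(hc s hs).2] at this
  -- For σ = 1 and σ = -1 these are the two first integrals of c'' = c; c is recovered from them by
  -- elimination.
  have hconst : ∀ σ : ℝ, σ * σ = 1 →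
      Real.exp (-σ * s) • (deriv c s + σ • c s) = Real.exp (-σ * r) • (deriv c r + σ • c r) := by
    intro σ hσ
    have hd : ∀ s ∈ Ioo a b,
        HasDerivAt (fun s => Real.exp (-σ * s) • (deriv c s + σ • c s)) 0 s := by
      intro s hs
      have he : HasDerivAt (fun s => Real.exp (-σ * s)) (Real.exp (-σ * s) * (-σ)) s := by
        simpa using ((hasDerivAt_id s).const_mul (-σ)).exp
      refine (he.smul ((h2 s hs).add ((h1 s hs).const_smul σ))).congr_deriv ?_
      have e1 : c s = (σ * σ) • c s := by rw [hσ, one_smul]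
      simp only [Pi.add_apply, Pi.smul_apply]
      nth_rewrite 1 [e1]
      module
    exact isOpen_Ioo.is_const_of_deriv_eq_zero isPreconnected_Ioo
      (fun s hs => (hd s hs).differentiableAt.differentiableWithinAt)
      (fun s hs => (hd s hs).deriv) hs hr
  have e1 := hconst 1 (by norm_num)
  have e2 := hconst (-1) (by norm_num)
  have key : ∀ σ : ℝ, Real.exp (σ * s) * Real.exp (-σ * s) = 1 := fun σ => by
    rw [← Real.exp_add]; simp
  have f1 : deriv c s + (1 : ℝ) • c s = Real.exp (s - r) • (deriv c r + (1 : ℝ) • c r) := by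
    have := congrArg (fun v => Real.exp (1 * s) • v) e1
    simp only [smul_smul, key, one_smul, ← Real.exp_add] at this
    rw [one_smul, one_smul, this]
    congr 2; ring
  have f2 : deriv c s + (-1 : ℝ) • c s = Real.exp (-(s - r)) • (deriv c r + (-1 : ℝ) • c r) := by
    have := congrArg (fun v => Real.exp (-1 * s) • v) e2
    simp only [smul_smul, key, one_smul, ← Real.exp_add] at this
    rw [this]
    congr 2; ring
  have f3 : c s = (1 / 2 : ℝ) • ((deriv c s + (1 : ℝ) • c s) - (deriv c s + (-1 : ℝ) • c s)) := by
    module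
  rw [f3, f1, f2, Real.cosh_eq, Real.sinh_eq]
  module

variable {n : ℕ} {M : Type*} [TopologicalSpace M] [ChartedSpace (E n) M] [IsManifold (𝓡 n) ∞ M]
  {g : RMetric n M} {U : Set M} {Φ : M → ℝ × E n}

/-- `γ` is a unit speed geodesic. -/
def IsUnitGeodesic (g : RMetric n M) (γ : ℝ → M) : Prop :=
  IsGeodesic g γ ∧ metricAt g (γ 0) (vel γ 0) (vel γ 0) = 1

/-- Locally the squared speed is ⟨c', c'⟩ for the image c in Lorentz space. Its derivative is 2⟨c'',
c'⟩, which vanishes because c'' is a multiple of c and c is orthogonal to c'. -/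
lemma IsUnitGeodesic.speed {γ : ℝ → M} (hγ : IsUnitGeodesic g γ) (hg : IsHyperbolicMetric g)
    (s : ℝ) : metricAt g (γ s) (vel γ s) (vel γ s) = 1 := by
  have hd : ∀ s, HasDerivAt (fun s => metricAt g (γ s) (vel γ s) (vel γ s)) 0 s := by
    intro s
    obtain ⟨U, Φ, h, hs⟩ := hg.exists_isLocalIsom (γ s)
    have h1 := h.geodesic hγ.1 hs
    have hev : ∀ᶠ τ in 𝓝 s, γ τ ∈ U := hγ.1.1.continuous.continuousAt.eventually
      (h.isOpen.mem_nhds hs)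
    have h2 := ((contDiffAt_deriv h1.1).differentiableAt (by simp)).hasDerivAt
    have h3 := ((lorentzL n).hasFDerivAt_of_bilinear h2.hasFDerivAt h2.hasFDerivAt).hasDerivAt
    refine (h3.congr_of_eventuallyEq ?_).congr_deriv ?_
    · filter_upwards [hev] with τ hτ
      rw [h.isom _ hτ, ← (h.geodesic hγ.1 hτ).2.1]
    · have h4 := h.dmap_orth hs (vel γ s)
      rw [← h1.2.1] at h4
      simp [h1.2.2, h4, lorentzL_comm (Φ (γ s))]
  have := is_const_of_deriv_eq_zero (fun s => (hd s).differentiableAt) (fun s => (hd s).deriv) s 0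
  rw [this, hγ.2]

lemma IsLocalIsom.unitGeodesic (h : IsLocalIsom g U Φ) {γ : ℝ → M} (hγ : IsUnitGeodesic g γ)
    (hg : IsHyperbolicMetric g) {s : ℝ} (hs : γ s ∈ U) :
    ContDiffAt ℝ ∞ (Φ ∘ γ) s ∧ deriv (deriv (Φ ∘ γ)) s = (Φ ∘ γ) s := by
  have h1 := h.geodesic hγ.1 hs
  refine ⟨h1.1, ?_⟩
  rw [h1.2.2, h1.2.1, ← h.isom _ hs, hγ.speed hg, one_smul, Function.comp_apply]

/-- The upper sheet is a graph over `E n`, so the second projection serves as a global coordinate on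
it. -/
lemma hyperboloid_eq_of_snd_eq {a b : ℝ × E n} (ha : a ∈ hyperboloid n) (hb : b ∈ hyperboloid n)
    (h : a.2 = b.2) : a = b := by
  refine Prod.ext ?_ h
  have h1 := ha.1
  have h2 := hb.1
  simp only [lorentz, h] at h1 h2
  nlinarith [ha.2, hb.2]

/-- Local inverses of a local isometry with the hyperboloid. -/
lemma IsLocalIsom.exists_inverse (h : IsLocalIsom g U Φ) {p : M} (hp : p ∈ U) :
    ∃ (U' : Set M) (W : Set (ℝ × E n)) (θ : ℝ × E n → M), IsOpen U' ∧ p ∈ U' ∧ U' ⊆ U ∧ IsOpen W ∧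
      (∀ q ∈ U', Φ q ∈ W ∧ θ (Φ q) = q) ∧
      ∀ a ∈ W, a ∈ hyperboloid n → θ a ∈ U' ∧ Φ (θ a) = a ∧
        ContMDiffAt 𝓘(ℝ, ℝ × E n) (𝓡 n) ∞ θ a := by
  set κ := extChartAt (𝓡 n) p with hκ
  have hps : p ∈ κ.source := mem_extChartAt_source (I := 𝓡 n) p
  -- This is Φ read in the chart of M and the graph coordinate of the hyperboloid. A tangent vector
  -- of the hyperboloid without spatial part is zero, being orthogonal to a point with positive time
  -- coordinate; so the differential of χ is invertible and the inverse function theorem applies.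
  set χ : E n → E n := fun y => (Φ (κ.symm y)).2 with hχ
  set O : Set (E n) := κ.target ∩ κ.symm ⁻¹' U with hO
  have hOo : IsOpen O :=
    (contMDiffOn_extChartAt_symm (n := ∞) p).continuousOn.isOpen_inter_preimage
      (isOpen_extChartAt_target p) h.isOpen
  have hχs : ∀ y ∈ O, ContDiffAt ℝ ∞ χ y := fun y hy =>
    contDiff_snd.contDiffAt.comp y (h.contDiffAt hy.1 hy.2)
  have hχd : ∀ y ∈ O, ∃ e : E n ≃L[ℝ] E n, HasFDerivAt χ (e : E n →L[ℝ] E n) y := by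
    intro y hy
    set A := fderiv ℝ (Φ ∘ κ.symm) y with hA
    have h1 : HasFDerivAt χ ((ContinuousLinearMap.snd ℝ ℝ (E n)).comp A) y :=
      (ContinuousLinearMap.snd ℝ ℝ (E n)).hasFDerivAt.comp y
        ((h.contDiffAt hy.1 hy.2).differentiableAt (by simp)).hasFDerivAt
    have hm := h.localModel (p := p) hy.2 (κ.map_target hy.1)
    rw [← hκ, κ.right_inv hy.1] at hm
    have hinj : Function.Injective
        (((ContinuousLinearMap.snd ℝ ℝ (E n)).comp A : E n →L[ℝ] E n) : E n →ₗ[ℝ] E n) := by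
      rw [← LinearMap.ker_eq_bot, LinearMap.ker_eq_bot']
      intro v hv
      have hv2 : (A v).2 = 0 := hv
      have h3 := hm.orth v
      have h4 := (h.hyp _ hy.2).2
      rw [lorentzL_apply, lorentz] at h3
      change ⟪(A v).2, _⟫ - (A v).1 * (Φ (κ.symm y)).1 = 0 at h3
      rw [hv2, inner_zero_left, zero_sub, neg_eq_zero, mul_eq_zero] at h3
      have h5 : A v = 0 := Prod.ext (h3.resolve_right h4.ne') hv2
      exact hm.injective (h5.trans (map_zero A).symm)
    have e := (LinearEquiv.ofInjectiveEndo _ hinj).toContinuousLinearEquiv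
    refine ⟨(LinearEquiv.ofInjectiveEndo _ hinj).toContinuousLinearEquiv, ?_⟩
    convert h1 using 1
    ext v : 1
    rfl
  have hy₀ : κ p ∈ O := ⟨κ.map_source hps, by
    rw [mem_preimage, κ.left_inv hps]; exact hp⟩
  obtain ⟨e₀, he₀⟩ := hχd _ hy₀
  set e := ((hχs _ hy₀).toOpenPartialHomeomorph χ he₀ (by simp)).restr O with he
  have hee : ∀ y, e y = χ y := fun y => rfl
  have hesrc : e.source ⊆ O := by
    rw [he, OpenPartialHomeomorph.restr_source, hOo.interior_eq]
    exact inter_subset_right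
  have hpe : κ p ∈ e.source := by
    rw [he, OpenPartialHomeomorph.restr_source, hOo.interior_eq]
    exact ⟨ContDiffAt.mem_toOpenPartialHomeomorph_source (hχs _ hy₀) he₀ (by simp), hy₀⟩
  -- The inverse θ depends only on the spatial part of its argument. It is thus defined on an open
  -- cylinder of the ambient space, where its smoothness is an ordinary statement.
  refine ⟨κ.source ∩ κ ⁻¹' e.source, {a | a.2 ∈ e.target}, fun a => κ.symm (e.symm a.2),
    (continuousOn_extChartAt p).isOpen_inter_preimage (isOpen_extChartAt_source p) e.open_source,
    ⟨hps, hpe⟩, ?_, e.open_target.preimage continuous_snd, ?_, ?_⟩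
  · rintro q ⟨hq, hq'⟩
    have := (hesrc hq').2
    rwa [mem_preimage, κ.left_inv hq] at this
  · rintro q ⟨hq, hq'⟩
    have h1 : (Φ q).2 = e (κ q) := by rw [hee, hχ]; simp only [κ.left_inv hq]
    simp only [mem_ofPred_eq, h1]
    refine ⟨e.map_source hq', ?_⟩
    rw [e.left_inv hq', κ.left_inv hq]
  · intro a ha hah
    have ha' : a.2 ∈ e.target := ha
    have h1 := e.map_target ha'
    have h2 := hesrc h1
    refine ⟨⟨κ.map_target h2.1, ?_⟩, ?_, ?_⟩
    · rw [mem_preimage, κ.right_inv h2.1]; exact h1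
    · exact hyperboloid_eq_of_snd_eq (h.hyp _ h2.2) hah (e.right_inv ha')
    · obtain ⟨e₁, he₁⟩ := hχd _ h2
      have h3 : ContDiffAt ℝ ∞ e.symm a.2 := e.contDiffAt_symm ha' he₁ (hχs _ h2)
      have h4 : ContMDiffAt 𝓘(ℝ, ℝ × E n) 𝓘(ℝ, E n) ∞ (fun a : ℝ × E n => e.symm a.2) a :=
        contMDiffAt_iff_contDiffAt.2 (h3.comp a contDiff_snd.contDiffAt)
      exact (contMDiffAt_chartInv h2.1).comp a h4

end HypSurf

end

/-! ### Smooth dependence of the geodesic flow on the starting point -/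

noncomputable section

namespace HypSurf

variable {n : ℕ} {M : Type*} [TopologicalSpace M] [ChartedSpace (E n) M] [IsManifold (𝓡 n) ∞ M]
  {g : RMetric n M} {U : Set M} {Φ : M → ℝ × E n}

/-- A point of the geodesic of the hyperboloid through `A` with velocity `B`. -/
def hypGeodesic (A B : ℝ × E n) (s : ℝ) : ℝ × E n := Real.cosh s • A + Real.sinh s • B

lemma hypGeodesic_lorentz {A B : ℝ × E n} (hA : lorentz A A = -1) (hAB : lorentzL n B A = 0)
    (hB : lorentzL n B B = 1) (s : ℝ) :
    lorentz (hypGeodesic A B s) (hypGeodesic A B s) = -1 := by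
  rw [← lorentzL_apply] at hA ⊢
  simp only [hypGeodesic, map_add, map_smul, add_apply, smul_apply, smul_eq_mul, hA, hAB, hB,
    lorentzL_comm A B]
  linarith [Real.cosh_sq s]

lemma hypGeodesic_ode (A B : ℝ × E n) (r s : ℝ) :
    ContDiffAt ℝ ∞ (fun s => hypGeodesic A B (s - r)) s ∧
    deriv (deriv (fun s => hypGeodesic A B (s - r))) s = hypGeodesic A B (s - r) := by
  have h1 : ∀ s, HasDerivAt (fun s => hypGeodesic A B (s - r))
      (Real.sinh (s - r) • A + Real.cosh (s - r) • B) s := by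
    intro s
    have hs : HasDerivAt (fun s => s - r) 1 s := (hasDerivAt_id s).sub_const r
    refine ((hs.cosh.smul_const A).add (hs.sinh.smul_const B)).congr_deriv ?_
    simp
  have h2 : ∀ s, HasDerivAt (fun s => Real.sinh (s - r) • A + Real.cosh (s - r) • B)
      (hypGeodesic A B (s - r)) s := by
    intro s
    have hs : HasDerivAt (fun s => s - r) 1 s := (hasDerivAt_id s).sub_const r
    refine ((hs.sinh.smul_const A).add (hs.cosh.smul_const B)).congr_deriv ?_
    simp [hypGeodesic]
  refine ⟨?_, ?_⟩
  · have hs : ContDiffAt ℝ ∞ (fun s => s - r) s := contDiffAt_id.sub contDiffAt_const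
    exact ((Real.contDiff_cosh.contDiffAt.comp s hs).smul contDiffAt_const).add
      ((Real.contDiff_sinh.contDiffAt.comp s hs).smul contDiffAt_const)
  · rw [show deriv (fun s => hypGeodesic A B (s - r)) =
      fun s => Real.sinh (s - r) • A + Real.cosh (s - r) • B from funext fun s => (h1 s).deriv]
    exact (h2 s).deriv

/-- In the domain of a local isometry, unit speed geodesics are explicit. -/
lemma IsLocalIsom.geodesic_eq (h : IsLocalIsom g U Φ) {γ : ℝ → M} (hγ : IsUnitGeodesic g γ)
    (hg : IsHyperbolicMetric g) {a b : ℝ} (hU : ∀ s ∈ Ioo a b, γ s ∈ U) {r s : ℝ}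
    (hr : r ∈ Ioo a b) (hs : s ∈ Ioo a b) :
    Φ (γ s) = hypGeodesic (Φ (γ r)) (dmap Φ (γ r) (vel γ r)) (s - r) := by
  have h1 := eq_cosh_add_sinh (c := Φ ∘ γ) (fun s hs => h.unitGeodesic hγ hg (hU s hs)) hr hs
  rw [(h.geodesic hγ.1 (hU r hr)).2.1] at h1
  exact h1

lemma IsLocalIsom.hypGeodesic_lorentz (h : IsLocalIsom g U Φ) {γ : ℝ → M}
    (hγ : IsUnitGeodesic g γ) (hg : IsHyperbolicMetric g) {r : ℝ} (hr : γ r ∈ U) (s : ℝ) :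
    lorentz (hypGeodesic (Φ (γ r)) (dmap Φ (γ r) (vel γ r)) s)
      (hypGeodesic (Φ (γ r)) (dmap Φ (γ r) (vel γ r)) s) = -1 := by
  apply HypSurf.hypGeodesic_lorentz (h.hyp _ hr).1 (h.dmap_orth hr _)
  rw [← h.isom _ hr, hγ.speed hg]

/-- A unit speed geodesic that follows an explicit hyperbolic geodesic at some time does so as long
as the latter stays in the image of a local isometry. -/
lemma IsLocalIsom.geodesic_follows [T2Space M] (h : IsLocalIsom g U Φ) {W : Set (ℝ × E n)}
    {θ : ℝ × E n → M} (hΦ : ∀ q ∈ U, Φ q ∈ W ∧ θ (Φ q) = q)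
    (hθ : ∀ a ∈ W, a ∈ hyperboloid n → θ a ∈ U ∧ Φ (θ a) = a ∧
        ContMDiffAt 𝓘(ℝ, ℝ × E n) (𝓡 n) ∞ θ a) {γ : ℝ → M} (hγ : IsUnitGeodesic g γ)
    (hg : IsHyperbolicMetric g) {a b r : ℝ} (hr : r ∈ Ioo a b) (hrU : γ r ∈ U)
    (hW : ∀ s ∈ Ioo a b, hypGeodesic (Φ (γ r)) (dmap Φ (γ r) (vel γ r)) (s - r) ∈ W ∧
      0 < (hypGeodesic (Φ (γ r)) (dmap Φ (γ r) (vel γ r)) (s - r)).1) {s : ℝ}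
    (hs : s ∈ Ioo a b) :
    γ s = θ (hypGeodesic (Φ (γ r)) (dmap Φ (γ r) (vel γ r)) (s - r)) := by
  set A := Φ (γ r) with hA
  set B := dmap Φ (γ r) (vel γ r) with hB
  set G : ℝ → ℝ × E n := fun s => hypGeodesic A B (s - r) with hG
  have hcont : Continuous γ := hγ.1.1.continuous
  have hhyp : ∀ s ∈ Ioo a b, G s ∈ hyperboloid n := fun s hs =>
    ⟨h.hypGeodesic_lorentz hγ hg hrU _, (hW s hs).2⟩
  -- continuation from an agreement of the images in Lorentz space
  have hstep : ∀ s ∈ Ioo a b, γ s ∈ U → (∃ᶠ τ in 𝓝 s, γ =ᶠ[𝓝 τ] θ ∘ G) →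
      γ =ᶠ[𝓝 s] θ ∘ G := by
    intro s hs hsU hfreq
    obtain ⟨ε, hε, hball⟩ := Metric.mem_nhds_iff.1
      ((isOpen_Ioo.mem_nhds hs : Ioo a b ∈ 𝓝 s))
    obtain ⟨ε', hε', hball'⟩ := Metric.mem_nhds_iff.1
      (hcont.continuousAt.preimage_mem_nhds (h.isOpen.mem_nhds hsU))
    set δ := min ε ε' with hδ
    have hδ0 : 0 < δ := lt_min hε hε'
    have hI1 : ∀ τ ∈ Ioo (s - δ) (s + δ), τ ∈ Ioo a b := fun τ hτ => hball (by
      rw [Real.ball_eq_Ioo]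
      exact ⟨by linarith [hτ.1, min_le_left ε ε'], by linarith [hτ.2, min_le_left ε ε']⟩)
    have hI2 : ∀ τ ∈ Ioo (s - δ) (s + δ), γ τ ∈ U := fun τ hτ => hball' (by
      rw [Real.ball_eq_Ioo]
      exact ⟨by linarith [hτ.1, min_le_right ε ε'], by linarith [hτ.2, min_le_right ε ε']⟩)
    have hmem : Ioo (s - δ) (s + δ) ∈ 𝓝 s := Ioo_mem_nhds (by linarith) (by linarith)
    obtain ⟨τ₁, hτ₁, hτ₁'⟩ := (hfreq.and_eventually hmem).exists
    have hΦG : (Φ ∘ γ) =ᶠ[𝓝 τ₁] G := by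
      filter_upwards [hτ₁, isOpen_Ioo.mem_nhds hτ₁'] with τ h1 h2
      rw [Function.comp_apply, h1, Function.comp_apply,
        (hθ _ (hW τ (hI1 τ h2)).1 (hhyp τ (hI1 τ h2))).2.1]
    filter_upwards [hmem] with τ hτ
    -- Near s the image of γ and the curve G both solve c'' = c, with the same value and derivative
    -- at τ₁; hence they agree on the whole small interval around s.
    have e1 := eq_cosh_add_sinh (c := Φ ∘ γ) (fun s hs => h.unitGeodesic hγ hg (hI2 s hs)) hτ₁' hτ
    have e2 := eq_cosh_add_sinh (c := G) (fun s _ => hypGeodesic_ode A B r s) hτ₁' hτ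
    rw [hΦG.deriv_eq, hΦG.self_of_nhds, ← e2] at e1
    rw [Function.comp_apply, ← e1, Function.comp_apply, (hΦ _ (hI2 τ hτ)).2]
  set u := {s : ℝ | γ =ᶠ[𝓝 s] θ ∘ G} with hu
  have huo : IsOpen u := by
    rw [isOpen_iff_mem_nhds]
    intro s hs
    exact Filter.Eventually.eventually_nhds hs
  -- The set of times near which the curves agree is open. It is also closed in the interval: at a
  -- limit time γ s equals θ(G s) since M is Hausdorff, so γ s lies in U and the continuation step
  -- applies.
  have hsub : Ioo a b ⊆ u := by
    refine isPreconnected_Ioo.subset_of_closure_inter_subset huo ⟨r, hr, ?_⟩ ?_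
    · obtain ⟨ε', hε', hball'⟩ := Metric.mem_nhds_iff.1
        (hcont.continuousAt.preimage_mem_nhds (h.isOpen.mem_nhds hrU))
      rw [Real.ball_eq_Ioo] at hball'
      have hr' : r ∈ Ioo (r - ε') (r + ε') := ⟨by linarith, by linarith⟩
      change ∀ᶠ τ in 𝓝 r, γ τ = θ (G τ)
      filter_upwards [isOpen_Ioo.mem_nhds hr'] with τ hτ
      have e1 := h.geodesic_eq hγ hg (fun τ hτ => hball' hτ) hr' hτ
      rw [hG, ← hA] at *
      simp only
      rw [← e1, (hΦ _ (hball' hτ)).2]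
    · rintro s ⟨hsc, hs⟩
      have hfreq : ∃ᶠ τ in 𝓝 s, τ ∈ u := mem_closure_iff_frequently.1 hsc
      have hGc : ContinuousAt (θ ∘ G) s := ContinuousAt.comp
        (hθ _ (hW s hs).1 (hhyp s hs)).2.2.continuousAt (hypGeodesic_ode A B r s).1.continuousAt
      have heq : γ s = (θ ∘ G) s :=
        tendsto_nhds_unique_of_frequently_eq hcont.continuousAt hGc
          (hfreq.mono fun τ hτ => (show γ =ᶠ[𝓝 τ] θ ∘ G from hτ).self_of_nhds)
      refine hstep s hs ?_ hfreq
      rw [heq]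
      exact (hθ _ (hW s hs).1 (hhyp s hs)).1
  exact (show γ =ᶠ[𝓝 s] θ ∘ G from hsub hs).self_of_nhds

section Flow

variable {m : ℕ} {S : Type*} [TopologicalSpace S] [ChartedSpace (E m) S]
  {F : ℝ → S → M}

/-- `F` is smooth near `(r, x₀)`. -/
def SmoothNear (n m : ℕ) {M : Type*} [TopologicalSpace M] [ChartedSpace (E n) M]
    {S : Type*} [TopologicalSpace S] [ChartedSpace (E m) S] (F : ℝ → S → M) (x₀ : S) (r : ℝ) : Prop :=
  ∀ᶠ q in 𝓝 (r, x₀), ContMDiffAt (𝓘(ℝ, ℝ).prod (𝓡 m)) (𝓡 n) ∞ (fun q : ℝ × S => F q.1 q.2) q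

/-- If position and velocity at one time r are smooth in x, the flow is θ of an explicit hyperbolic
geodesic. Only the geodesic from x₀ is assumed to stay in U; for nearby x this follows from the
explicit formula. -/
lemma IsLocalIsom.smoothNear_of_initial [T2Space M] (h : IsLocalIsom g U Φ) {W : Set (ℝ × E n)}
    {θ : ℝ × E n → M} (hWo : IsOpen W) (hΦ : ∀ q ∈ U, Φ q ∈ W ∧ θ (Φ q) = q)
    (hθ : ∀ a ∈ W, a ∈ hyperboloid n → θ a ∈ U ∧ Φ (θ a) = a ∧
        ContMDiffAt 𝓘(ℝ, ℝ × E n) (𝓡 n) ∞ θ a)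
    (hF : ∀ x, IsUnitGeodesic g (fun r => F r x)) (hg : IsHyperbolicMetric g) {x₀ : S} {a b r : ℝ}
    (hr : r ∈ Ioo a b) (hU : ∀ s ∈ Ioo a b, F s x₀ ∈ U) (hrU : ∀ᶠ x in 𝓝 x₀, F r x ∈ U)
    (hA : ∀ᶠ x in 𝓝 x₀, ContMDiffAt (𝓡 m) 𝓘(ℝ, ℝ × E n) ∞ (fun x => Φ (F r x)) x)
    (hB : ∀ᶠ x in 𝓝 x₀, ContMDiffAt (𝓡 m) 𝓘(ℝ, ℝ × E n) ∞
      (fun x => dmap Φ (F r x) (vel (fun r => F r x) r)) x) {s : ℝ} (hs : s ∈ Ioo a b) :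
    SmoothNear n m F x₀ s := by
  set G : ℝ × S → ℝ × E n := fun q => hypGeodesic (Φ (F r q.2))
    (dmap Φ (F r q.2) (vel (fun r => F r q.2) r)) (q.1 - r) with hG
  have hGs : ∀ᶠ x in 𝓝 x₀, ∀ σ : ℝ,
      ContMDiffAt (𝓘(ℝ, ℝ).prod (𝓡 m)) 𝓘(ℝ, ℝ × E n) ∞ G (σ, x) := by
    filter_upwards [hA, hB] with x h1 h2 σ
    have h3 : ContMDiffAt (𝓘(ℝ, ℝ).prod (𝓡 m)) 𝓘(ℝ, ℝ × E n) ∞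
      (fun q : ℝ × S => Φ (F r q.2)) (σ, x) := ContMDiffAt.comp (g := fun x => Φ (F r x)) (σ, x) h1
        contMDiffAt_snd
    have h4 : ContMDiffAt (𝓘(ℝ, ℝ).prod (𝓡 m)) 𝓘(ℝ, ℝ × E n) ∞
      (fun q : ℝ × S => dmap Φ (F r q.2) (vel (fun r => F r q.2) r)) (σ, x) :=
      ContMDiffAt.comp (g := fun x => dmap Φ (F r x) (vel (fun r => F r x) r)) (σ, x) h2
        contMDiffAt_snd
    have hcosh : ContMDiffAt (𝓘(ℝ, ℝ).prod (𝓡 m)) 𝓘(ℝ, ℝ) ∞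
        (fun q : ℝ × S => Real.cosh (q.1 - r)) (σ, x) := by
      have : ContDiff ℝ ∞ (fun s => Real.cosh (s - r)) :=
        Real.contDiff_cosh.comp (contDiff_id.sub contDiff_const)
      exact ContMDiffAt.comp (σ, x) (g := fun s => Real.cosh (s - r)) this.contMDiff.contMDiffAt
        contMDiffAt_fst
    have hsinh : ContMDiffAt (𝓘(ℝ, ℝ).prod (𝓡 m)) 𝓘(ℝ, ℝ) ∞
        (fun q : ℝ × S => Real.sinh (q.1 - r)) (σ, x) := by
      have : ContDiff ℝ ∞ (fun s => Real.sinh (s - r)) :=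
        Real.contDiff_sinh.comp (contDiff_id.sub contDiff_const)
      exact ContMDiffAt.comp (σ, x) (g := fun s => Real.sinh (s - r)) this.contMDiff.contMDiffAt
        contMDiffAt_fst
    exact (hcosh.smul h3).add (hsinh.smul h4)
  -- A compact interval [a', b'] whose interior contains r and s allows the tube argument `htube`:
  -- for x near x₀ the explicit geodesics stay in W during all of it.
  obtain ⟨a', ha', ha''⟩ : ∃ a', a < a' ∧ a' < min r s := exists_between (lt_min hr.1 hs.1)
  obtain ⟨b', hb', hb''⟩ : ∃ b', max r s < b' ∧ b' < b := exists_between (max_lt hr.2 hs.2)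
  have hr' : r ∈ Ioo a' b' :=
    ⟨ha''.trans_le (min_le_left _ _), (le_max_left _ _).trans_lt hb'⟩
  have hs' : s ∈ Ioo a' b' :=
    ⟨ha''.trans_le (min_le_right _ _), (le_max_right _ _).trans_lt hb'⟩
  have hW0 : ∀ σ ∈ Icc a' b', G (σ, x₀) ∈ W ∧ 0 < (G (σ, x₀)).1 := by
    intro σ hσ
    have hσ' : σ ∈ Ioo a b := ⟨ha'.trans_le hσ.1, hσ.2.trans_lt hb''⟩
    have e1 := h.geodesic_eq (hF x₀) hg hU hr hσ'
    have e2 : G (σ, x₀) = Φ (F σ x₀) := e1.symm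
    rw [e2]
    exact ⟨(hΦ _ (hU σ hσ')).1, (h.hyp _ (hU σ hσ')).2⟩
  have htube : ∀ᶠ x in 𝓝 x₀, ∀ σ ∈ Icc a' b', G (σ, x) ∈ W ∧ 0 < (G (σ, x)).1 := by
    refine isCompact_Icc.eventually_forall_of_forall_eventually fun σ hσ => ?_
    have hc : ContinuousAt (fun z : S × ℝ => G (z.2, z.1)) (x₀, σ) :=
      ContinuousAt.comp (g := G) (hGs.self_of_nhds σ).continuousAt continuous_swap.continuousAt
    exact hc.eventually ((hWo.inter (isOpen_lt continuous_const continuous_fst)).mem_nhds (hW0 σ hσ))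
  have hall : ∀ᶠ x in 𝓝 x₀, F r x ∈ U ∧ (∀ σ ∈ Icc a' b', G (σ, x) ∈ W ∧ 0 < (G (σ, x)).1) ∧
      ∀ σ : ℝ, ContMDiffAt (𝓘(ℝ, ℝ).prod (𝓡 m)) 𝓘(ℝ, ℝ × E n) ∞ G (σ, x) :=
    hrU.and (htube.and hGs)
  have hfin : ∀ᶠ q in 𝓝 (s, x₀), q.1 ∈ Ioo a' b' ∧ F r q.2 ∈ U ∧
      (∀ σ ∈ Icc a' b', G (σ, q.2) ∈ W ∧ 0 < (G (σ, q.2)).1) ∧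
      ∀ σ : ℝ, ContMDiffAt (𝓘(ℝ, ℝ).prod (𝓡 m)) 𝓘(ℝ, ℝ × E n) ∞ G (σ, q.2) :=
    (continuousAt_fst.eventually (isOpen_Ioo.mem_nhds hs')).and
      ((continuousAt_snd (p := (s, x₀))).eventually hall)
  have hEq : ∀ q : ℝ × S, q.1 ∈ Ioo a' b' → F r q.2 ∈ U →
      (∀ σ ∈ Icc a' b', G (σ, q.2) ∈ W ∧ 0 < (G (σ, q.2)).1) → F q.1 q.2 = θ (G q) := by
    intro q h1 h2 h3
    exact h.geodesic_follows hΦ hθ (hF q.2) hg hr' h2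
      (fun σ hσ => h3 σ (Ioo_subset_Icc_self hσ)) h1
  filter_upwards [hfin.eventually_nhds] with q hq
  obtain ⟨h1, h2, h3, h4⟩ := hq.self_of_nhds
  have hGq : G q ∈ W ∧ 0 < (G q).1 := h3 q.1 (Ioo_subset_Icc_self h1)
  have hhyp : G q ∈ hyperboloid n := ⟨h.hypGeodesic_lorentz (hF q.2) hg h2 _, hGq.2⟩
  refine ((hθ _ hGq.1 hhyp).2.2.comp q (h4 q.1)).congr_of_eventuallyEq ?_
  filter_upwards [hq] with q' hq'
  exact hEq q' hq'.1 hq'.2.1 hq'.2.2.1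

omit [IsManifold (𝓡 n) ∞ M] in
lemma SmoothNear.continuousAt {x₀ : S} {r : ℝ} (h : SmoothNear n m F x₀ r) :
    ContinuousAt (fun q : ℝ × S => F q.1 q.2) (r, x₀) :=
  (ContMDiffAt.continuousAt h.self_of_nhds)

/-- The radius δ depends on r and x₀ only, not on the time at which smoothness is known. This makes
the set of good times closed as well as open. -/
lemma SmoothNear.propagate [T2Space M] (hF : ∀ x, IsUnitGeodesic g (fun r => F r x))
    (hg : IsHyperbolicMetric g) {x₀ : S} {r : ℝ} :
    ∃ δ > 0, ∀ s₁ ∈ Ioo (r - δ) (r + δ), SmoothNear n m F x₀ s₁ →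
      ∀ s₂ ∈ Ioo (r - δ) (r + δ), SmoothNear n m F x₀ s₂ := by
  obtain ⟨U₀, Φ, h₀, hr₀⟩ := hg.exists_isLocalIsom (F r x₀)
  obtain ⟨U, W, θ, hUo, hrU, hUU, hWo, hΦ, hθ⟩ := h₀.exists_inverse hr₀
  have h : IsLocalIsom g U Φ := ⟨hUo, h₀.smooth.mono hUU, fun q hq => h₀.hyp q (hUU hq),
    fun q hq => h₀.isom q (hUU hq)⟩
  obtain ⟨δ, hδ, hball⟩ := Metric.mem_nhds_iff.1
    ((hF x₀).1.1.continuous.continuousAt.preimage_mem_nhds (hUo.mem_nhds hrU))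
  rw [Real.ball_eq_Ioo] at hball
  refine ⟨δ, hδ, fun s₁ hs₁ hsm s₂ hs₂ => ?_⟩
  -- a box on which the flow is smooth and stays in `U`
  have hbox : ∀ᶠ q : ℝ × S in 𝓝 (s₁, x₀), F q.1 q.2 ∈ U ∧
      ContMDiffAt (𝓘(ℝ, ℝ).prod (𝓡 m)) (𝓡 n) ∞ (fun q : ℝ × S => F q.1 q.2) q :=
    (hsm.continuousAt.eventually (hUo.mem_nhds (hball hs₁))).and hsm
  rw [nhds_prod_eq] at hbox
  obtain ⟨pa, hpa, pb, hpb, hp⟩ := Filter.eventually_prod_iff.1 hbox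
  obtain ⟨ε, hε, hεball⟩ := Metric.mem_nhds_iff.1 hpa
  rw [Real.ball_eq_Ioo] at hεball
  have hs₁' : s₁ ∈ Ioo (s₁ - ε) (s₁ + ε) := ⟨by linarith, by linarith⟩
  -- Smoothness of F gives smooth positions. The velocity at s₁ is recovered from the positions at
  -- s₁ and s₃, since Φ(F s₃) = cosh(s₃ - s₁) Φ(F s₁) + sinh(s₃ - s₁) × velocity and this sinh is
  -- not zero.
  set s₃ := s₁ + ε / 2 with hs₃
  have hs₃' : s₃ ∈ Ioo (s₁ - ε) (s₁ + ε) := ⟨by linarith, by linarith⟩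
  have hslice : ∀ s ∈ Ioo (s₁ - ε) (s₁ + ε), ∀ x, pb x →
      ContMDiffAt (𝓡 m) 𝓘(ℝ, ℝ × E n) ∞ (fun x => Φ (F s x)) x := by
    intro s hs x hx
    have h1 := hp (hεball hs) hx
    have h2 : ContMDiffAt (𝓡 m) (𝓡 n) ∞ (fun x => F s x) x :=
      ContMDiffAt.comp (g := fun q : ℝ × S => F q.1 q.2) (f := fun x => (s, x)) x h1.2
        (contMDiffAt_const.prodMk contMDiffAt_id)
    exact (h.contMDiffAt h1.1).comp x h2
  have hsinh : Real.sinh (s₃ - s₁) ≠ 0 := by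
    rw [Real.sinh_ne_zero, hs₃]
    linarith
  refine h.smoothNear_of_initial hWo hΦ hθ hF hg hs₁ (fun s hs => hball hs) ?_ ?_ ?_ hs₂
  · filter_upwards [hpb] with x hx
    exact (hp (hεball hs₁') hx).1
  · filter_upwards [hpb] with x hx
    exact hslice s₁ hs₁' x hx
  · filter_upwards [eventually_eventually_nhds.2 hpb] with x hx
    have h3 : ContMDiffAt (𝓡 m) 𝓘(ℝ, ℝ × E n) ∞ (fun x => (Real.sinh (s₃ - s₁))⁻¹ •
        (Φ (F s₃ x) - Real.cosh (s₃ - s₁) • Φ (F s₁ x))) x := by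
      have h4 := hslice s₃ hs₃' x hx.self_of_nhds
      have h5 := hslice s₁ hs₁' x hx.self_of_nhds
      have hc : ∀ c : ℝ, ContMDiffAt (𝓡 m) 𝓘(ℝ, ℝ) ∞ (fun _ : S => c) x :=
        fun c => contMDiffAt_const
      exact (hc _).smul (h4.sub ((hc _).smul h5))
    refine h3.congr_of_eventuallyEq ?_
    filter_upwards [hx] with z hz
    have h6 := h.geodesic_eq (hF z) hg (a := s₁ - ε) (b := s₁ + ε)
      (fun s hs => (hp (hεball hs) hz).1) hs₁' hs₃'
    rw [h6, hypGeodesic, add_sub_cancel_left (Real.cosh (s₃ - s₁) • Φ (F s₁ z)), smul_smul,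
      inv_mul_cancel₀ hsinh, one_smul]

/-- A family of complete unit speed geodesics is smooth if it is smooth near time zero. -/
lemma contMDiff_flow [T2Space M] (hF : ∀ x, IsUnitGeodesic g (fun r => F r x))
    (hg : IsHyperbolicMetric g) (h0 : ∀ x₀, SmoothNear n m F x₀ 0) :
    ContMDiff (𝓘(ℝ, ℝ).prod (𝓡 m)) (𝓡 n) ∞ (fun q : ℝ × S => F q.1 q.2) := by
  rintro ⟨r, x₀⟩
  -- A good time within δ of r makes r good, and if r is good then so are all times within δ;
  -- connectedness of the line finishes.
  have hclopen : IsClopen {r | SmoothNear n m F x₀ r} := by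
    constructor
    · rw [← isOpen_compl_iff, isOpen_iff_mem_nhds]
      intro r hr
      obtain ⟨δ, hδ, h⟩ := SmoothNear.propagate (n := n) (m := m) hF hg (x₀ := x₀) (r := r)
      filter_upwards [Ioo_mem_nhds (show r - δ < r by linarith) (show r < r + δ by linarith)]
        with s hs hs'
      exact hr (h s hs hs' r ⟨by linarith, by linarith⟩)
    · rw [isOpen_iff_mem_nhds]
      intro r hr
      obtain ⟨δ, hδ, h⟩ := SmoothNear.propagate (n := n) (m := m) hF hg (x₀ := x₀) (r := r)
      filter_upwards [Ioo_mem_nhds (show r - δ < r by linarith) (show r < r + δ by linarith)]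
        with s hs
      exact h r ⟨by linarith, by linarith⟩ hr s hs
  have huniv := hclopen.eq_univ ⟨0, h0 x₀⟩
  have hr : SmoothNear n m F x₀ r := by
    have : r ∈ {r | SmoothNear n m F x₀ r} := huniv ▸ mem_univ r
    exact this
  exact hr.self_of_nhds

/-- The image in Lorentz space of a smooth vector field along a map is smooth. -/
lemma IsLocalIsom.contMDiffAt_dmap (h : IsLocalIsom g U Φ) {f : S → M} {V : S → E n} {x : S} {p : M}
    (hf : ContMDiffAt (𝓡 m) (𝓡 n) ∞ f x) (hfU : f x ∈ U)
    (hp : f x ∈ (extChartAt (𝓡 n) p).source)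
    (hV : ContMDiffAt (𝓡 m) 𝓘(ℝ, E n) ∞ (fun z => dchart p (f z) (V z)) x) :
    ContMDiffAt (𝓡 m) 𝓘(ℝ, ℝ × E n) ∞ (fun z => dmap Φ (f z) (V z)) x := by
  have h1 : ContMDiffAt (𝓡 m) 𝓘(ℝ, E n) ∞ (fun z => extChartAt (𝓡 n) p (f z)) x :=
    (contMDiffAt_chart hp).comp x hf
  have h2 : ContDiffAt ℝ ∞ (fderiv ℝ (Φ ∘ (extChartAt (𝓡 n) p).symm)) (extChartAt (𝓡 n) p (f x)) :=
    (h.localModel hfU hp).smooth.fderiv_right (by simp)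
  have h3 := (ContMDiffAt.comp x h2.contMDiffAt h1).clm_apply hV
  refine h3.congr_of_eventuallyEq ?_
  filter_upwards [hf.continuousAt.eventually (h.isOpen.mem_nhds hfU),
    hf.continuousAt.eventually ((isOpen_extChartAt_source p).mem_nhds hp)] with z hz hz'
  exact (h.fderiv_dchart hz hz' (V z)).symm

lemma smoothNear_zero [T2Space M] (hF : ∀ x, IsUnitGeodesic g (fun r => F r x))
    (hg : IsHyperbolicMetric g) (hf : ContMDiff (𝓡 m) (𝓡 n) ∞ (F 0))
    (hV : ContMDiff (𝓡 m) (𝓡 n).tangent ∞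
      (fun x => (⟨F 0 x, vel (fun r => F r x) 0⟩ : TangentBundle (𝓡 n) M))) (x₀ : S) :
    SmoothNear n m F x₀ 0 := by
  obtain ⟨U₀, Φ, h₀, hr₀⟩ := hg.exists_isLocalIsom (F 0 x₀)
  obtain ⟨U, W, θ, hUo, hrU, hUU, hWo, hΦ, hθ⟩ := h₀.exists_inverse hr₀
  have h : IsLocalIsom g U Φ := ⟨hUo, h₀.smooth.mono hUU, fun q hq => h₀.hyp q (hUU hq),
    fun q hq => h₀.isom q (hUU hq)⟩
  obtain ⟨δ, hδ, hball⟩ := Metric.mem_nhds_iff.1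
    ((hF x₀).1.1.continuous.continuousAt.preimage_mem_nhds (hUo.mem_nhds hrU))
  rw [Real.ball_eq_Ioo] at hball
  have h0 : (0 : ℝ) ∈ Ioo (0 - δ) (0 + δ) := ⟨by linarith, by linarith⟩
  have hev : ∀ᶠ x in 𝓝 x₀, F 0 x ∈ U := hf.continuous.continuousAt.eventually (hUo.mem_nhds hrU)
  refine h.smoothNear_of_initial hWo hΦ hθ hF hg h0 (fun s hs => hball hs) hev ?_ ?_ h0
  · filter_upwards [hev] with x hx
    exact (h.contMDiffAt hx).comp x hf.contMDiffAt
  · filter_upwards [hev] with x hx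
    have hps := mem_extChartAt_source (I := 𝓡 n) (F 0 x)
    exact h.contMDiffAt_dmap (V := fun x => vel (fun r => F r x) 0) hf.contMDiffAt hx hps
      ((contMDiffAt_tangentBundle_iff hf.contMDiffAt hps).1 hV.contMDiffAt)

end Flow

end HypSurf

end

/-! ### Unit normals and the second fundamental form in coordinates -/

noncomputable section

namespace HypSurf

/-- The normal, on the side of `v` and of length one for `b`, of the plane that is the range
of `A`. -/
def normalVec (b : Bil 3) (A : E 2 →L[ℝ] E 3) (v : E 3) : E 3 :=
  let a₁ := A (EuclideanSpace.single 0 1)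
  let a₂ := A (EuclideanSpace.single 1 1)
  let m := (b a₁ a₁ * b a₂ a₂ - b a₁ a₂ ^ 2) • v - (b a₂ a₂ * b v a₁ - b a₁ a₂ * b v a₂) • a₁ -
    (b a₁ a₁ * b v a₂ - b a₁ a₂ * b v a₁) • a₂
  (√(b m m))⁻¹ • m

lemma single_eq (u : E 2) :
    u = u 0 • EuclideanSpace.single 0 (1 : ℝ) + u 1 • EuclideanSpace.single 1 (1 : ℝ) := by
  ext i
  fin_cases i <;> simp

section normalVec

variable {b : Bil 3} {A : E 2 →L[ℝ] E 3} {v : E 3}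

/-- D is the Gram determinant of a₁, a₂, and m is D times the component of v perpendicular to their
plane. Clearing the denominator keeps m polynomial in the data. -/
lemma normalVec_aux (hb : IsInner b) (hA : Function.Injective A) (hv : ∀ u, A u ≠ v) :
    let a₁ := A (EuclideanSpace.single 0 1)
    let a₂ := A (EuclideanSpace.single 1 1)
    let D := b a₁ a₁ * b a₂ a₂ - b a₁ a₂ ^ 2
    let m := D • v - (b a₂ a₂ * b v a₁ - b a₁ a₂ * b v a₂) • a₁ -
      (b a₁ a₁ * b v a₂ - b a₁ a₂ * b v a₁) • a₂
    0 < D ∧ m ≠ 0 ∧ b m a₁ = 0 ∧ b m a₂ = 0 := by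
  intro a₁ a₂ D m
  have hne : ∀ u, u ≠ 0 → A u ≠ 0 := fun u hu h => hu (hA (h.trans (map_zero A).symm))
  have hD : 0 < D := by
    have h2 : 0 < b a₂ a₂ := hb.pos _ (hne _ (by simp))
    -- This is the strict Cauchy–Schwarz inequality: the vector is nonzero by independence of a₁,
    -- a₂, and its square is b(a₂, a₂) D.
    have h1 : 0 < b (b a₂ a₂ • a₁ - b a₁ a₂ • a₂) (b a₂ a₂ • a₁ - b a₁ a₂ • a₂) := by
      refine hb.pos _ ?_
      have : b a₂ a₂ • a₁ - b a₁ a₂ • a₂ = A (b a₂ a₂ • EuclideanSpace.single 0 1 -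
          b a₁ a₂ • EuclideanSpace.single 1 1) := by simp [a₁, a₂]
      rw [this]
      refine hne _ fun h => ?_
      have := congrArg (fun u : E 2 => u 0) h
      simp at this
      exact h2.ne' this
    have h3 : b (b a₂ a₂ • a₁ - b a₁ a₂ • a₂) (b a₂ a₂ • a₁ - b a₁ a₂ • a₂) = b a₂ a₂ * D := by
      simp only [map_sub, map_smul, sub_apply, smul_apply, smul_eq_mul, hb.symm a₂ a₁, D]
      ring
    rw [h3] at h1
    exact (pos_iff_pos_of_mul_pos h1).1 h2
  refine ⟨hD, ?_, ?_, ?_⟩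
  · intro hm
    set c₁ := b a₂ a₂ * b v a₁ - b a₁ a₂ * b v a₂
    set c₂ := b a₁ a₁ * b v a₂ - b a₁ a₂ * b v a₁
    apply hv ((D⁻¹ * c₁) • EuclideanSpace.single 0 1 + (D⁻¹ * c₂) • EuclideanSpace.single 1 1)
    have h1 : D • v = c₁ • a₁ + c₂ • a₂ := by
      have h2 : D • v - c₁ • a₁ - c₂ • a₂ = 0 := hm
      rw [sub_sub, sub_eq_zero] at h2
      exact h2
    have h2 : v = D⁻¹ • (c₁ • a₁ + c₂ • a₂) := by
      rw [← h1, smul_smul, inv_mul_cancel₀ hD.ne', one_smul]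
    rw [h2]
    simp [smul_smul, a₁, a₂]
  · simp only [m, D, map_sub, map_smul, sub_apply, smul_apply, smul_eq_mul, hb.symm a₂ a₁]
    ring
  · simp only [m, D, map_sub, map_smul, sub_apply, smul_apply, smul_eq_mul]
    ring

lemma normalVec_spec (hb : IsInner b) (hA : Function.Injective A) (hv : ∀ u, A u ≠ v) :
    b (normalVec b A v) (normalVec b A v) = 1 ∧ (∀ u, b (normalVec b A v) (A u) = 0) ∧
      0 < b (normalVec b A v) v := by
  obtain ⟨hD, hm, h1, h2⟩ := normalVec_aux hb hA hv
  set a₁ := A (EuclideanSpace.single 0 1) with ha₁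
  set a₂ := A (EuclideanSpace.single 1 1) with ha₂
  set D := b a₁ a₁ * b a₂ a₂ - b a₁ a₂ ^ 2 with hDdef
  set c₁ := b a₂ a₂ * b v a₁ - b a₁ a₂ * b v a₂
  set c₂ := b a₁ a₁ * b v a₂ - b a₁ a₂ * b v a₁
  set m := D • v - c₁ • a₁ - c₂ • a₂ with hmdef
  have hN : normalVec b A v = (√(b m m))⁻¹ • m := rfl
  have hmm : 0 < b m m := hb.pos m hm
  have hs : 0 < √(b m m) := Real.sqrt_pos.2 hmm
  rw [hN]
  refine ⟨?_, fun u => ?_, ?_⟩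
  · simp only [map_smul, smul_apply, smul_eq_mul]
    nth_rewrite 3 [← Real.mul_self_sqrt hmm.le]
    field_simp
  · have hu : A u = u 0 • a₁ + u 1 • a₂ := by
      conv_lhs => rw [single_eq u]
      simp [ha₁, ha₂]
    simp [hu, h1, h2]
  · have h3 : b m m = D * b m v := by
      conv_lhs => enter [2]; rw [hmdef]
      simp [h1, h2]
    have h4 : 0 < b m v := (pos_iff_pos_of_mul_pos (h3 ▸ hmm)).1 hD
    simp only [map_smul, smul_apply, smul_eq_mul]
    positivity

lemma contDiffAt_normalVec {X : Type*} [NormedAddCommGroup X] [NormedSpace ℝ X] {x : X}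
    {b : X → Bil 3} {A : X → E 2 →L[ℝ] E 3} {v : X → E 3} (hb : IsInner (b x))
    (hA : Function.Injective (A x)) (hv : ∀ u, A x u ≠ v x) (hbs : ContDiffAt ℝ ∞ b x)
    (hAs : ContDiffAt ℝ ∞ A x) (hvs : ContDiffAt ℝ ∞ v x) :
    ContDiffAt ℝ ∞ (fun z => normalVec (b z) (A z) (v z)) x := by
  have ha : ∀ u, ContDiffAt ℝ ∞ (fun z => A z u) x := fun u => hAs.clm_apply contDiffAt_const
  have hB : ∀ {p q : X → E 3}, ContDiffAt ℝ ∞ p x → ContDiffAt ℝ ∞ q x →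
      ContDiffAt ℝ ∞ (fun z => b z (p z) (q z)) x := fun hp hq => (hbs.clm_apply hp).clm_apply hq
  have ha₁ := ha (EuclideanSpace.single 0 1)
  have ha₂ := ha (EuclideanSpace.single 1 1)
  have hm := (((((hB ha₁ ha₁).mul (hB ha₂ ha₂)).sub ((hB ha₁ ha₂).pow 2)).smul hvs).sub
    ((((hB ha₂ ha₂).mul (hB hvs ha₁)).sub ((hB ha₁ ha₂).mul (hB hvs ha₂))).smul ha₁)).sub
    ((((hB ha₁ ha₁).mul (hB hvs ha₂)).sub ((hB ha₁ ha₂).mul (hB hvs ha₁))).smul ha₂)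
  have hpos := hb.pos _ (normalVec_aux hb hA hv).2.1
  exact (((hB hm hm).sqrt hpos.ne').inv (Real.sqrt_pos.2 hpos).ne').smul hm

/-- A unit normal completes a tangent plane to the whole space. -/
lemma exists_eq_add_smul_normal {N : E 3} (hA : Function.Injective A) (hN : b N N = 1)
    (hNA : ∀ u, b N (A u) = 0) (X : E 3) : ∃ (u : E 2) (r : ℝ), X = A u + r • N := by
  let T : (E 2 × ℝ) →ₗ[ℝ] E 3 :=
    { toFun := fun p => A p.1 + p.2 • N
      map_add' := fun p q => by simp [add_smul]; abel
      map_smul' := fun c p => by simp [mul_smul] }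
  have hinj : Function.Injective T := by
    rw [← LinearMap.ker_eq_bot, LinearMap.ker_eq_bot']
    rintro ⟨u, r⟩ h
    have h' : A u + r • N = 0 := h
    have h1 := congrArg (fun X => b N X) h'
    simp [hNA, hN] at h1
    subst h1
    rw [zero_smul, add_zero] at h'
    have := hA (h'.trans (map_zero A).symm)
    simp [this]
  have hsurj : Function.Surjective T :=
    (LinearMap.injective_iff_surjective_of_finrank_eq_finrank (by simp)).1 hinj
  obtain ⟨⟨u, r⟩, h⟩ := hsurj X
  exact ⟨u, r, h.symm⟩

lemma eq_zero_of_perp {N : E 3} (hb : IsInner b) (hA : Function.Injective A) (hN : b N N = 1)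
    (hNA : ∀ u, b N (A u) = 0) {X : E 3} (hXA : ∀ u, b X (A u) = 0) (hXN : b X N = 0) : X = 0 := by
  obtain ⟨u, r, h⟩ := exists_eq_add_smul_normal hA hN hNA X
  apply hb.eq_zero
  conv_lhs => enter [2]; rw [h]
  simp [hXA, hXN]

/-- A vector with the three defining properties is a multiple of N; the length makes the factor ±1
and the side makes it positive. So any choice of unit normal equals `normalVec`. -/
lemma normal_unique {N N' : E 3} (hb : IsInner b) (hA : Function.Injective A) (hN : b N N = 1)
    (hNA : ∀ u, b N (A u) = 0) (hv : 0 < b N v) (hN' : b N' N' = 1)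
    (hNA' : ∀ u, b N' (A u) = 0) (hv' : 0 < b N' v) : N' = N := by
  have h1 : N' - (b N' N) • N = 0 := by
    apply eq_zero_of_perp hb hA hN hNA
    · intro u; simp [hNA, hNA']
    · simp [hN]
  rw [sub_eq_zero] at h1
  set α := b N' N with hα
  have h2 : α * α = 1 := by
    rw [h1] at hN'
    simpa [hN] using hN'
  have h3 : 0 < α := by
    rw [h1] at hv'
    simp only [map_smul, smul_apply, smul_eq_mul] at hv'
    exact (pos_iff_pos_of_mul_pos hv').2 hv
  have h4 : α = 1 := by nlinarith
  rw [h1, h4, one_smul]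

end normalVec

/-- The second fundamental form of a hypersurface in coordinates. -/
lemma second_fundamental_coord {k n : ℕ} {G : E n → Bil n} {φ N : E k → E n} {z : E k}
    (hφ : ContDiffAt ℝ ∞ φ z) (hN : DifferentiableAt ℝ N z) (hI : IsInner (G (φ z)))
    (hd : DifferentiableAt ℝ G (φ z))
    (hs : ∀ᶠ y in 𝓝 (φ z), ∀ u v, G y u v = G y v u)
    (hN1 : ∀ᶠ x in 𝓝 z, G (φ x) (N x) (N x) = 1)
    (hNφ : ∀ᶠ x in 𝓝 z, ∀ v, G (φ x) (N x) (fderiv ℝ φ x v) = 0) (u : E k) :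
    G (φ z) (fderiv ℝ N z u + christoffel G (φ z) (fderiv ℝ φ z u) (N z)) (N z) = 0 ∧
    ∀ v, G (φ z) (fderiv ℝ N z u + christoffel G (φ z) (fderiv ℝ φ z u) (N z)) (fderiv ℝ φ z v) =
      - G (φ z) (N z) (fderiv ℝ (fderiv ℝ φ) z u v +
        christoffel G (φ z) (fderiv ℝ φ z u) (fderiv ℝ φ z v)) := by
  have hφd : HasFDerivAt φ (fderiv ℝ φ z) z := (hφ.differentiableAt (by simp)).hasFDerivAt
  have hG : HasFDerivAt (fun x => G (φ x)) ((fderiv ℝ G (φ z)).comp (fderiv ℝ φ z)) z :=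
    HasFDerivAt.comp z hd.hasFDerivAt hφd
  have hD : DifferentiableAt ℝ (fderiv ℝ φ) z :=
    (hφ.fderiv_right (m := 1) one_add_one_le_infty).differentiableAt (by simp)
  -- The two claims are the derivatives along u of G(N, N) = 1 and G(N, dφ v) = 0; `metric_compat`
  -- turns the derivative of G into Christoffel terms.
  constructor
  · have h1 := (hG.clm_apply hN.hasFDerivAt).clm_apply hN.hasFDerivAt
    have h2 := h1.unique ((hasFDerivAt_const (1 : ℝ) z).congr_of_eventuallyEq hN1)
    have h3 := congrArg (fun l : E k →L[ℝ] ℝ => l u) h2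
    simp at h3
    rw [metric_compat hI hd hs] at h3
    have h4 := hI.symm (N z) (fderiv ℝ N z u)
    have h5 := hI.symm (N z) (christoffel G (φ z) (fderiv ℝ φ z u) (N z))
    simp only [map_add, add_apply]
    linarith
  · intro v
    have hDv : HasFDerivAt (fun x => fderiv ℝ φ x v) ((fderiv ℝ (fderiv ℝ φ) z).flip v) z :=
      (ContinuousLinearMap.apply ℝ (E n) v).hasFDerivAt.comp z hD.hasFDerivAt
    have h1 := (hG.clm_apply hN.hasFDerivAt).clm_apply hDv
    have h2 := h1.unique ((hasFDerivAt_const (0 : ℝ) z).congr_of_eventuallyEq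
      (hNφ.mono fun x hx => hx v))
    have h3 := congrArg (fun l : E k →L[ℝ] ℝ => l u) h2
    simp at h3
    rw [metric_compat hI hd hs] at h3
    simp only [map_add, add_apply]
    linarith

end HypSurf

end

/-! ### The immersed surface and its normal field in charts -/

noncomputable section

namespace HypSurf

variable {M : Type*} [TopologicalSpace M] [ChartedSpace (E 3) M] [IsManifold (𝓡 3) ∞ M]
  {S : Type*} [TopologicalSpace S] [ChartedSpace (E 2) S] [IsManifold (𝓡 2) ∞ S]

/-- The differential of a map from a surface to a 3-manifold. -/
def dsurf (f : S → M) (x : S) : E 2 →L[ℝ] E 3 := mfderiv (𝓡 2) (𝓡 3) f x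

/-- The surface in the preferred charts at `p` and `x₀`. -/
def surfCoord (f : S → M) (p : M) (x₀ : S) (z : E 2) : E 3 :=
  extChartAt (𝓡 3) p (f ((extChartAt (𝓡 2) x₀).symm z))

/-- A vector field along the surface in the preferred charts at `p` and `x₀`. -/
def fieldCoord (f : S → M) (V : S → E 3) (p : M) (x₀ : S) (z : E 2) : E 3 :=
  dchart p (f ((extChartAt (𝓡 2) x₀).symm z)) (V ((extChartAt (𝓡 2) x₀).symm z))

/-- The domain of the surface in the preferred charts at `p` and `x₀`. -/
def coordDomain (f : S → M) (p : M) (x₀ : S) : Set (E 2) :=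
  (extChartAt (𝓡 2) x₀).target ∩
    (fun z => f ((extChartAt (𝓡 2) x₀).symm z)) ⁻¹' (extChartAt (𝓡 3) p).source

/-- The unit normal of the surface, as a vector of `E 3`. -/
def nrm (g : RMetric 3 M) (f : S → M) (ν : (x : S) → TangentSpace (𝓡 3) (f x)) (x : S) : E 3 :=
  unitNormal g f ν x

variable {g : RMetric 3 M} {f : S → M} {ν : (x : S) → TangentSpace (𝓡 3) (f x)} {p : M} {x₀ : S}
  {z : E 2}

lemma coordDomain_self (f : S → M) (x : S) :
    extChartAt (𝓡 2) x x ∈ coordDomain f (f x) x := by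
  refine ⟨mem_extChartAt_target x, ?_⟩
  simp only [mem_preimage, extChartAt_to_inv]
  exact mem_extChartAt_source _

lemma mem_coordDomain {x : S} (hx : x ∈ (extChartAt (𝓡 2) x₀).source)
    (hfx : f x ∈ (extChartAt (𝓡 3) p).source) : extChartAt (𝓡 2) x₀ x ∈ coordDomain f p x₀ := by
  refine ⟨(extChartAt (𝓡 2) x₀).map_source hx, ?_⟩
  simp only [mem_preimage, (extChartAt (𝓡 2) x₀).left_inv hx]
  exact hfx

section

variable (hf : IsImmersedSurface f)

include hf

lemma isOpen_coordDomain (p : M) (x₀ : S) : IsOpen (coordDomain f p x₀) :=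
  ((hf.1.continuous.comp_continuousOn
    (contMDiffOn_extChartAt_symm (n := ∞) x₀).continuousOn)).isOpen_inter_preimage
    (isOpen_extChartAt_target x₀) (isOpen_extChartAt_source p)

lemma contMDiffAt_param (hz : z ∈ coordDomain f p x₀) :
    ContMDiffAt 𝓘(ℝ, E 2) (𝓡 3) ∞ (fun z => f ((extChartAt (𝓡 2) x₀).symm z)) z :=
  hf.1.contMDiffAt.comp z (contMDiffAt_chartInv hz.1)

lemma contDiffAt_surfCoord (hz : z ∈ coordDomain f p x₀) :
    ContDiffAt ℝ ∞ (surfCoord f p x₀) z := by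
  rw [← contMDiffAt_iff_contDiffAt]
  exact (contMDiffAt_chart hz.2).comp z (contMDiffAt_param hf hz)

lemma fderiv_surfCoord (hz : z ∈ coordDomain f p x₀) (u : E 2) :
    fderiv ℝ (surfCoord f p x₀) z u = dchart p (f ((extChartAt (𝓡 2) x₀).symm z))
      (dsurf f ((extChartAt (𝓡 2) x₀).symm z) (dchartInv x₀ z u)) := by
  rw [← mfderiv_eq_fderiv]
  have h1 := mfderiv_comp z ((contMDiffAt_chart hz.2).mdifferentiableAt (by simp))
    ((contMDiffAt_param hf hz).mdifferentiableAt (by simp))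
  have h2 := mfderiv_comp z ((hf.1.contMDiffAt
    (x := (extChartAt (𝓡 2) x₀).symm z)).mdifferentiableAt (by simp))
    ((contMDiffAt_chartInv hz.1).mdifferentiableAt (by simp))
  change mfderiv 𝓘(ℝ, E 2) (𝓡 3) (fun z => f ((extChartAt (𝓡 2) x₀).symm z)) z = _ at h2
  rw [h2] at h1
  exact congrArg (fun l : E 2 →L[ℝ] E 3 => l u) h1

lemma dsurf_injective (x : S) : Function.Injective (dsurf f x) := hf.2 x

lemma fderiv_surfCoord_injective (hz : z ∈ coordDomain f p x₀) :
    Function.Injective (fderiv ℝ (surfCoord f p x₀) z) := by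
  intro u v huv
  rw [fderiv_surfCoord hf hz, fderiv_surfCoord hf hz] at huv
  have h1 := congrArg (dchartInv p (extChartAt (𝓡 3) p (f ((extChartAt (𝓡 2) x₀).symm z)))) huv
  rw [dchartInv_dchart hz.2, dchartInv_dchart hz.2] at h1
  exact dchartInv_injective hz.1 (dsurf_injective hf _ h1)

lemma surfCoord_mem_target (hz : z ∈ coordDomain f p x₀) :
    surfCoord f p x₀ z ∈ (extChartAt (𝓡 3) p).target :=
  (extChartAt (𝓡 3) p).map_source hz.2

lemma contDiffAt_fieldCoord {V : S → E 3}
    (hV : ContMDiff (𝓡 2) (𝓡 3).tangent ∞ (fun x => (⟨f x, V x⟩ : TangentBundle (𝓡 3) M)))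
    (hz : z ∈ coordDomain f p x₀) : ContDiffAt ℝ ∞ (fieldCoord f V p x₀) z := by
  rw [← contMDiffAt_iff_contDiffAt]
  have h1 : ContMDiffAt 𝓘(ℝ, E 2) (𝓡 3).tangent ∞
      (fun z => (⟨f ((extChartAt (𝓡 2) x₀).symm z), V ((extChartAt (𝓡 2) x₀).symm z)⟩ :
        TangentBundle (𝓡 3) M)) z := hV.contMDiffAt.comp z (contMDiffAt_chartInv hz.1)
  exact (contMDiffAt_tangentBundle_iff (contMDiffAt_param hf hz) hz.2).1 h1

variable (hν : IsTransverseOrientation f ν)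

include hν

lemma nrm_spec (g : RMetric 3 M) (x : S) :
    metricAt g (f x) (nrm g f ν x) (nrm g f ν x) = 1 ∧
    (∀ u, metricAt g (f x) (nrm g f ν x) (dsurf f x u) = 0) ∧
    0 < metricAt g (f x) (nrm g f ν x) (ν x) := by
  have h : IsUnitNormal g f ν x (unitNormal g f ν x) :=
    Classical.epsilon_spec (p := IsUnitNormal g f ν x)
      ⟨normalVec (metricAt g (f x)) (dsurf f x) (ν x),
        normalVec_spec (metricAt_isInner g (f x)) (dsurf_injective hf x) (hν.2 x)⟩
  exact h

lemma fieldCoord_not_mem (hz : z ∈ coordDomain f p x₀) (u : E 2) :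
    fderiv ℝ (surfCoord f p x₀) z u ≠ fieldCoord f ν p x₀ z := by
  intro huv
  rw [fderiv_surfCoord hf hz] at huv
  have h1 := congrArg (dchartInv p (extChartAt (𝓡 3) p (f ((extChartAt (𝓡 2) x₀).symm z)))) huv
  have h2 := dchartInv_dchart hz.2 (ν ((extChartAt (𝓡 2) x₀).symm z))
  rw [dchartInv_dchart hz.2] at h1
  exact hν.2 _ _ (h1.trans h2)

/-- The properties of the unit normal in coordinates. -/
lemma normalCoord_spec (g : RMetric 3 M) (hz : z ∈ coordDomain f p x₀) :
    chartMetric g p (surfCoord f p x₀ z) (fieldCoord f (nrm g f ν) p x₀ z)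
      (fieldCoord f (nrm g f ν) p x₀ z) = 1 ∧
    (∀ u, chartMetric g p (surfCoord f p x₀ z) (fieldCoord f (nrm g f ν) p x₀ z)
      (fderiv ℝ (surfCoord f p x₀) z u) = 0) ∧
    0 < chartMetric g p (surfCoord f p x₀ z) (fieldCoord f (nrm g f ν) p x₀ z)
      (fieldCoord f ν p x₀ z) := by
  obtain ⟨h1, h2, h3⟩ := nrm_spec hf hν g ((extChartAt (𝓡 2) x₀).symm z)
  refine ⟨?_, fun u => ?_, ?_⟩
  · rw [fieldCoord, surfCoord, chartMetric_eq g hz.2, h1]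
  · rw [fieldCoord, surfCoord.eq_def, fderiv_surfCoord hf hz, chartMetric_eq g hz.2, h2]
  · exact h3.trans_eq (chartMetric_eq g hz.2 _ _).symm

/-- `unitNormal` is a pointwise choice with no smoothness of its own; this identity with an explicit
expression supplies smoothness in the point and in the metric. -/
lemma normalCoord_eq (g : RMetric 3 M) (hz : z ∈ coordDomain f p x₀) :
    fieldCoord f (nrm g f ν) p x₀ z = normalVec (chartMetric g p (surfCoord f p x₀ z))
      (fderiv ℝ (surfCoord f p x₀) z) (fieldCoord f ν p x₀ z) := by
  have hb := chartMetric_isInner g (surfCoord_mem_target hf hz)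
  have hA := fderiv_surfCoord_injective hf hz
  obtain ⟨h1, h2, h3⟩ := normalVec_spec hb hA (fieldCoord_not_mem hf hν hz)
  obtain ⟨h1', h2', h3'⟩ := normalCoord_spec hf hν g hz
  exact normal_unique hb hA h1 h2 h3 h1' h2' h3'

/-- The unit normals of a smooth family of metrics form a smooth family. -/
lemma contDiffAt_normalCoord {J : Set ℝ} (hJ : IsOpen J) {g : ℝ → RMetric 3 M}
    (hg : IsSmoothFamilyOn J g) {t : ℝ} (ht : t ∈ J) (hz : z ∈ coordDomain f p x₀) :
    ContDiffAt ℝ ∞ (fun q : ℝ × E 2 => fieldCoord f (nrm (g q.1) f ν) p x₀ q.2) (t, z) := by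
  have hφ : ContDiffAt ℝ ∞ (fun q : ℝ × E 2 => surfCoord f p x₀ q.2) (t, z) :=
    ContDiffAt.comp (g := surfCoord f p x₀) (t, z) (contDiffAt_surfCoord hf hz) contDiffAt_snd
  have hD : ContDiffAt ℝ ∞ (fun q : ℝ × E 2 => fderiv ℝ (surfCoord f p x₀) q.2) (t, z) :=
    ContDiffAt.comp (g := fderiv ℝ (surfCoord f p x₀)) (t, z)
      ((contDiffAt_surfCoord hf hz).fderiv_right (by simp)) contDiffAt_snd
  have hv : ContDiffAt ℝ ∞ (fun q : ℝ × E 2 => fieldCoord f ν p x₀ q.2) (t, z) :=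
    ContDiffAt.comp (g := fieldCoord f ν p x₀) (t, z) (contDiffAt_fieldCoord hf hν.1 hz)
      contDiffAt_snd
  have hb : ContDiffAt ℝ ∞ (fun q : ℝ × E 2 => chartMetric (g q.1) p (surfCoord f p x₀ q.2))
      (t, z) :=
    ContDiffAt.comp (g := fun q : ℝ × E 3 => chartMetric (g q.1) p q.2)
      (f := fun q : ℝ × E 2 => (q.1, surfCoord f p x₀ q.2)) (t, z)
      (hg.contDiffAt_chartMetric hJ ht (surfCoord_mem_target hf hz)) (contDiffAt_fst.prodMk hφ)
  refine (contDiffAt_normalVec (x := (t, z))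
    (b := fun q : ℝ × E 2 => chartMetric (g q.1) p (surfCoord f p x₀ q.2))
    (A := fun q => fderiv ℝ (surfCoord f p x₀) q.2) (v := fun q => fieldCoord f ν p x₀ q.2)
    (chartMetric_isInner (g t) (surfCoord_mem_target hf hz))
    (fderiv_surfCoord_injective hf hz) (fieldCoord_not_mem hf hν hz) hb hD hv).congr_of_eventuallyEq
    ?_
  filter_upwards [continuousAt_snd.eventually ((isOpen_coordDomain hf p x₀).mem_nhds hz)] with q hq
  exact normalCoord_eq hf hν (g q.1) hq

lemma contDiffAt_normalCoord_const (g : RMetric 3 M) (hz : z ∈ coordDomain f p x₀) :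
    ContDiffAt ℝ ∞ (fieldCoord f (nrm g f ν) p x₀) z :=
  ContDiffAt.comp (g := fun q : ℝ × E 2 => fieldCoord f (nrm g f ν) p x₀ q.2)
    (f := fun z => ((0 : ℝ), z)) z
    (contDiffAt_normalCoord hf hν isOpen_univ (isSmoothFamilyOn_const g univ) (mem_univ 0) hz)
    (contDiffAt_const.prodMk contDiffAt_id)

/-- The unit normal is a smooth vector field along the surface. -/
lemma contMDiff_nrm (g : RMetric 3 M) : ContMDiff (𝓡 2) (𝓡 3).tangent ∞
    (fun x => (⟨f x, nrm g f ν x⟩ : TangentBundle (𝓡 3) M)) := by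
  intro x
  rw [contMDiffAt_tangentBundle_iff hf.1.contMDiffAt (mem_extChartAt_source (I := 𝓡 3) (f x))]
  have h1 := contDiffAt_normalCoord_const hf hν g (coordDomain_self f x)
  have h2 := ContMDiffAt.comp (I' := 𝓘(ℝ, E 2)) x h1.contMDiffAt
    (contMDiffAt_chart (mem_extChartAt_source (I := 𝓡 2) x))
  refine h2.congr_of_eventuallyEq ?_
  filter_upwards [(isOpen_extChartAt_source (I := 𝓡 2) x).mem_nhds (mem_extChartAt_source x)]
    with z hz
  simp only [Function.comp_apply, fieldCoord, (extChartAt (𝓡 2) x).left_inv hz]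

end

end HypSurf

end

/-! ### The shape operator -/

noncomputable section

namespace HypSurf

variable {M : Type*} [TopologicalSpace M] [ChartedSpace (E 3) M] [IsManifold (𝓡 3) ∞ M]
  {S : Type*} [TopologicalSpace S] [ChartedSpace (E 2) S] [IsManifold (𝓡 2) ∞ S]

/-- The covariant derivative along the surface of the vector field `V`, in the preferred charts
at `p` and `x₀`. -/
def covCoord (g : RMetric 3 M) (f : S → M) (V : S → E 3) (p : M) (x₀ : S) (z u : E 2) : E 3 :=
  fderiv ℝ (fieldCoord f V p x₀) z u + christoffel (chartMetric g p) (surfCoord f p x₀ z)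
    (fderiv ℝ (surfCoord f p x₀) z u) (fieldCoord f V p x₀ z)

/-- The shape operator of a surface as a continuous linear map. -/
def shapeCLM (g : RMetric 3 M) (f : S → M) (ν : (x : S) → TangentSpace (𝓡 3) (f x)) (x : S) :
    E 2 →L[ℝ] E 2 :=
  LinearMap.toContinuousLinearMap (shapeOperator g f ν x : E 2 →ₗ[ℝ] E 2)

/-- The differential of a map from a surface to a vector space. -/
def dfun {Y : Type*} [NormedAddCommGroup Y] [NormedSpace ℝ Y] (F : S → Y) (x : S) : E 2 →L[ℝ] Y :=
  mfderiv (𝓡 2) 𝓘(ℝ, Y) F x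

/-- The image in Lorentz space of the unit normal. -/
def lorentzNormal (Φ : M → ℝ × E 3) (g : RMetric 3 M) (f : S → M)
    (ν : (x : S) → TangentSpace (𝓡 3) (f x)) (x : S) : ℝ × E 3 :=
  dmap Φ (f x) (nrm g f ν x)

variable {g : RMetric 3 M} {f : S → M} {ν : (x : S) → TangentSpace (𝓡 3) (f x)} {p : M} {x₀ x : S}
  {z : E 2} {U : Set M} {Φ : M → ℝ × E 3} (hf : IsImmersedSurface f)

lemma fderiv_comp_chartInv {Y : Type*} [NormedAddCommGroup Y] [NormedSpace ℝ Y] {F : S → Y}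
    (hz : z ∈ (extChartAt (𝓡 2) x₀).target)
    (hF : MDifferentiableAt (𝓡 2) 𝓘(ℝ, Y) F ((extChartAt (𝓡 2) x₀).symm z)) (u : E 2) :
    fderiv ℝ (F ∘ (extChartAt (𝓡 2) x₀).symm) z u =
      dfun F ((extChartAt (𝓡 2) x₀).symm z) (dchartInv x₀ z u) := by
  rw [← mfderiv_eq_fderiv]
  have h := mfderiv_comp z hF ((contMDiffAt_chartInv hz).mdifferentiableAt (by simp))
  exact congrArg (fun l : E 2 →L[ℝ] Y => l u) h

include hf

lemma fderiv_surfCoord_self (x : S) (u : E 2) :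
    fderiv ℝ (surfCoord f (f x) x) (extChartAt (𝓡 2) x x) u = dsurf f x u := by
  rw [fderiv_surfCoord hf (coordDomain_self f x), dchartInv_self, extChartAt_to_inv, dchart_self]
  rfl

variable (hν : IsTransverseOrientation f ν)

include hν

lemma covDerivAlong_eq (g : RMetric 3 M) (x : S) (u : E 2) :
    (covDerivAlong g f (unitNormal g f ν) x u : E 3) =
      covCoord g f (nrm g f ν) (f x) x (extChartAt (𝓡 2) x x) u := by
  have hW : ContMDiffAt (𝓡 2) 𝓘(ℝ, E 3) ∞ (fun y => dchart (f x) (f y) (nrm g f ν y)) x :=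
    (contMDiffAt_tangentBundle_iff hf.1.contMDiffAt (mem_extChartAt_source (I := 𝓡 3) (f x))).1
      (contMDiff_nrm hf hν g x)
  have h1 := fderiv_comp_chartInv (mem_extChartAt_target (I := 𝓡 2) x)
    (F := fun y => dchart (f x) (f y) (nrm g f ν y))
    (by rw [extChartAt_to_inv]; exact hW.mdifferentiableAt (by simp)) u
  rw [dchartInv_self, extChartAt_to_inv] at h1
  rw [covCoord, fderiv_surfCoord_self hf]
  have h2 : surfCoord f (f x) x (extChartAt (𝓡 2) x x) = extChartAt (𝓡 3) (f x) (f x) := by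
    rw [surfCoord, extChartAt_to_inv]
  have h3 : fieldCoord f (nrm g f ν) (f x) x (extChartAt (𝓡 2) x x) = nrm g f ν x := by
    rw [fieldCoord, extChartAt_to_inv, dchart_self]; rfl
  rw [h2, h3]
  exact congrArg (· + christoffelAt g (f x) (dsurf f x u) (nrm g f ν x)) h1.symm

lemma contMDiffAt_lorentzNormal (h : IsLocalIsom g U Φ) (hx : f x ∈ U) :
    ContMDiffAt (𝓡 2) 𝓘(ℝ, ℝ × E 3) ∞ (lorentzNormal Φ g f ν) x :=
  h.contMDiffAt_dmap hf.1.contMDiffAt hx (mem_extChartAt_source (I := 𝓡 3) (f x))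
    ((contMDiffAt_tangentBundle_iff hf.1.contMDiffAt (mem_extChartAt_source (I := 𝓡 3) (f x))).1
      (contMDiff_nrm hf hν g x))

/-- In Gauss' formula for the normal field the term along Φ is the product of the normal with a
tangent vector, hence zero. The left side involves no chart at p or x₀, so covariant derivatives
computed in different charts can be compared through it. -/
lemma mfderiv_lorentzNormal (h : IsLocalIsom g U Φ)
    (hx : f x ∈ U) (hp : f x ∈ (extChartAt (𝓡 3) p).source)
    (hx₀ : x ∈ (extChartAt (𝓡 2) x₀).source) (u : E 2) :
    dfun (lorentzNormal Φ g f ν) x u =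
      dmap Φ (f x) (dchartInv p (extChartAt (𝓡 3) p (f x))
        (covCoord g f (nrm g f ν) p x₀ (extChartAt (𝓡 2) x₀ x) (dchart x₀ x u))) := by
  have hz := mem_coordDomain hx₀ hp
  have hl := (extChartAt (𝓡 2) x₀).left_inv hx₀
  have h1 := fderiv_comp_chartInv hz.1 (F := lorentzNormal Φ g f ν)
    (by rw [hl]; exact (contMDiffAt_lorentzNormal hf hν h hx).mdifferentiableAt (by simp))
    (dchart x₀ x u)
  rw [dchartInv_dchart hx₀, hl] at h1
  rw [← h1]
  have hy : surfCoord f p x₀ (extChartAt (𝓡 2) x₀ x) = extChartAt (𝓡 3) p (f x) := by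
    rw [surfCoord, hl]
  have h2 := ((h.localModel hx hp).fderiv_push hy
    ((contDiffAt_surfCoord hf hz).differentiableAt (by simp))
    ((contDiffAt_normalCoord_const hf hν g hz).differentiableAt (by simp))).2 (dchart x₀ x u)
  have h3 := (normalCoord_spec hf hν g hz).2.1 (dchart x₀ x u)
  rw [hy, (chartMetric_isInner g ((extChartAt (𝓡 3) p).map_source hp)).symm] at h3
  rw [h3, zero_smul, add_zero, h.fderiv_comp ((extChartAt (𝓡 3) p).map_source hp)
    (by rwa [(extChartAt (𝓡 3) p).left_inv hp]), (extChartAt (𝓡 3) p).left_inv hp, ← hy] at h2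
  rw [← hy]
  refine Eq.trans (congrArg (fun l : E 2 →L[ℝ] ℝ × E 3 => l (dchart x₀ x u))
    (Filter.EventuallyEq.fderiv_eq ?_)) h2
  have hc : ContinuousAt (fun z => f ((extChartAt (𝓡 2) x₀).symm z)) (extChartAt (𝓡 2) x₀ x) :=
    (contMDiffAt_param hf hz).continuousAt
  filter_upwards [(isOpen_coordDomain hf p x₀).mem_nhds hz,
    hc.eventually (h.isOpen.mem_nhds (by simpa only [hl] using hx))] with z hz hzU
  exact (h.fderiv_dchart hzU hz.2 _).symm

/-- The choice in `shapeOperator` needs a witness. The covariant derivative of the normal is tangent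
because the normal has length one, so it lifts through df. The lift is linear because dΦ ∘ df
carries it to a genuine differential and is injective. -/
lemma isShapeOperator_shapeOperator (hg : IsHyperbolicMetric g) (x : S) :
    IsShapeOperator g f ν x (shapeOperator g f ν x) := by
  obtain ⟨U, Φ, h, hx⟩ := hg.exists_isLocalIsom (f x)
  have hz := coordDomain_self f x
  have hp := mem_extChartAt_source (I := 𝓡 3) (f x)
  have hx₀ := mem_extChartAt_source (I := 𝓡 2) x
  have hT := mfderiv_lorentzNormal hf hν h hx hp hx₀
  simp only [dchart_self, dchartInv_self, ContinuousLinearMap.id_apply] at hT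
  set w : E 2 → E 3 := covCoord g f (nrm g f ν) (f x) x (extChartAt (𝓡 2) x x)
  have hy : surfCoord f (f x) x (extChartAt (𝓡 2) x x) = extChartAt (𝓡 3) (f x) (f x) := by
    rw [surfCoord, extChartAt_to_inv]
  have htan : ∀ u, ∃ v, dsurf f x v = w u := by
    intro u
    have hev : ∀ᶠ z in 𝓝 (extChartAt (𝓡 2) x x), z ∈ coordDomain f (f x) x :=
      (isOpen_coordDomain hf (f x) x).mem_nhds hz
    have hyt := surfCoord_mem_target hf hz
    have h1 := (second_fundamental_coord (contDiffAt_surfCoord hf hz)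
      ((contDiffAt_normalCoord_const hf hν g hz).differentiableAt (by simp))
      (chartMetric_isInner g hyt) ((contDiffAt_chartMetric g hyt).differentiableAt (by simp))
      (Filter.Eventually.mono ((isOpen_extChartAt_target _).mem_nhds hyt)
        fun y hy => (chartMetric_isInner g hy).symm)
      (hev.mono fun z hz => (normalCoord_spec hf hν g hz).1)
      (hev.mono fun z hz => (normalCoord_spec hf hν g hz).2.1) u).1
    obtain ⟨hN, hNA, -⟩ := normalCoord_spec hf hν g hz
    obtain ⟨v, r, hv⟩ := exists_eq_add_smul_normal (fderiv_surfCoord_injective hf hz) hN hNA (w u)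
    have h2 : chartMetric g (f x) (surfCoord f (f x) x (extChartAt (𝓡 2) x x)) (w u)
      (fieldCoord f (nrm g f ν) (f x) x (extChartAt (𝓡 2) x x)) = 0 := h1
    rw [hv, map_add, add_apply, (chartMetric_isInner g hyt).symm, hNA, map_smul, smul_apply, hN,
      smul_eq_mul, mul_one, zero_add] at h2
    refine ⟨v, ?_⟩
    rw [hv, h2, zero_smul, add_zero, fderiv_surfCoord_self hf]
  choose b hb using htan
  have hinj : Function.Injective ((dmap Φ (f x)).comp (dsurf f x)) :=
    (h.dmap_injective hx).comp (dsurf_injective hf x)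
  have hb' : ∀ u, (dmap Φ (f x)).comp (dsurf f x) (b u) =
      dfun (lorentzNormal Φ g f ν) x u := by
    intro u
    rw [hT, ContinuousLinearMap.comp_apply, hb]
  let B : E 2 →ₗ[ℝ] E 2 :=
    { toFun := b
      map_add' := fun u v => hinj (by rw [map_add, hb', hb', hb', map_add])
      map_smul' := fun c u => hinj (by rw [map_smul, hb', hb', map_smul, RingHom.id_apply]) }
  refine Classical.epsilon_spec (p := IsShapeOperator g f ν x) ⟨B, fun u => ?_⟩
  exact (hb u).trans (covDerivAlong_eq hf hν g x u).symm

lemma dsurf_shapeCLM_self (hg : IsHyperbolicMetric g) (x : S) (u : E 2) :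
    dsurf f x (shapeCLM g f ν x u) =
      covCoord g f (nrm g f ν) (f x) x (extChartAt (𝓡 2) x x) u :=
  (isShapeOperator_shapeOperator hf hν hg x u).trans (covDerivAlong_eq hf hν g x u)

/-- The derivative of the image in Lorentz space of the unit normal. -/
lemma mfderiv_lorentzNormal_shape (hg : IsHyperbolicMetric g) (h : IsLocalIsom g U Φ)
    (hx : f x ∈ U) (u : E 2) :
    dfun (lorentzNormal Φ g f ν) x u =
      dmap Φ (f x) (dsurf f x (shapeCLM g f ν x u)) := by
  rw [mfderiv_lorentzNormal hf hν h hx (mem_extChartAt_source (I := 𝓡 3) (f x))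
    (mem_extChartAt_source (I := 𝓡 2) x), dsurf_shapeCLM_self hf hν hg, dchart_self, dchartInv_self]
  rfl

/-- The shape operator in coordinates. -/
lemma covCoord_eq (hg : IsHyperbolicMetric g) (hz : z ∈ coordDomain f p x₀) (u : E 2) :
    covCoord g f (nrm g f ν) p x₀ z u = dchart p (f ((extChartAt (𝓡 2) x₀).symm z))
      (dsurf f ((extChartAt (𝓡 2) x₀).symm z)
        (shapeCLM g f ν ((extChartAt (𝓡 2) x₀).symm z) (dchartInv x₀ z u))) := by
  set x := (extChartAt (𝓡 2) x₀).symm z with hxdef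
  obtain ⟨U, Φ, h, hx⟩ := hg.exists_isLocalIsom (f x)
  have hx₀ : x ∈ (extChartAt (𝓡 2) x₀).source := (extChartAt (𝓡 2) x₀).map_target hz.1
  have hr : extChartAt (𝓡 2) x₀ x = z := (extChartAt (𝓡 2) x₀).right_inv hz.1
  have h1 := mfderiv_lorentzNormal hf hν h hx hz.2 hx₀ (dchartInv x₀ z u)
  rw [mfderiv_lorentzNormal_shape hf hν hg h hx] at h1
  have h2 := h.dmap_injective hx h1
  have h3 := dchart_dchartInv hx₀ u
  rw [hr] at h2 h3
  rw [h3] at h2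
  rw [h2, dchart_dchartInv hz.2]

/-- The shape operator is self-adjoint. -/
lemma shapeCLM_symm (hg : IsHyperbolicMetric g) (x : S) (u v : E 2) :
    metricAt g (f x) (dsurf f x (shapeCLM g f ν x u)) (dsurf f x v) =
      metricAt g (f x) (dsurf f x u) (dsurf f x (shapeCLM g f ν x v)) := by
  have hz := coordDomain_self f x
  have hyt := surfCoord_mem_target hf hz
  have hy : surfCoord f (f x) x (extChartAt (𝓡 2) x x) = extChartAt (𝓡 3) (f x) (f x) := by
    rw [surfCoord, extChartAt_to_inv]
  have hev : ∀ᶠ z in 𝓝 (extChartAt (𝓡 2) x x), z ∈ coordDomain f (f x) x :=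
    (isOpen_coordDomain hf (f x) x).mem_nhds hz
  have hsymm : ∀ᶠ y in 𝓝 (surfCoord f (f x) x (extChartAt (𝓡 2) x x)), ∀ u v,
      chartMetric g (f x) y u v = chartMetric g (f x) y v u :=
    Filter.Eventually.mono ((isOpen_extChartAt_target _).mem_nhds hyt)
      fun y hy => (chartMetric_isInner g hy).symm
  have hd := (contDiffAt_chartMetric g hyt).differentiableAt (by simp)
  have h1 : ∀ u v, metricAt g (f x) (dsurf f x (shapeCLM g f ν x u)) (dsurf f x v) =
      - chartMetric g (f x) (surfCoord f (f x) x (extChartAt (𝓡 2) x x))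
        (fieldCoord f (nrm g f ν) (f x) x (extChartAt (𝓡 2) x x))
        (fderiv ℝ (fderiv ℝ (surfCoord f (f x) x)) (extChartAt (𝓡 2) x x) u v +
          christoffel (chartMetric g (f x)) (surfCoord f (f x) x (extChartAt (𝓡 2) x x))
            (fderiv ℝ (surfCoord f (f x) x) (extChartAt (𝓡 2) x x) u)
            (fderiv ℝ (surfCoord f (f x) x) (extChartAt (𝓡 2) x x) v)) := fun u v => by
    rw [dsurf_shapeCLM_self hf hν hg x u, ← fderiv_surfCoord_self hf x v, ← chartMetric_self, ← hy]
    exact (second_fundamental_coord (contDiffAt_surfCoord hf hz)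
      ((contDiffAt_normalCoord_const hf hν g hz).differentiableAt (by simp))
      (chartMetric_isInner g hyt) hd hsymm
      (hev.mono fun z hz => (normalCoord_spec hf hν g hz).1)
      (hev.mono fun z hz => (normalCoord_spec hf hν g hz).2.1) u).2 v
  have h2 : IsSymmSndFDerivAt ℝ (surfCoord f (f x) x) (extChartAt (𝓡 2) x x) :=
    (contDiffAt_surfCoord hf hz).isSymmSndFDerivAt
      (by rw [minSmoothness_of_isRCLikeNormedField]; exact two_le_infty)
  -- The second fundamental form is -⟨N, D²f(u, v) + Γ(df u, df v)⟩, symmetric because D²f and Γ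
  -- are.
  rw [h1 u v, (metricAt_isInner g (f x)).symm (dsurf f x u), h1 v u,
    christoffel_symm (chartMetric_isInner g hyt) hd hsymm, h2 u v]

end HypSurf

end

/-! ### The normal flow and its limit at infinity -/

noncomputable section

namespace HypSurf

variable {M : Type*} [TopologicalSpace M] [ChartedSpace (E 3) M] [IsManifold (𝓡 3) ∞ M]
  {S : Type*} [TopologicalSpace S] [ChartedSpace (E 2) S] [IsManifold (𝓡 2) ∞ S]

/-- `F` is the normal flow of the surface `f`, for a hyperbolic metric. -/
structure NormalFlow (g : RMetric 3 M) (f : S → M) (ν : (x : S) → TangentSpace (𝓡 3) (f x))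
    (F : ℝ → S → M) : Prop where
  smooth : ContMDiff (𝓘(ℝ, ℝ).prod (𝓡 2)) (𝓡 3) ∞ (fun q : ℝ × S => F q.1 q.2)
  geod : ∀ x, IsUnitGeodesic g (fun r => F r x)
  zero : ∀ x, F 0 x = f x
  vel_zero : ∀ x, vel (fun r => F r x) 0 = nrm g f ν x

variable {g : RMetric 3 M} {f : S → M} {ν : (x : S) → TangentSpace (𝓡 3) (f x)} {x : S}
  {U : Set M} {Φ : M → ℝ × E 3} {F : ℝ → S → M}

lemma vel_of_velocity_eq {γ : ℝ → M} {s : ℝ} {p : M} {N : E 3}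
    (h : velocity γ s = (⟨p, N⟩ : TangentBundle (𝓡 3) M)) : γ s = p ∧ vel γ s = N :=
  ⟨congrArg (fun v : TangentBundle (𝓡 3) M => v.1) h,
    congrArg (fun v : TangentBundle (𝓡 3) M => (v.2 : E 3)) h⟩

lemma IsNormalFlow.normalFlow (hf : IsImmersedSurface f) (hν : IsTransverseOrientation f ν)
    (h : IsNormalFlow g f ν F) : NormalFlow g f ν F := by
  have h0 : ∀ x, F 0 x = f x ∧ vel (fun r => F r x) 0 = nrm g f ν x :=
    fun x => vel_of_velocity_eq (h.2 x).2
  refine ⟨h.1, fun x => ⟨(h.2 x).1, ?_⟩, fun x => (h0 x).1, fun x => (h0 x).2⟩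
  change metricAt g (F 0 x) (vel (fun r => F r x) 0) (vel (fun r => F r x) 0) = 1
  rw [(h0 x).1, (h0 x).2]
  exact (nrm_spec hf hν g x).1

section

variable (hF : NormalFlow g f ν F)

include hF

lemma NormalFlow.contMDiff (r : ℝ) : ContMDiff (𝓡 2) (𝓡 3) ∞ (F r) :=
  ContMDiff.comp (g := fun q : ℝ × S => F q.1 q.2) (f := fun x => (r, x)) hF.smooth
    (contMDiff_const.prodMk contMDiff_id)

lemma NormalFlow.hasMFDerivAt (h : IsLocalIsom g U Φ) {r : ℝ} (hr : F r x ∈ U) :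
    HasMFDerivAt (𝓡 2) 𝓘(ℝ, ℝ × E 3) (fun y => Φ (F r y)) x
      ((dmap Φ (F r x)).comp (dsurf (F r) x)) :=
  (h.mdifferentiableAt hr).hasMFDerivAt.comp x
    (((hF.contMDiff r).contMDiffAt.mdifferentiableAt (by simp)).hasMFDerivAt)

/-- The differential of the normal flow, in Lorentz space. -/
lemma NormalFlow.dmap_dsurf (hg : IsHyperbolicMetric g) (h : IsLocalIsom g U Φ) {a b r₀ r : ℝ}
    (hr₀ : r₀ ∈ Ioo a b) (hr : r ∈ Ioo a b) (hU : ∀ᶠ y in 𝓝 x, ∀ s ∈ Ioo a b, F s y ∈ U) (u : E 2) :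
    dmap Φ (F r x) (dsurf (F r) x u) = hypGeodesic (dmap Φ (F r₀ x) (dsurf (F r₀) x u))
      (dfun (fun y => dmap Φ (F r₀ y) (vel (fun s => F s y) r₀)) x u) (r - r₀) := by
  have hUx := hU.self_of_nhds
  have hgeo : ∀ᶠ y in 𝓝 x, ∀ s ∈ Ioo a b, Φ (F s y) = hypGeodesic (Φ (F r₀ y))
      (dmap Φ (F r₀ y) (vel (fun s => F s y) r₀)) (s - r₀) := by
    filter_upwards [hU] with y hy s hs
    exact h.geodesic_eq (hF.geod y) hg hy hr₀ hs
  obtain ⟨c, hrc, hcb⟩ := exists_between hr₀.2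
  have hc : c ∈ Ioo a b := ⟨hr₀.1.trans hrc, hcb⟩
  have hsc : Real.sinh (c - r₀) ≠ 0 := (Real.sinh_pos_iff.2 (sub_pos.2 hrc)).ne'
  set A : ℝ → S → ℝ × E 3 := fun s y => Φ (F s y)
  set T : S → ℝ × E 3 := fun y => dmap Φ (F r₀ y) (vel (fun s => F s y) r₀)
  have hA : ∀ s ∈ Ioo a b, HasMFDerivAt (𝓡 2) 𝓘(ℝ, ℝ × E 3) (A s) x
      ((dmap Φ (F s x)).comp (dsurf (F s) x)) := fun s hs => hF.hasMFDerivAt h (hUx s hs)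
  -- The velocity field at time r₀ is a combination of the surfaces at the two times c and r₀, both
  -- differentiable.
  have hT : MDifferentiableAt (𝓡 2) 𝓘(ℝ, ℝ × E 3) T x := by
    have h1 := ((hA c hc).add ((hA r₀ hr₀).const_smul (-Real.cosh (c - r₀)))).const_smul
      (Real.sinh (c - r₀))⁻¹
    refine (h1.congr_of_eventuallyEq ?_).mdifferentiableAt
    filter_upwards [hgeo] with y hy
    have h2 := hy c hc
    simp only [hypGeodesic] at h2
    simp only [Pi.smul_apply, Pi.add_apply, A]
    rw [h2, neg_smul, add_neg_cancel_comm, smul_smul, inv_mul_cancel₀ hsc, one_smul]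
  have h1 := ((hA r₀ hr₀).const_smul (Real.cosh (r - r₀))).add
    (hT.hasMFDerivAt.const_smul (Real.sinh (r - r₀)))
  have h2 : A r =ᶠ[𝓝 x] Real.cosh (r - r₀) • A r₀ + Real.sinh (r - r₀) • T := by
    filter_upwards [hgeo] with y hy
    exact hy r hr
  have h3 := hasMFDerivAt_unique (hA r hr) (h1.congr_of_eventuallyEq h2)
  exact congrArg (fun l : E 2 →L[ℝ] ℝ × E 3 => l u) h3

/-- Near each time the surfaces of the normal flow lie in the domain of a local isometry. -/
lemma NormalFlow.exists_box (hg : IsHyperbolicMetric g) (r₀ : ℝ) (x : S) :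
    ∃ (U : Set M) (Φ : M → ℝ × E 3) (a b : ℝ), IsLocalIsom g U Φ ∧ r₀ ∈ Ioo a b ∧
      ∀ᶠ y in 𝓝 x, ∀ s ∈ Ioo a b, F s y ∈ U := by
  obtain ⟨U, Φ, h, hU⟩ := hg.exists_isLocalIsom (F r₀ x)
  have h1 : ∀ᶠ q in 𝓝 (r₀, x), F q.1 q.2 ∈ U :=
    (hF.smooth.continuous.continuousAt (x := (r₀, x))).eventually (h.isOpen.mem_nhds hU)
  rw [nhds_prod_eq, Filter.eventually_prod_iff] at h1
  obtain ⟨pa, hpa, pb, hpb, hp⟩ := h1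
  obtain ⟨δ, hδ, hball⟩ := Metric.mem_nhds_iff.1 hpa
  refine ⟨U, Φ, r₀ - δ, r₀ + δ, h, ⟨by linarith, by linarith⟩, ?_⟩
  filter_upwards [hpb] with y hy s hs
  refine hp (hball ?_) hy
  rw [Real.ball_eq_Ioo]
  exact hs

/-- The squared length of the differential of the normal flow. -/
lemma NormalFlow.analyticAt (hg : IsHyperbolicMetric g) (x : S) (u : E 2) (r₀ : ℝ) :
    AnalyticAt ℝ (fun r => metricAt g (F r x) (dsurf (F r) x u) (dsurf (F r) x u)) r₀ := by
  obtain ⟨U, Φ, a, b, h, hr₀, hU⟩ := hF.exists_box hg r₀ x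
  set A := dmap Φ (F r₀ x) (dsurf (F r₀) x u)
  set B := dfun (fun y => dmap Φ (F r₀ y) (vel (fun s => F s y) r₀)) x u
  have h1 : AnalyticAt ℝ (fun r => lorentzL 3 (hypGeodesic A B (r - r₀))
      (hypGeodesic A B (r - r₀))) r₀ := by
    have h2 : ContDiff ℝ ω (fun r => hypGeodesic A B (r - r₀)) := by
      unfold hypGeodesic
      exact ((Real.contDiff_cosh.comp (contDiff_id.sub contDiff_const)).smul contDiff_const).add
        ((Real.contDiff_sinh.comp (contDiff_id.sub contDiff_const)).smul contDiff_const)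
    have h3 : ContDiff ℝ ω (fun r => lorentzL 3 (hypGeodesic A B (r - r₀))
      (hypGeodesic A B (r - r₀))) := (contDiff_const.clm_apply h2).clm_apply h2
    exact h3.contDiffAt.analyticAt
  refine h1.congr ?_
  filter_upwards [isOpen_Ioo.mem_nhds hr₀] with r hr
  rw [h.isom _ (hU.self_of_nhds r hr), hF.dmap_dsurf hg h hr₀ hr hU]

/-- The metrics induced by the normal flow are given by the shape operator. -/
lemma NormalFlow.pullback_eq (hf : IsImmersedSurface f) (hν : IsTransverseOrientation f ν)
    (hg : IsHyperbolicMetric g) (x : S) (u : E 2) (r : ℝ) :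
    metricAt g (F r x) (dsurf (F r) x u) (dsurf (F r) x u) =
      metricAt g (f x) (dsurf f x (Real.cosh r • u + Real.sinh r • shapeCLM g f ν x u))
        (dsurf f x (Real.cosh r • u + Real.sinh r • shapeCLM g f ν x u)) := by
  have h1 : AnalyticOnNhd ℝ
      (fun r => metricAt g (F r x) (dsurf (F r) x u) (dsurf (F r) x u)) univ :=
    fun r _ => hF.analyticAt hg x u r
  have h2 : AnalyticOnNhd ℝ (fun r => metricAt g (f x)
      (dsurf f x (Real.cosh r • u + Real.sinh r • shapeCLM g f ν x u))
        (dsurf f x (Real.cosh r • u + Real.sinh r • shapeCLM g f ν x u))) univ := by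
    have h3 : ContDiff ℝ ω
        (fun r => dsurf f x (Real.cosh r • u + Real.sinh r • shapeCLM g f ν x u)) :=
      (dsurf f x).contDiff.comp ((Real.contDiff_cosh.smul contDiff_const).add
        (Real.contDiff_sinh.smul contDiff_const))
    exact ((contDiff_const.clm_apply h3).clm_apply h3).analyticOnNhd
  -- A single local isometry covers only small r. Both sides are real analytic in r on the whole
  -- line, so agreement near r = 0 is enough.
  refine congrFun (h1.eq_of_eventuallyEq (z₀ := 0) h2 ?_) r
  obtain ⟨U, Φ, a, b, h, h0, hU⟩ := hF.exists_box hg 0 x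
  have hF0 : F 0 = f := funext hF.zero
  have hx : f x ∈ U := by rw [← hF.zero]; exact hU.self_of_nhds 0 h0
  have hT : (fun y => dmap Φ (F 0 y) (vel (fun s => F s y) 0)) = lorentzNormal Φ g f ν := by
    ext1 y
    rw [hF.vel_zero, hF.zero, lorentzNormal]
  filter_upwards [isOpen_Ioo.mem_nhds h0] with r hr
  rw [h.isom _ (hU.self_of_nhds r hr), h.isom _ hx, hF.dmap_dsurf hg h h0 hr hU, hT, hF0,
    mfderiv_lorentzNormal_shape hf hν hg h hx]
  simp [hypGeodesic]

end

/-- The normal flow exists for complete hyperbolic metrics. -/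
lemma exists_isNormalFlow [T2Space M] (hf : IsImmersedSurface f) (hν : IsTransverseOrientation f ν)
    (hg : IsHyperbolicMetric g) (hc : IsCompleteMetric g) : ∃ F, IsNormalFlow g f ν F := by
  -- The geodesics are chosen point by point; their joint smoothness comes from `contMDiff_flow`.
  choose γ hγ hv using fun x => hc (⟨f x, unitNormal g f ν x⟩ : TangentBundle (𝓡 3) M)
  have h0 : ∀ x, γ x 0 = f x ∧ vel (γ x) 0 = nrm g f ν x := fun x => vel_of_velocity_eq (hv x)
  have hu : ∀ x, IsUnitGeodesic g (fun r => (fun r x => γ x r) r x) := by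
    refine fun x => ⟨hγ x, ?_⟩
    change metricAt g (γ x 0) (vel (γ x) 0) (vel (γ x) 0) = 1
    rw [(h0 x).1, (h0 x).2]
    exact (nrm_spec hf hν g x).1
  refine ⟨fun r x => γ x r, contMDiff_flow hu hg ?_, fun x => ⟨hγ x, hv x⟩⟩
  have hz : (fun x => γ x 0) = f := funext fun x => (h0 x).1
  refine smoothNear_zero hu hg (by simpa only [hz] using hf.1) ?_
  refine (contMDiff_nrm hf hν g).congr fun x => ?_
  change (⟨γ x 0, vel (γ x) 0⟩ : TangentBundle (𝓡 3) M) = ⟨f x, nrm g f ν x⟩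
  rw [(h0 x).2]
  exact congrArg (fun q => (⟨q, nrm g f ν x⟩ : TangentBundle (𝓡 3) M)) (h0 x).1

/-- The squared length that determines the conformal structure at infinity. -/
def infSq (g : RMetric 3 M) (f : S → M) (ν : (x : S) → TangentSpace (𝓡 3) (f x)) (x : S)
    (u : E 2) : ℝ :=
  metricAt g (f x) (dsurf f x (u + shapeCLM g f ν x u)) (dsurf f x (u + shapeCLM g f ν x u))

lemma infSq_pos (hf : IsImmersedSurface f) (h : ∀ u, u + shapeCLM g f ν x u = 0 → u = 0) {u : E 2}
    (hu : u ≠ 0) : 0 < infSq g f ν x u :=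
  (metricAt_isInner g (f x)).pos _ fun h1 =>
    hu (h u (dsurf_injective hf x (h1.trans (map_zero _).symm)))

lemma tendsto_tanh_atTop : Tendsto Real.tanh atTop (𝓝 1) := by
  have h1 : Tendsto (fun r => Real.exp (-r)) atTop (𝓝 0) :=
    Real.tendsto_exp_atBot.comp tendsto_neg_atTop_atBot
  have h2 : Tendsto (fun r => 1 - Real.exp (-r)) atTop (𝓝 1) := by
    simpa using tendsto_const_nhds.sub h1
  refine tendsto_of_tendsto_of_tendsto_of_le_of_le h2 tendsto_const_nhds (fun r => ?_)
    fun r => (Real.tanh_lt_one r).le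
  have hc := Real.one_le_cosh r
  have h3 : Real.tanh r = 1 - Real.exp (-r) / Real.cosh r := by
    rw [← Real.cosh_sub_sinh, sub_div, div_self (by positivity), Real.tanh_eq_sinh_div_cosh]
    ring
  rw [h3]
  exact sub_le_sub_left (div_le_self (Real.exp_pos _).le hc) 1

/-- The factor cosh² r cancels in the ratio, and what is left depends continuously on tanh r, which
tends to 1. -/
lemma tendsto_pullback_ratio (hf : IsImmersedSurface f) (hν : IsTransverseOrientation f ν)
    (hg : IsHyperbolicMetric g) (hF : NormalFlow g f ν F)
    (h : ∀ u, u + shapeCLM g f ν x u = 0 → u = 0) (u : E 2) {v : E 2} (hv : v ≠ 0) :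
    Tendsto (fun r => metricAt g (F r x) (dsurf (F r) x u) (dsurf (F r) x u) /
      metricAt g (F r x) (dsurf (F r) x v) (dsurf (F r) x v)) atTop
      (𝓝 (infSq g f ν x u / infSq g f ν x v)) := by
  set c : ℝ → E 2 → ℝ := fun τ u => metricAt g (f x) (dsurf f x (u + τ • shapeCLM g f ν x u))
    (dsurf f x (u + τ • shapeCLM g f ν x u))
  have hp : ∀ r u, metricAt g (F r x) (dsurf (F r) x u) (dsurf (F r) x u) = Real.cosh r ^ 2 * c (Real.tanh r) u := by
    intro r u
    refine (hF.pullback_eq hf hν hg x u r).trans ?_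
    have hch := (Real.cosh_pos r).ne'
    have h1 : Real.cosh r • u + Real.sinh r • shapeCLM g f ν x u =
        Real.cosh r • (u + Real.tanh r • shapeCLM g f ν x u) := by
      rw [smul_add, smul_smul, Real.tanh_eq_sinh_div_cosh, mul_div_cancel₀ _ hch]
    rw [h1]
    simp only [map_smul, smul_apply, smul_eq_mul, c]
    ring
  have hc : ∀ u, Tendsto (fun r => c (Real.tanh r) u) atTop (𝓝 (infSq g f ν x u)) := by
    intro u
    have h1 : Continuous (fun τ : ℝ => c τ u) := by
      have h2 : Continuous (fun τ : ℝ => dsurf f x (u + τ • shapeCLM g f ν x u)) := by fun_prop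
      exact ((metricAt g (f x)).continuous.comp h2).clm_apply h2
    have h3 : infSq g f ν x u = c 1 u := by simp [c, infSq]
    rw [h3]
    exact (h1.tendsto 1).comp tendsto_tanh_atTop
  refine ((hc u).div (hc v) (infSq_pos hf h hv).ne').congr fun r => ?_
  have hch := (Real.cosh_pos r).ne'
  rw [hp, hp, mul_div_mul_left _ _ (pow_ne_zero 2 hch), Pi.div_apply]

/-- Injectivity of 1 + τB at τ = tanh r makes F_r an immersion, and at τ = 1 it makes the limit form
nondegenerate; hence the closed interval of τ. -/
lemma isConformalStructureAtInfinity_of [T2Space M] (hf : IsImmersedSurface f)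
    (hν : IsTransverseOrientation f ν) (hg : IsHyperbolicMetric g) (hc : IsCompleteMetric g)
    (h : ∀ x, ∀ τ ∈ Icc (0 : ℝ) 1, ∀ u, u + τ • shapeCLM g f ν x u = 0 → u = 0) {k : RMetric 2 S}
    (hk : ∀ x u, metricAt k x u u = infSq g f ν x u) : IsConformalStructureAtInfinity g f ν k := by
  obtain ⟨F, hF⟩ := exists_isNormalFlow hf hν hg hc
  have hF' := hF.normalFlow hf hν
  refine ⟨F, hF, fun r hr x => ?_, fun x u v hv => ?_⟩
  · change Function.Injective (dsurf (F r) x)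
    refine (injective_iff_map_eq_zero _).2 fun u hu => ?_
    have h1 := hF'.pullback_eq hf hν hg x u r
    rw [hu, map_zero, eq_comm] at h1
    have h2 := dsurf_injective hf x
      (((metricAt_isInner g (f x)).eq_zero h1).trans (map_zero _).symm)
    refine h x (Real.tanh r) ⟨?_, (Real.tanh_lt_one r).le⟩ u ?_
    · rw [Real.tanh_eq_sinh_div_cosh]
      exact div_nonneg (Real.sinh_nonneg_iff.2 hr) (Real.cosh_pos r).le
    · have hch := (Real.cosh_pos r).ne'
      rw [Real.tanh_eq_sinh_div_cosh, ← smul_right_injective (E 2) hch |>.eq_iff, smul_add, smul_smul,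
        mul_div_cancel₀ _ hch, h2, smul_zero]
  · have h1 := tendsto_pullback_ratio hf hν hg hF'
      (fun u hu => h x 1 ⟨zero_le_one, le_rfl⟩ u (by rwa [one_smul])) u hv
    have h2 : metricAt k x u u / metricAt k x v v = infSq g f ν x u / infSq g f ν x v :=
      congrArg₂ (· / ·) (hk x u) (hk x v)
    exact h2 ▸ h1

/-- The conformal structure at infinity is determined by the shape operator. -/
lemma IsConformalStructureAtInfinity.ratio_eq {k : RMetric 2 S}
    (hk : IsConformalStructureAtInfinity g f ν k) (hf : IsImmersedSurface f)
    (hν : IsTransverseOrientation f ν) (hg : IsHyperbolicMetric g)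
    (h : ∀ u, u + shapeCLM g f ν x u = 0 → u = 0) (u : E 2) {v : E 2} (hv : v ≠ 0) :
    metricAt k x u u / metricAt k x v v = infSq g f ν x u / infSq g f ν x v := by
  obtain ⟨F, hF, -, hlim⟩ := hk
  exact tendsto_nhds_unique (hlim x u v hv)
    (tendsto_pullback_ratio hf hν hg (hF.normalFlow hf hν) h u hv)

end HypSurf

end

/-! ### Building smooth families of metrics from coefficients -/

noncomputable section

namespace HypSurf

section Construction

variable {n : ℕ} {M : Type*} [TopologicalSpace M] [ChartedSpace (E n) M] [IsManifold (𝓡 n) ∞ M]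

lemma contMDiffAt_clm_of_apply {D ED HD X Y : Type*} [NormedAddCommGroup ED] [NormedSpace ℝ ED]
    [TopologicalSpace HD] {I : ModelWithCorners ℝ ED HD} [TopologicalSpace D] [ChartedSpace HD D]
    [NormedAddCommGroup X] [NormedSpace ℝ X] [FiniteDimensional ℝ X]
    [NormedAddCommGroup Y] [NormedSpace ℝ Y] {m : ℕ∞ω} {f : D → X →L[ℝ] Y} {x : D}
    (h : ∀ u, ContMDiffAt I 𝓘(ℝ, Y) m (fun z => f z u) x) :
    ContMDiffAt I 𝓘(ℝ, X →L[ℝ] Y) m f x := by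
  let e₁ := ContinuousLinearEquiv.ofFinrankEq
    (Module.finrank_fin_fun ℝ (n := Module.finrank ℝ X)).symm
  let e₂ := (e₁.arrowCongr (1 : Y ≃L[ℝ] Y)).trans (ContinuousLinearEquiv.piRing _)
  have h1 : ContMDiffAt I 𝓘(ℝ, Fin (Module.finrank ℝ X) → Y) m (fun z => e₂ (f z)) x :=
    contMDiffAt_pi_space.2 fun i => h _
  have h2 : f = fun z => e₂.symm (e₂ (f z)) := by
    ext1 z; simp
  rw [h2]
  exact (ContDiff.contMDiff e₂.symm.contDiff).contMDiffAt.comp x h1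

lemma symm_trivializationAt {p q : M} (hq : q ∈ (extChartAt (𝓡 n) p).source) (v : E n) :
    ((trivializationAt (E n) (TangentSpace (𝓡 n) (M := M)) p).symm q v : E n) =
      dchartInv p (extChartAt (𝓡 n) p q) v := by
  have := isManifold_one n M
  rw [extChartAt_source] at hq
  have h := TangentBundle.symmL_trivializationAt (I := 𝓡 n) (𝕜 := ℝ) hq
  rw [ModelWithCorners.range_eq_univ, mfderivWithin_univ] at h
  refine Eq.trans ?_ (congrArg (fun l : E n →L[ℝ] E n => l v) h)
  exact (Bundle.Trivialization.symmL_apply (R := ℝ)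
    (trivializationAt (E n) (TangentSpace (𝓡 n) (M := M)) p) (b := q) (by simpa using hq) v).symm

/-- A field of bilinear forms with smooth coefficients is smooth. -/
lemma contMDiffAt_bilinear_section {X EX HX : Type*} [TopologicalSpace X] [NormedAddCommGroup EX]
    [NormedSpace ℝ EX] [TopologicalSpace HX] {I : ModelWithCorners ℝ EX HX} [ChartedSpace HX X]
    {b : X → M} {B : X → Bil n} {x : X} (hb : ContMDiffAt I (𝓡 n) ∞ b x)
    (h : ∀ u v, ContMDiffAt I 𝓘(ℝ, ℝ) ∞
      (fun z => B z (dchartInv (b x) (extChartAt (𝓡 n) (b x) (b z)) u)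
        (dchartInv (b x) (extChartAt (𝓡 n) (b x) (b z)) v)) x) :
    ContMDiffAt I ((𝓡 n).prod 𝓘(ℝ, Bil n)) ∞ (fun z => (TotalSpace.mk' (Bil n) (b z) (B z) :
      TotalSpace (Bil n) (fun p : M =>
        TangentSpace (𝓡 n) p →L[ℝ] TangentSpace (𝓡 n) p →L[ℝ] ℝ))) x := by
  have := isManifold_one n M
  refine (contMDiffAt_hom_bundle _).2 ⟨hb, ?_⟩
  apply contMDiffAt_clm_of_apply
  intro u
  apply contMDiffAt_clm_of_apply
  intro v
  refine (h u v).congr_of_eventuallyEq ?_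
  filter_upwards [hb.continuousAt.eventually ((isOpen_extChartAt_source (I := 𝓡 n) (b x)).mem_nhds
    (mem_extChartAt_source (b x)))] with z hz
  have hz' : b z ∈ (chartAt (E n) (b x)).source := by rwa [extChartAt_source] at hz
  refine (inCoordinates_apply_eq₂ (F₁ := E n) (F₂ := E n) (F₃ := ℝ)
    (E₁ := TangentSpace (𝓡 n) (M := M)) (E₂ := TangentSpace (𝓡 n) (M := M)) (E₃ := fun _ => ℝ)
    (by simpa using hz') (by simpa using hz') (by simp)).trans ?_
  have hu := symm_trivializationAt hz u
  have hv := symm_trivializationAt hz v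
  rw [← hu, ← hv]
  simp
  rfl

/-- The bundled metric requires its unit balls to be bounded. Cauchy–Schwarz bounds the functional b
v by √‖b‖ on the ball, and v is recovered by the inverse of b. -/
lemma IsInner.isVonNBounded {b : Bil n} (hb : IsInner b) :
    Bornology.IsVonNBounded ℝ {v : E n | b v v < 1} := by
  rw [NormedSpace.isVonNBounded_iff, isBounded_iff_forall_norm_le]
  refine ⟨‖b.inverse‖ * √‖b‖, fun v hv => ?_⟩
  have h1 : ‖b v‖ ≤ √‖b‖ := by
    refine ContinuousLinearMap.opNorm_le_bound _ (Real.sqrt_nonneg _) fun w => ?_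
    have h2 := hb.cauchy_schwarz v w
    have h3 : b w w ≤ ‖b‖ * ‖w‖ * ‖w‖ := (le_abs_self _).trans (b.le_opNorm₂ w w)
    have h4 : b v v * b w w ≤ 1 * (‖b‖ * ‖w‖ * ‖w‖) :=
      mul_le_mul (le_of_lt hv) h3 (hb.nonneg w) zero_le_one
    rw [← Real.sqrt_mul (hb.nonneg v)] at h2
    rw [Real.norm_eq_abs, ← Real.sqrt_sq (norm_nonneg w), ← Real.sqrt_mul (norm_nonneg _)]
    refine h2.trans (Real.sqrt_le_sqrt (h4.trans_eq ?_))
    ring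
  have h2 : v = b.inverse (b v) := hb.eq_of_forall fun w => (hb.apply_inverse _ w).symm
  calc ‖v‖ = ‖b.inverse (b v)‖ := by rw [← h2]
    _ ≤ ‖b.inverse‖ * ‖b v‖ := b.inverse.le_opNorm _
    _ ≤ _ := by gcongr

/-- The Riemannian metric given by a field of inner products with smooth coefficients. -/
def rmetricOf (b : M → Bil n) (hb : ∀ p, IsInner (b p))
    (hs : ∀ p u v, ContDiffAt ℝ ∞ (fun y => b ((extChartAt (𝓡 n) p).symm y) (dchartInv p y u)
      (dchartInv p y v)) (extChartAt (𝓡 n) p p)) : RMetric n M where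
  inner p := b p
  symm p := (hb p).symm
  pos p := (hb p).pos
  isVonNBounded p := (hb p).isVonNBounded
  contMDiff p := by
    refine contMDiffAt_bilinear_section (b := id) contMDiffAt_id fun u v => ?_
    refine (ContMDiffAt.comp p (hs p u v).contMDiffAt
      (contMDiffAt_chart (mem_extChartAt_source p))).congr_of_eventuallyEq ?_
    filter_upwards [(isOpen_extChartAt_source (I := 𝓡 n) p).mem_nhds (mem_extChartAt_source p)]
      with q hq
    simp only [Function.comp_apply, (extChartAt (𝓡 n) p).left_inv hq, id]

/-- A family of metrics with smooth coefficients is a smooth family. -/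
lemma isSmoothFamilyOn_of {J : Set ℝ} {h : ℝ → RMetric n M}
    (hs : ∀ t ∈ J, ∀ p u v, ContDiffAt ℝ ∞ (fun q : ℝ × E n =>
      metricAt (h q.1) ((extChartAt (𝓡 n) p).symm q.2) (dchartInv p q.2 u)
        (dchartInv p q.2 v)) (t, extChartAt (𝓡 n) p p)) : IsSmoothFamilyOn J h := by
  rintro ⟨t, p⟩ ⟨ht, -⟩
  refine ContMDiffAt.contMDiffWithinAt ?_
  refine contMDiffAt_bilinear_section (I := 𝓘(ℝ, ℝ).prod (𝓡 n)) (b := fun q : ℝ × M => q.2)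
    (B := fun q : ℝ × M => metricAt (h q.1) q.2) contMDiffAt_snd fun u v => ?_
  have hc : ContMDiffAt (𝓘(ℝ, ℝ).prod (𝓡 n)) 𝓘(ℝ, ℝ × E n) ∞
      (fun q : ℝ × M => (q.1, extChartAt (𝓡 n) p q.2)) (t, p) :=
    contMDiffAt_fst.prodMk_space
      ((contMDiffAt_chart (p := p) (mem_extChartAt_source p)).comp (t, p) contMDiffAt_snd)
  refine (ContMDiffAt.comp (t, p) (hs t ht p u v).contMDiffAt hc).congr_of_eventuallyEq ?_
  filter_upwards [(continuousAt_snd (p := (t, p))).eventually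
    ((isOpen_extChartAt_source (I := 𝓡 n) p).mem_nhds (mem_extChartAt_source p))] with q hq
  simp only [Function.comp_apply, (extChartAt (𝓡 n) p).left_inv hq]

end Construction

end HypSurf

end

/-! ### The stretched differentials df(1 + τB) -/

noncomputable section

namespace HypSurf

variable {M : Type*} [TopologicalSpace M] [ChartedSpace (E 3) M] [IsManifold (𝓡 3) ∞ M]
  {S : Type*} [TopologicalSpace S] [ChartedSpace (E 2) S] [IsManifold (𝓡 2) ∞ S]

/-- The differential of the surface, stretched by its shape operator. -/
def stretch (g : RMetric 3 M) (f : S → M) (ν : (x : S) → TangentSpace (𝓡 3) (f x)) (τ : ℝ) (x : S) :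
    E 2 →L[ℝ] E 3 :=
  (dsurf f x).comp (ContinuousLinearMap.id ℝ (E 2) + τ • shapeCLM g f ν x)

/-- The stretched differential of the surface, in the preferred charts at `p` and `x₀`. -/
def stretchCoord (g : RMetric 3 M) (f : S → M) (ν : (x : S) → TangentSpace (𝓡 3) (f x)) (p : M)
    (x₀ : S) (τ : ℝ) (z : E 2) : E 2 →L[ℝ] E 3 :=
  (dchart p (f ((extChartAt (𝓡 2) x₀).symm z))).comp
    ((stretch g f ν τ ((extChartAt (𝓡 2) x₀).symm z)).comp (dchartInv x₀ z))

variable {f : S → M} {ν : (x : S) → TangentSpace (𝓡 3) (f x)} {p : M} {x₀ x : S}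
  {z : E 2} {τ t : ℝ}

lemma stretch_apply (g : RMetric 3 M) (u : E 2) :
    stretch g f ν τ x u = dsurf f x (u + τ • shapeCLM g f ν x u) := by
  simp [stretch]

lemma infSq_eq (g : RMetric 3 M) (u : E 2) :
    infSq g f ν x u = metricAt g (f x) (stretch g f ν 1 x u) (stretch g f ν 1 x u) := by
  simp [stretch, infSq]

lemma chartMetric_stretchCoord (g : RMetric 3 M) (hz : z ∈ coordDomain f p x₀) (u v : E 2) :
    chartMetric g p (surfCoord f p x₀ z) (stretchCoord g f ν p x₀ τ z u)
      (stretchCoord g f ν p x₀ τ z v) =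
    metricAt g (f ((extChartAt (𝓡 2) x₀).symm z))
      (stretch g f ν τ ((extChartAt (𝓡 2) x₀).symm z) (dchartInv x₀ z u))
      (stretch g f ν τ ((extChartAt (𝓡 2) x₀).symm z) (dchartInv x₀ z v)) :=
  chartMetric_eq g hz.2 _ _

section

variable (hf : IsImmersedSurface f) (hν : IsTransverseOrientation f ν)

include hf hν

/-- The right side no longer contains the chosen shape operator, only the covariant derivative of
the normal, which is smooth in the metric and the point. -/
lemma stretchCoord_apply {g : RMetric 3 M} (hg : IsHyperbolicMetric g)
    (hz : z ∈ coordDomain f p x₀) (u : E 2) :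
    stretchCoord g f ν p x₀ τ z u =
      fderiv ℝ (surfCoord f p x₀) z u + τ • covCoord g f (nrm g f ν) p x₀ z u := by
  rw [covCoord_eq hf hν hg hz, fderiv_surfCoord hf hz]
  simp [stretchCoord, stretch_apply]

variable {J : Set ℝ} (hJ : IsOpen J) {g : ℝ → RMetric 3 M} (hg : IsSmoothFamilyOn J g)

include hJ hg

lemma contDiffAt_covCoord (ht : t ∈ J) (hz : z ∈ coordDomain f p x₀) (u : E 2) :
    ContDiffAt ℝ ∞ (fun q : ℝ × E 2 => covCoord (g q.1) f (nrm (g q.1) f ν) p x₀ q.2 u) (t, z) := by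
  have hN := contDiffAt_normalCoord hf hν hJ hg ht hz
  have hφ : ContDiffAt ℝ ∞ (fun q : ℝ × E 2 => surfCoord f p x₀ q.2) (t, z) :=
    ContDiffAt.comp (g := surfCoord f p x₀) (t, z) (contDiffAt_surfCoord hf hz) contDiffAt_snd
  have hD : ContDiffAt ℝ ∞ (fun q : ℝ × E 2 => fderiv ℝ (surfCoord f p x₀) q.2 u) (t, z) :=
    (ContDiffAt.comp (g := fderiv ℝ (surfCoord f p x₀)) (t, z)
      ((contDiffAt_surfCoord hf hz).fderiv_right (by simp)) contDiffAt_snd).clm_apply contDiffAt_const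
  have hy := surfCoord_mem_target hf hz
  have hDN : ContDiffAt ℝ ∞ (fun q : ℝ × E 2 =>
      fderiv ℝ (fieldCoord f (nrm (g q.1) f ν) p x₀) q.2 u) (t, z) := by
    refine (((hN.fderiv_right (m := ∞) (by simp)).clm_apply
      (contDiffAt_const (c := ((0 : ℝ), u))))).congr_of_eventuallyEq ?_
    filter_upwards [eventually_differentiableAt_of_infty hN] with q hq
    exact (fderiv_slice (f := fun s z => fieldCoord f (nrm (g s) f ν) p x₀ z) (t := q.1) (x := q.2)
      hq u).2
  exact hDN.add (ContDiffAt.christoffel (G := fun s => chartMetric (g s) p) (τ := fun q : ℝ × E 2 => q.1)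
    (p := fun q => surfCoord f p x₀ q.2) (hg.contDiffAt_chartMetric hJ ht hy)
    (chartMetric_isInner (g t) hy) contDiffAt_fst hφ hD hN)

lemma contDiffAt_stretchCoord (hh : ∀ t ∈ J, IsHyperbolicMetric (g t)) (ht : t ∈ J)
    (hz : z ∈ coordDomain f p x₀) :
    ContDiffAt ℝ ∞ (fun q : ℝ × ℝ × E 2 => stretchCoord (g q.2.1) f ν p x₀ q.1 q.2.2) (τ, t, z) := by
  apply contDiffAt_clm_of_apply
  intro u
  have hD : ContDiffAt ℝ ∞ (fun q : ℝ × ℝ × E 2 => fderiv ℝ (surfCoord f p x₀) q.2.2 u)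
      (τ, t, z) :=
    (ContDiffAt.comp (g := fderiv ℝ (surfCoord f p x₀)) (f := fun q : ℝ × ℝ × E 2 => q.2.2) (τ, t, z)
      ((contDiffAt_surfCoord hf hz).fderiv_right (by simp))
      (contDiffAt_snd.comp _ contDiffAt_snd)).clm_apply contDiffAt_const
  have hC : ContDiffAt ℝ ∞
      (fun q : ℝ × ℝ × E 2 => covCoord (g q.2.1) f (nrm (g q.2.1) f ν) p x₀ q.2.2 u) (τ, t, z) :=
    ContDiffAt.comp (g := fun q : ℝ × E 2 => covCoord (g q.1) f (nrm (g q.1) f ν) p x₀ q.2 u)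
      (f := fun q : ℝ × ℝ × E 2 => q.2) (τ, t, z)
      (contDiffAt_covCoord hf hν hJ hg ht hz u) contDiffAt_snd
  refine (hD.add (contDiffAt_fst.smul hC)).congr_of_eventuallyEq ?_
  have hev : ∀ᶠ q : ℝ × ℝ × E 2 in 𝓝 (τ, t, z), q.2.1 ∈ J ∧ q.2.2 ∈ coordDomain f p x₀ :=
    ((continuousAt_fst.comp (continuousAt_snd (p := (τ, t, z)))).eventually (hJ.mem_nhds ht)).and
      ((continuousAt_snd.comp (continuousAt_snd (p := (τ, t, z)))).eventually
        ((isOpen_coordDomain hf p x₀).mem_nhds hz))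
  filter_upwards [hev] with q hq
  exact stretchCoord_apply hf hν (hh _ hq.1) hq.2 u

/-- The coefficients of the metrics of the conformal structures at infinity. -/
lemma contDiffAt_infCoord (hh : ∀ t ∈ J, IsHyperbolicMetric (g t)) (ht : t ∈ J)
    (hz : z ∈ coordDomain f p x₀) (u v : E 2) :
    ContDiffAt ℝ ∞ (fun q : ℝ × E 2 =>
      metricAt (g q.1) (f ((extChartAt (𝓡 2) x₀).symm q.2))
        (stretch (g q.1) f ν 1 ((extChartAt (𝓡 2) x₀).symm q.2) (dchartInv x₀ q.2 u))
        (stretch (g q.1) f ν 1 ((extChartAt (𝓡 2) x₀).symm q.2) (dchartInv x₀ q.2 v))) (t, z) := by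
  have hT : ContDiffAt ℝ ∞ (fun q : ℝ × E 2 => stretchCoord (g q.1) f ν p x₀ 1 q.2) (t, z) :=
    ContDiffAt.comp (g := fun q : ℝ × ℝ × E 2 => stretchCoord (g q.2.1) f ν p x₀ q.1 q.2.2)
      (f := fun q : ℝ × E 2 => ((1 : ℝ), q)) (t, z)
      (contDiffAt_stretchCoord hf hν hJ hg hh ht hz) (contDiffAt_const.prodMk contDiffAt_id)
  have hb : ContDiffAt ℝ ∞ (fun q : ℝ × E 2 => chartMetric (g q.1) p (surfCoord f p x₀ q.2))
      (t, z) :=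
    ContDiffAt.comp (g := fun q : ℝ × E 3 => chartMetric (g q.1) p q.2)
      (f := fun q : ℝ × E 2 => (q.1, surfCoord f p x₀ q.2)) (t, z)
      (hg.contDiffAt_chartMetric hJ ht (surfCoord_mem_target hf hz)) (contDiffAt_fst.prodMk
      (ContDiffAt.comp (g := surfCoord f p x₀) (t, z) (contDiffAt_surfCoord hf hz) contDiffAt_snd))
  refine ((hb.clm_apply (hT.clm_apply (contDiffAt_const (c := u)))).clm_apply
    (hT.clm_apply (contDiffAt_const (c := v)))).congr_of_eventuallyEq ?_
  filter_upwards [(continuousAt_snd (p := (t, z))).eventually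
    ((isOpen_coordDomain hf p x₀).mem_nhds hz)] with q hq
  exact (chartMetric_stretchCoord (g q.1) hq u v).symm

/-- Injectivity of the stretched differentials is an open condition. -/
lemma eventually_stretch_injective [CompactSpace S] (hh : ∀ t ∈ J, IsHyperbolicMetric (g t))
    (ht : t ∈ J) (hinj : ∀ τ ∈ Icc (0 : ℝ) 1, ∀ x, Function.Injective (stretch (g t) f ν τ x)) :
    ∀ᶠ s in 𝓝 t, ∀ τ ∈ Icc (0 : ℝ) 1, ∀ x, Function.Injective (stretch (g s) f ν τ x) := by
  -- Injectivity is open among linear maps and the stretched differentials vary continuously;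
  -- compactness of [0, 1] × S gives one neighbourhood of t for all (τ, x).
  have hK : IsCompact (Icc (0 : ℝ) 1 ×ˢ (univ : Set S)) := isCompact_Icc.prod isCompact_univ
  have h1 := hK.eventually_forall_of_forall_eventually (x₀ := t)
    (P := fun s y => Function.Injective (stretch (g s) f ν y.1 y.2)) ?_
  · filter_upwards [h1] with s hs τ hτ x
    exact hs (τ, x) ⟨hτ, mem_univ _⟩
  rintro ⟨τ, x⟩ ⟨hτ, -⟩
  have hz := coordDomain_self f x
  have hx := mem_extChartAt_source (I := 𝓡 2) x
  have h2 := (contDiffAt_stretchCoord (τ := τ) hf hν hJ hg hh ht hz).continuousAt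
  have h3 : Function.Injective (stretchCoord (g t) f ν (f x) x τ (extChartAt (𝓡 2) x x)) := by
    have h4 : stretchCoord (g t) f ν (f x) x τ (extChartAt (𝓡 2) x x) = stretch (g t) f ν τ x := by
      rw [stretchCoord, extChartAt_to_inv, dchart_self, dchartInv_self]
      rfl
    rw [h4]
    exact hinj τ hτ x
  have h4 := h2.eventually (ContinuousLinearMap.isOpen_injective.mem_nhds h3)
  have hc : ContinuousAt (fun q : ℝ × ℝ × S => (q.2.1, q.1, extChartAt (𝓡 2) x q.2.2)) (t, τ, x) := by
    have h5 : ContinuousAt (fun q : ℝ × ℝ × S => extChartAt (𝓡 2) x q.2.2) (t, τ, x) :=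
      ContinuousAt.comp (g := extChartAt (𝓡 2) x) (f := fun q : ℝ × ℝ × S => q.2.2)
        (continuousAt_extChartAt x) (continuousAt_snd.comp continuousAt_snd)
    exact (continuousAt_fst.comp continuousAt_snd).prodMk (continuousAt_fst.prodMk h5)
  filter_upwards [hc.eventually h4, (continuousAt_snd.comp
    (continuousAt_snd (p := (t, τ, x)))).eventually ((isOpen_extChartAt_source x).mem_nhds hx)]
    with q hq hqx
  change q.2.2 ∈ (extChartAt (𝓡 2) x).source at hqx
  refine (injective_iff_map_eq_zero _).2 fun u hu => ?_
  have hl := (extChartAt (𝓡 2) x).left_inv hqx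
  have h6 : stretchCoord (g q.1) f ν (f x) x q.2.1 (extChartAt (𝓡 2) x q.2.2)
      (dchart x q.2.2 u) = 0 := by
    simp only [stretchCoord, ContinuousLinearMap.comp_apply, hl]
    rw [dchartInv_dchart hqx, hu, map_zero]
  have h7 := hq (h6.trans (map_zero _).symm)
  rw [← dchartInv_dchart hqx u, h7, map_zero]

end

end HypSurf

end

/-! ### Eigenvalues and pointwise norm bounds -/

noncomputable section

namespace HypSurf

section PositiveForms

variable {n : ℕ}

/-- Positivity of quadratic forms is an open condition. -/
lemma eventually_forall_pos {X : Type*} [TopologicalSpace X] {b : X → Bil n} {x : X}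
    (hc : ContinuousAt b x) (hpos : ∀ u, u ≠ 0 → 0 < b x u u) :
    ∀ᶠ z in 𝓝 x, ∀ u, u ≠ 0 → 0 < b z u u := by
  have h1 := (isCompact_sphere (0 : E n) 1).eventually_forall_of_forall_eventually (x₀ := x)
    (P := fun z u => 0 < b z u u) ?_
  · filter_upwards [h1] with z hz u hu
    have hu' := norm_pos_iff.2 hu
    have h2 := hz (‖u‖⁻¹ • u) (by simp [norm_smul, hu'.ne'])
    simp only [map_smul, smul_apply, smul_eq_mul] at h2
    have h3 : 0 < ‖u‖⁻¹ := inv_pos.2 hu'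
    exact (pos_iff_pos_of_mul_pos ((pos_iff_pos_of_mul_pos h2).1 h3)).1 h3
  · intro u hu
    have hu0 : u ≠ 0 := by
      rintro rfl
      simp at hu
    have h2 : ContinuousAt (fun q : X × E n => b q.1 q.2 q.2) (x, u) :=
      ((hc.comp (f := Prod.fst) (x := (x, u)) continuousAt_fst).clm_apply
        continuousAt_snd).clm_apply continuousAt_snd
    exact h2.eventually (isOpen_Ioi.mem_nhds (hpos u hu0))

/-- The smallest eigenvalue of a self-adjoint operator. -/
lemma exists_smallest_eigenvalue {b : Bil n} (hb : IsInner b) {T : E n →L[ℝ] E n}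
    (hT : ∀ u v, b (T u) v = b u (T v)) {u₀ : E n} (hu₀ : u₀ ≠ 0) :
    ∃ (l : ℝ) (w : E n), w ≠ 0 ∧ T w = l • w ∧ ∀ v, l * b v v ≤ b (T v) v := by
  have hne : (Metric.sphere (0 : E n) 1).Nonempty :=
    ⟨‖u₀‖⁻¹ • u₀, by simp [norm_smul, (norm_pos_iff.2 hu₀).ne']⟩
  have hsp : ∀ u ∈ Metric.sphere (0 : E n) 1, u ≠ 0 := by
    rintro u hu rfl
    simp at hu
  have hcont : ContinuousOn (fun v => b (T v) v / b v v) (Metric.sphere (0 : E n) 1) := by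
    refine ContinuousOn.div ?_ ?_ fun v hv => (hb.pos v (hsp v hv)).ne'
    · exact (((b.continuous.comp T.continuous)).clm_apply continuous_id).continuousOn
    · exact (b.continuous.clm_apply continuous_id).continuousOn
  -- The eigenvector minimizes the Rayleigh quotient of T for b. The Euclidean sphere supplies
  -- compactness, and homogeneity extends the minimum to all vectors.
  obtain ⟨w, hw, hmin⟩ := (isCompact_sphere (0 : E n) 1).exists_isMinOn hne hcont
  have hw0 := hsp w hw
  set l := b (T w) w / b w w with hl
  have hle : ∀ v, l * b v v ≤ b (T v) v := by
    intro v
    by_cases hv : v = 0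
    · simp [hv]
    have hv' := norm_pos_iff.2 hv
    have h1 : l ≤ b (T (‖v‖⁻¹ • v)) (‖v‖⁻¹ • v) / b (‖v‖⁻¹ • v) (‖v‖⁻¹ • v) :=
      hmin (a := ‖v‖⁻¹ • v) (by simp [norm_smul, hv'.ne'])
    simp only [map_smul, smul_apply, smul_eq_mul] at h1
    rw [mul_div_mul_left _ _ (inv_pos.2 hv').ne', mul_div_mul_left _ _ (inv_pos.2 hv').ne',
      le_div_iff₀ (hb.pos v hv)] at h1
    exact h1
  refine ⟨l, w, hw0, hb.eq_of_forall fun v => ?_, hle⟩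
  have hww : b (T w) w = l * b w w := by rw [hl, div_mul_cancel₀ _ (hb.pos w hw0).ne']
  -- First-order condition at the minimum: a nonnegative quadratic in s without constant term has no
  -- linear term, so T w - l w is orthogonal to every v.
  have hquad : ∀ s : ℝ, 0 ≤ (b (T v) v - l * b v v) * (s * s) +
      (2 * (b (T w) v - l * b w v)) * s + 0 := by
    intro s
    have h1 := hle (w + s • v)
    simp only [map_add, map_smul, add_apply, smul_apply, smul_eq_mul] at h1
    have h2 : b (T v) w = b (T w) v := by rw [hT, hb.symm]
    have h3 := hb.symm v w
    rw [h2, h3, hww] at h1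
    linarith
  have h4 := discrim_le_zero hquad
  simp only [discrim, mul_zero, sub_zero] at h4
  have h5 : 2 * (b (T w) v - l * b w v) = 0 := pow_eq_zero_iff (two_ne_zero) |>.1
    (le_antisymm h4 (sq_nonneg _))
  simp only [map_smul, smul_apply, smul_eq_mul]
  linarith

end PositiveForms

section Homogeneity

variable {n : ℕ} {G : ℝ → E n → Bil n} {t : ℝ} {y : E n}

lemma christoffel_smul_left (G : E n → Bil n) (y : E n) (c : ℝ) (u v : E n) :
    christoffel G y (c • u) v = c • christoffel G y u v := by
  simp only [christoffel, map_smul, smul_apply]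
  rw [← map_smul]
  ext w
  simp
  ring

lemma christoffel_smul_right (G : E n → Bil n) (y : E n) (c : ℝ) (u v : E n) :
    christoffel G y u (c • v) = c • christoffel G y u v := by
  simp only [christoffel, map_smul, smul_apply]
  rw [← map_smul]
  ext w
  simp
  ring

lemma covStrain_smul_left (c : ℝ) (u v : E n) :
    covStrain G t y (c • u) v = c • covStrain G t y u v := by
  simp [covStrain, christoffel_smul_left, smul_sub]

lemma covStrain_smul_right (c : ℝ) (u v : E n) :
    covStrain G t y u (c • v) = c • covStrain G t y u v := by
  simp [covStrain, christoffel_smul_right, smul_sub]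

lemma sqrt_form_smul (b : Bil n) (c : ℝ) (u : E n) : √(b (c • u) (c • u)) = |c| * √(b u u) := by
  rw [← Real.sqrt_sq_eq_abs, ← Real.sqrt_mul (sq_nonneg c)]
  congr 1
  simp only [map_smul, smul_apply, smul_eq_mul]
  ring

/-- A bound on unit vectors is a bound on all vectors. -/
lemma IsInner.bound_of_unit {b : Bil n} (hb : IsInner b) {H : ℝ} {φ : E n → E n}
    (hφ : ∀ (c : ℝ) u, φ (c • u) = c • φ u)
    (h : ∀ u, √(b u u) = 1 → √(b (φ u) (φ u)) ≤ H) (u : E n) :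
    √(b (φ u) (φ u)) ≤ H * √(b u u) := by
  by_cases hu : u = 0
  · have h0 : φ 0 = 0 := by simpa using hφ 0 0
    simp [hu, h0]
  have hs := Real.sqrt_pos.2 (hb.pos u hu)
  have h1 := h ((√(b u u))⁻¹ • u) (by
    rw [sqrt_form_smul, abs_of_pos (inv_pos.2 hs), inv_mul_cancel₀ hs.ne'])
  rw [hφ, sqrt_form_smul, abs_of_pos (inv_pos.2 hs), inv_mul_le_iff₀ hs, mul_comm] at h1
  exact h1

end Homogeneity

section Strain

variable {n : ℕ} {M : Type*} [TopologicalSpace M] [ChartedSpace (E n) M] [IsManifold (𝓡 n) ∞ M]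
  {g : ℝ → RMetric n M} {A : Set M} {p : M} {t H : ℝ}

lemma strain_bound (hH : strainNorm g t A ≤ ENNReal.ofReal H) (hH0 : 0 ≤ H) (hp : p ∈ A) (u : E n) :
    √(metricAt (g t) p (strainOf (fun s => metricAt (g s) p) t u)
      (strainOf (fun s => metricAt (g s) p) t u)) ≤ H * √(metricAt (g t) p u u) := by
  refine (metricAt_isInner (g t) p).bound_of_unit (fun c u => map_smul _ c u) (fun u hu => ?_) u
  have h1 : ENNReal.ofReal (vnorm (g t) p (strainField g t p u)) ≤ strainNorm g t A :=
    le_iSup₂_of_le p hp (le_iSup₂_of_le (u : TangentSpace (𝓡 n) p) hu le_rfl)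
  exact (ENNReal.ofReal_le_ofReal_iff hH0).1 (h1.trans hH)

lemma strainGrad_bound (hH : strainGradNorm g t A ≤ ENNReal.ofReal H) (hH0 : 0 ≤ H) (hp : p ∈ A)
    (u v : E n) :
    √(metricAt (g t) p
      (covStrain (fun s => chartMetric (g s) p) t (extChartAt (𝓡 n) p p) u v)
      (covStrain (fun s => chartMetric (g s) p) t (extChartAt (𝓡 n) p p) u v)) ≤
      H * (√(metricAt (g t) p u u) * √(metricAt (g t) p v v)) := by
  have hb := metricAt_isInner (g t) p
  have h1 : ∀ u, √(metricAt (g t) p u u) = 1 → ∀ v, √(metricAt (g t) p v v) = 1 →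
      √(metricAt (g t) p
        (covStrain (fun s => chartMetric (g s) p) t (extChartAt (𝓡 n) p p) u v)
        (covStrain (fun s => chartMetric (g s) p) t (extChartAt (𝓡 n) p p) u v)) ≤ H := by
    intro u hu v hv
    have h1 : ENNReal.ofReal (vnorm (g t) p (strainGrad g t p u v)) ≤ strainGradNorm g t A :=
      le_iSup₂_of_le p hp (le_iSup₂_of_le (u : TangentSpace (𝓡 n) p) hu
        (le_iSup₂_of_le (v : TangentSpace (𝓡 n) p) hv le_rfl))
    exact (ENNReal.ofReal_le_ofReal_iff hH0).1 (h1.trans hH)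
  have h2 := hb.bound_of_unit (φ := fun u => covStrain (fun s => chartMetric (g s) p) t
    (extChartAt (𝓡 n) p p) u v) (fun c u => covStrain_smul_left c u v)
    (H := H * √(metricAt (g t) p v v)) (fun u hu => hb.bound_of_unit
      (fun c v => covStrain_smul_right c u v) (h1 u hu) v) u
  refine h2.trans_eq ?_
  ring

end Strain

section Surface

variable {M : Type*} [TopologicalSpace M] [ChartedSpace (E 3) M] [IsManifold (𝓡 3) ∞ M]
  {S : Type*} [TopologicalSpace S] [ChartedSpace (E 2) S] [IsManifold (𝓡 2) ∞ S]
  {f : S → M} {ν : (x : S) → TangentSpace (𝓡 3) (f x)} {x : S} {k : ℝ}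

/-- For τ > 0 a kernel vector of 1 + τB is an eigenvector of B for -1/τ ≤ -1, which lies below -1 +
1/k. -/
lemma stretch_injective_of_eigenvalue {g : RMetric 3 M} (hf : IsImmersedSurface f) (hk : 0 < k)
    (h : ∀ l : ℝ, Module.End.HasEigenvalue (shapeOperator g f ν x) l → -1 + 1 / k ≤ l) {τ : ℝ}
    (hτ : τ ∈ Icc (0 : ℝ) 1) : Function.Injective (stretch g f ν τ x) := by
  refine (injective_iff_map_eq_zero _).2 fun u hu => ?_
  rw [stretch_apply] at hu
  have h1 := dsurf_injective hf x (hu.trans (map_zero _).symm)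
  by_contra hne
  rcases hτ.1.eq_or_lt with h0 | h0
  · rw [← h0, zero_smul, add_zero] at h1
    exact hne h1
  · have h2 : shapeCLM g f ν x u = (-τ⁻¹) • u := by
      have h3 := congrArg (fun v => τ⁻¹ • v) h1
      simp only [smul_add, smul_smul, inv_mul_cancel₀ h0.ne', one_smul, smul_zero] at h3
      rw [neg_smul]
      exact eq_neg_of_add_eq_zero_right h3
    have h4 := h _ (Module.End.hasEigenvalue_of_hasEigenvector
      (Module.End.hasEigenvector_iff.2 ⟨Module.End.mem_eigenspace_iff.2 h2, hne⟩))
    have h5 : 1 ≤ τ⁻¹ := (one_le_inv₀ h0).2 hτ.2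
    have h6 : 0 < 1 / k := by positivity
    linarith

/-- As B is self-adjoint with least eigenvalue at least -1 + 1/k, ⟨(1 + B)u, u⟩ ≥ |u|²/k;
Cauchy–Schwarz then allows division by |u|. This is where k enters the constant. -/
lemma norm_le_stretch {g : RMetric 3 M} (hf : IsImmersedSurface f)
    (hν : IsTransverseOrientation f ν) (hg : IsHyperbolicMetric g) (hk : 0 < k)
    (h : ∀ l : ℝ, Module.End.HasEigenvalue (shapeOperator g f ν x) l → -1 + 1 / k ≤ l) (u : E 2) :
    √(metricAt g (f x) (dsurf f x u) (dsurf f x u)) ≤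
      k * √(metricAt g (f x) (stretch g f ν 1 x u) (stretch g f ν 1 x u)) := by
  by_cases hu : u = 0
  · simp [hu]
  set b : Bil 2 := (metricAt g (f x)).bilinearComp (dsurf f x) (dsurf f x)
  have hb : IsInner b := ⟨fun u v => (metricAt_isInner g (f x)).symm _ _, fun u hu =>
    (metricAt_isInner g (f x)).pos _ fun h => hu (dsurf_injective hf x (h.trans (map_zero _).symm))⟩
  obtain ⟨l, w, hw, hlw, hl⟩ := exists_smallest_eigenvalue hb (T := shapeCLM g f ν x)
    (fun u v => shapeCLM_symm hf hν hg x u v) hu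
  have hle := h l (Module.End.hasEigenvalue_of_hasEigenvector
      (Module.End.hasEigenvector_iff.2 ⟨Module.End.mem_eigenspace_iff.2 hlw, hw⟩))
  set v := u + shapeCLM g f ν x u with hv
  have h1 : (1 / k) * b u u ≤ b v u := by
    have h2 := hl u
    have h3 := hb.nonneg u
    rw [hv, map_add, add_apply]
    nlinarith
  have h2 : b v u ≤ √(b v v) * √(b u u) := (le_abs_self _).trans (hb.cauchy_schwarz v u)
  have h3 : 0 < √(b u u) := Real.sqrt_pos.2 (hb.pos u hu)
  have h4 : √(b u u) * √(b u u) = b u u := Real.mul_self_sqrt (hb.nonneg u)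
  have h5 : (1 / k) * √(b u u) ≤ √(b v v) := by
    refine le_of_mul_le_mul_right ?_ h3
    rw [mul_assoc, h4]
    exact h1.trans h2
  have h6 : √(b u u) ≤ k * √(b v v) := by
    rwa [one_div, inv_mul_le_iff₀ hk] at h5
  rw [stretch_apply, one_smul]
  exact h6

end Surface

end HypSurf

end

/-! ### Time derivative of the metrics at infinity -/

noncomputable section

namespace HypSurf

variable {M : Type*} [TopologicalSpace M] [ChartedSpace (E 3) M] [IsManifold (𝓡 3) ∞ M]
  {S : Type*} [TopologicalSpace S] [ChartedSpace (E 2) S] [IsManifold (𝓡 2) ∞ S]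
  {f : S → M} {ν : (x : S) → TangentSpace (𝓡 3) (f x)} {x : S} {k t : ℝ}
  (hf : IsImmersedSurface f) (hν : IsTransverseOrientation f ν)
  {J : Set ℝ} (hJ : IsOpen J) {g : ℝ → RMetric 3 M} (hg : IsSmoothFamilyOn J g)
  (hh : ∀ t ∈ J, IsHyperbolicMetric (g t)) (ht : t ∈ J)

include hf hν hJ hg hh ht

/-- The derivative of the metrics of the conformal structures at infinity is bounded by the strain
and its gradient. -/
lemma exists_hasDerivAt_infSq {H : ℝ} (hH0 : 0 ≤ H) (hk0 : 0 ≤ k)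
    (hH : strainNorm g t (range f) ≤ ENNReal.ofReal H)
    (hH' : strainGradNorm g t (range f) ≤ ENNReal.ofReal H) {u : E 2}
    (hk : √(metricAt (g t) (f x) (dsurf f x u) (dsurf f x u)) ≤
      k * √(metricAt (g t) (f x) (stretch (g t) f ν 1 x u) (stretch (g t) f ν 1 x u))) :
    ∃ Q' : ℝ, HasDerivAt (fun s => infSq (g s) f ν x u) Q' t ∧
      |Q'| ≤ (8 + 12 * k) * H * infSq (g t) f ν x u := by
  have hz := coordDomain_self f x
  set p := f x with hp
  set y := extChartAt (𝓡 3) p p with hy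
  set z := extChartAt (𝓡 2) x x with hzdef
  have hyz : surfCoord f p x z = y := by rw [surfCoord, extChartAt_to_inv]
  have hyt : y ∈ (extChartAt (𝓡 3) p).target := mem_extChartAt_target p
  have htJ : ∀ᶠ s in 𝓝 t, s ∈ J := hJ.mem_nhds ht
  have hself : ∀ s, chartMetric (g s) p y = metricAt (g s) p := fun s => chartMetric_self (g s) p
  have hNz : ∀ s, fieldCoord f (nrm (g s) f ν) p x z = nrm (g s) f ν x := fun s => by
    rw [fieldCoord, extChartAt_to_inv, dchart_self]; rfl
  have hNs : ContDiffAt ℝ ∞ (fun s => nrm (g s) f ν x) t := by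
    have h1 := ContDiffAt.comp (g := fun q : ℝ × E 2 => fieldCoord f (nrm (g q.1) f ν) p x q.2)
      (f := fun s : ℝ => (s, z)) t (contDiffAt_normalCoord hf hν hJ hg ht hz)
      (contDiffAt_id.prodMk contDiffAt_const)
    exact h1.congr_of_eventuallyEq (Eventually.of_forall fun s => (hNz s).symm)
  have hws : ContDiffAt ℝ ∞ (fun s => covCoord (g s) f (nrm (g s) f ν) p x z u) t :=
    ContDiffAt.comp
      (g := fun q : ℝ × E 2 => covCoord (g q.1) f (nrm (g q.1) f ν) p x q.2 u)
      (f := fun s : ℝ => (s, z)) t (contDiffAt_covCoord hf hν hJ hg ht hz u)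
      (contDiffAt_id.prodMk contDiffAt_const)
  have hw : ∀ s ∈ J, dsurf f x u + covCoord (g s) f (nrm (g s) f ν) p x z u =
      dsurf f x (u + shapeCLM (g s) f ν x u) := fun s hs => by
    rw [map_add, dsurf_shapeCLM_self hf hν (hh s hs)]
  -- In the preferred charts at x and f x, A is df at x, w is the covariant derivative of the moving
  -- normal along u, and v = (1 + B)u is frozen at time t.
  obtain ⟨Q', hQ, hQ'⟩ := variation_bound (G := fun s => chartMetric (g s) p) (t₀ := t) (y := y)
    (hg.contDiffAt_chartMetric hJ ht hyt)
    (((continuousAt_snd (p := (t, y))).eventually ((isOpen_extChartAt_target p).mem_nhds hyt)).mono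
      fun q hq => chartMetric_isInner (g q.1) hq)
    (A := dsurf f x) (hNs.differentiableAt (by simp)).hasDerivAt
    (Eventually.of_forall fun s => by rw [hself]; exact (nrm_spec hf hν (g s) x).1)
    (Eventually.of_forall fun s => by rw [hself]; exact (nrm_spec hf hν (g s) x).2.1)
    (fun X h1 h2 => by
      rw [hself] at h1 h2
      exact eq_zero_of_perp (metricAt_isInner (g t) p) (dsurf_injective hf x)
        (nrm_spec hf hν (g t) x).1 (nrm_spec hf hν (g t) x).2.1 h1 h2)
    (u := u) (v := u + shapeCLM (g t) f ν x u)
    (hws.differentiableAt (by simp)).hasDerivAt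
    (X := fderiv ℝ (fderiv ℝ (surfCoord f p x)) z u)
    (by
      refine Eventually.of_forall fun s v => ?_
      have hev : ∀ᶠ z in 𝓝 z, z ∈ coordDomain f p x := (isOpen_coordDomain hf p x).mem_nhds hz
      have h1 := (second_fundamental_coord (G := chartMetric (g s) p) (contDiffAt_surfCoord hf hz)
        ((contDiffAt_normalCoord_const hf hν (g s) hz).differentiableAt (by simp))
        (by rw [hyz]; exact chartMetric_isInner (g s) hyt)
        (by rw [hyz]; exact (contDiffAt_chartMetric (g s) hyt).differentiableAt (by simp))
        (by
          rw [hyz]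
          exact Filter.Eventually.mono ((isOpen_extChartAt_target _).mem_nhds hyt)
            fun y hy => (chartMetric_isInner (g s) hy).symm)
        (hev.mono fun z hz => (normalCoord_spec hf hν (g s) hz).1)
        (hev.mono fun z hz => (normalCoord_spec hf hν (g s) hz).2.1) u).2 v
      rw [fderiv_surfCoord_self hf, fderiv_surfCoord_self hf, hyz, hNz] at h1
      rw [← h1, covCoord, fderiv_surfCoord_self hf, hyz, hNz])
    (hw t ht) hH0 hH0 hk0
    (fun w => by
      simp only [hself]
      exact strain_bound hH hH0 (mem_range_self x) w)
    (fun v w => by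
      rw [hself]
      exact strainGrad_bound hH' hH0 (mem_range_self x) v w)
    (by
      rw [hself]
      rw [stretch_apply, one_smul] at hk
      exact hk)
  refine ⟨Q', hQ.congr_of_eventuallyEq ?_, ?_⟩
  · filter_upwards [htJ] with s hs
    rw [hself, hw s hs]
    rfl
  · refine hQ'.trans_eq ?_
    rw [hself, infSq]
    ring

/-- Near `t`, the metrics of the conformal structures at infinity vary at the rate given by the
bound at `t`. -/
lemma eventually_abs_deriv_infSq_le [CompactSpace S] {c : ℝ}
    (hpos : ∀ x (u : E 2), u ≠ 0 → 0 < infSq (g t) f ν x u)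
    {c' : ℝ} (hc : c' < c) (hd : ∀ x u, ∃ Q' : ℝ, HasDerivAt (fun s => infSq (g s) f ν x u) Q' t ∧
      |Q'| ≤ c' * infSq (g t) f ν x u) :
    ∀ᶠ s in 𝓝 t, ∀ x u, ∃ Q' : ℝ, HasDerivAt (fun s => infSq (g s) f ν x u) Q' s ∧
      |Q'| ≤ c * infSq (g s) f ν x u := by
  have h1 := (isCompact_univ (X := S)).eventually_forall_of_forall_eventually (x₀ := t)
    (P := fun s x => ∀ u, ∃ Q' : ℝ, HasDerivAt (fun s => infSq (g s) f ν x u) Q' s ∧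
      |Q'| ≤ c * infSq (g s) f ν x u) ?_
  · filter_upwards [h1] with s hs x
    exact hs x (mem_univ x)
  rintro x -
  have hz := coordDomain_self f x
  have hx := mem_extChartAt_source (I := 𝓡 2) x
  set z := extChartAt (𝓡 2) x x with hzdef
  set B : ℝ × E 2 → Bil 2 := fun q =>
    (metricAt (g q.1) (f ((extChartAt (𝓡 2) x).symm q.2))).bilinearComp
      ((stretch (g q.1) f ν 1 ((extChartAt (𝓡 2) x).symm q.2)).comp (dchartInv x q.2))
      ((stretch (g q.1) f ν 1 ((extChartAt (𝓡 2) x).symm q.2)).comp (dchartInv x q.2)) with hB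
  have hBs : ContDiffAt ℝ ∞ B (t, z) := by
    apply contDiffAt_clm_of_apply
    intro u
    apply contDiffAt_clm_of_apply
    intro v
    exact contDiffAt_infCoord hf hν hJ hg hh ht hz u v
  have hBinf : ∀ q : ℝ × S, q.2 ∈ (extChartAt (𝓡 2) x).source → ∀ s u,
      infSq (g s) f ν q.2 u =
        B (s, extChartAt (𝓡 2) x q.2) (dchart x q.2 u) (dchart x q.2 u) := by
    intro q hq s u
    simp only [hB, ContinuousLinearMap.bilinearComp_apply, ContinuousLinearMap.comp_apply,
      (extChartAt (𝓡 2) x).left_inv hq]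
    rw [dchartInv_dchart hq, infSq_eq]
  set D : ℝ × E 2 → Bil 2 := fun q => fderiv ℝ B q (1, 0) with hD
  have hDc : ContinuousAt D (t, z) :=
    (((hBs.fderiv_right (m := ∞) (by simp)).clm_apply
      (contDiffAt_const (c := ((1 : ℝ), (0 : E 2)))))).continuousAt
  have hderiv : ∀ q : ℝ × E 2, DifferentiableAt ℝ B q → ∀ u, HasDerivAt (fun s => B (s, q.2) u u)
      (D q u u) q.1 := by
    intro q hq u
    have h1 := deriv_slice (f := fun s z => B (s, z)) (t := q.1) (x := q.2) hq
    have h2 := (h1.clm_apply (hasDerivAt_const q.1 u)).clm_apply (hasDerivAt_const q.1 u)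
    refine h2.congr_deriv ?_
    simp [hD]
  -- The gap between c' and c makes the bound strict on nonzero vectors. It then says that c B + D
  -- and c B - D are positive definite, an open condition on (time, point).
  have hDB : ∀ u, u ≠ 0 → |D (t, z) u u| < c * B (t, z) u u := by
    intro u hu
    obtain ⟨Q', hQ, hQ'⟩ := hd x u
    have h2 : ∀ s, infSq (g s) f ν x u = B (s, z) u u := fun s => by
      have := hBinf (t, x) hx s u
      rwa [dchart_self] at this
    have h3 := hderiv (t, z) (hBs.differentiableAt (by simp)) u
    have h4 : Q' = D (t, z) u u := hQ.unique (h3.congr_of_eventuallyEq (Eventually.of_forall h2))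
    rw [← h4, ← h2]
    exact hQ'.trans_lt (mul_lt_mul_of_pos_right hc (hpos x u hu))
  have e1 := eventually_forall_pos (b := fun q => c • B q + D q) (x := (t, z))
    ((hBs.continuousAt.const_smul c).add hDc) (fun u hu => by
      have := neg_lt_of_abs_lt (hDB u hu)
      simp only [add_apply, smul_apply, smul_eq_mul]
      linarith)
  have e2 := eventually_forall_pos (b := fun q => c • B q - D q) (x := (t, z))
    ((hBs.continuousAt.const_smul c).sub hDc) (fun u hu => by
      have := lt_of_abs_lt (hDB u hu)
      simp only [sub_apply, smul_apply, smul_eq_mul]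
      linarith)
  have hcont : ContinuousAt (fun q : ℝ × S => (q.1, extChartAt (𝓡 2) x q.2)) (t, x) :=
    continuousAt_fst.prodMk (ContinuousAt.comp (g := extChartAt (𝓡 2) x)
      (f := fun q : ℝ × S => q.2) (continuousAt_extChartAt x) continuousAt_snd)
  filter_upwards [hcont.eventually (e1.and (e2.and (eventually_differentiableAt_of_infty hBs))),
    (continuousAt_snd (p := (t, x))).eventually ((isOpen_extChartAt_source x).mem_nhds hx)]
    with q ⟨h1, h2, h3⟩ hqx u
  have h4 := hderiv _ h3 (dchart x q.2 u)
  refine ⟨_, h4.congr_of_eventuallyEq (Eventually.of_forall fun s => hBinf q hqx s u), ?_⟩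
  rw [hBinf q hqx]
  by_cases hu : dchart x q.2 u = 0
  · simp [hu]
  have h5 := h1 _ hu
  have h6 := h2 _ hu
  simp only [add_apply, sub_apply, smul_apply, smul_eq_mul] at h5 h6
  exact abs_le.2 ⟨by linarith, by linarith⟩

end HypSurf

end

/-! ### From the derivative bound to the Teichmüller speed -/

noncomputable section

namespace HypSurf

/-- A positive quantity with logarithmic derivative at most `c` changes by a factor at most
`exp (c * |t|)` in time `t`. -/
lemma le_exp_mul_of_abs_deriv_le {q : ℝ → ℝ} {c δ : ℝ}
    (h : ∀ s ∈ Ioo (-δ) δ, ∃ q', HasDerivAt q q' s ∧ |q'| ≤ c * q s) {t : ℝ}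
    (ht : t ∈ Ioo (-δ) δ) :
    q t ≤ Real.exp (c * |t|) * q 0 ∧ q 0 ≤ Real.exp (c * |t|) * q t := by
  have h0 : (0 : ℝ) ∈ Ioo (-δ) δ := ⟨by linarith [ht.1, ht.2], by linarith [ht.1, ht.2]⟩
  choose! q' hq hb using h
  have hexp : ∀ (a s : ℝ), HasDerivAt (fun s => Real.exp (a * s)) (Real.exp (a * s) * a) s := by
    intro a s
    simpa using ((hasDerivAt_id s).const_mul a).exp
  have hd : ∀ a, ∀ s ∈ Ioo (-δ) δ, HasDerivAt (fun s => Real.exp (a * s) * q s)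
      (Real.exp (a * s) * (a * q s + q' s)) s := by
    intro a s hs
    refine ((hexp a s).mul (hq s hs)).congr_deriv ?_
    ring
  -- The bound on q' says that exp(cs) q increases and exp(-cs) q decreases; comparison with time 0
  -- gives both inequalities for either sign of t.
  have hmono : MonotoneOn (fun s => Real.exp (c * s) * q s) (Ioo (-δ) δ) := by
    refine monotoneOn_of_deriv_nonneg (convex_Ioo _ _)
      (fun s hs => (hd c s hs).continuousAt.continuousWithinAt)
      (fun s hs => ((hd c s (interior_subset hs)).differentiableAt.differentiableWithinAt))
      fun s hs => ?_
    rw [(hd c s (interior_subset hs)).deriv]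
    have := (abs_le.1 (hb s (interior_subset hs))).1
    exact mul_nonneg (Real.exp_pos _).le (by linarith)
  have hanti : AntitoneOn (fun s => Real.exp (-c * s) * q s) (Ioo (-δ) δ) := by
    refine antitoneOn_of_deriv_nonpos (convex_Ioo _ _)
      (fun s hs => (hd (-c) s hs).continuousAt.continuousWithinAt)
      (fun s hs => ((hd (-c) s (interior_subset hs)).differentiableAt.differentiableWithinAt))
      fun s hs => ?_
    rw [(hd (-c) s (interior_subset hs)).deriv]
    have := (abs_le.1 (hb s (interior_subset hs))).2
    exact mul_nonpos_of_nonneg_of_nonpos (Real.exp_pos _).le (by linarith)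
  have hflip : ∀ a b r : ℝ, Real.exp (-r) * a ≤ b → a ≤ Real.exp r * b := by
    intro a b r hab
    have h1 := mul_le_mul_of_nonneg_left hab (Real.exp_pos r).le
    rwa [← mul_assoc, ← Real.exp_add, add_neg_cancel, Real.exp_zero, one_mul] at h1
  rcases le_total 0 t with h | h
  · have h1 := hmono h0 ht h
    have h2 := hanti h0 ht h
    simp only [mul_zero, Real.exp_zero, one_mul] at h1 h2
    rw [abs_of_nonneg h]
    exact ⟨hflip _ _ _ (by rwa [← neg_mul]), h1⟩
  · have h1 := hmono ht h0 h
    have h2 := hanti ht h0 h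
    simp only [mul_zero, Real.exp_zero, one_mul] at h1 h2
    rw [abs_of_nonpos h, mul_neg, ← neg_mul]
    exact ⟨hflip _ _ _ (by rwa [neg_mul, neg_neg]), h2⟩

section Teichmueller

variable {S : Type*} [TopologicalSpace S] [ChartedSpace (E 2) S] [IsManifold (𝓡 2) ∞ S]

/-- The identity is a competitor in the infimum, through the constant isotopy. -/
lemma teichDist_le_of_refl {h₀ h₁ : RMetric 2 S} {K : ℝ} (hK : 1 ≤ K)
    (h : DilatationLE h₀ h₁ id K) : teichDist h₀ h₁ ≤ ENNReal.ofReal (1 / 2 * Real.log K) := by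
  have hiso : IsIsotopicToId (Diffeomorph.refl (𝓡 2) S ∞) :=
    ⟨fun _ => Diffeomorph.refl (𝓡 2) S ∞, contMDiff_snd, fun _ => rfl, fun _ => rfl⟩
  exact iInf₂_le_of_le (Diffeomorph.refl (𝓡 2) S ∞) hiso
    (iInf₂_le_of_le K hK (iInf_le_of_le h le_rfl))

/-- The hypothesis compares squared lengths while dilatation compares lengths, whence the exponent
2. -/
lemma dilatationLE_id {h₀ h₁ : RMetric 2 S} {K : ℝ} (hK : 0 ≤ K)
    (h : ∀ x (u v : E 2), u ≠ 0 → v ≠ 0 → metricAt h₁ x u u / metricAt h₁ x v v ≤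
      K ^ 2 * (metricAt h₀ x u u / metricAt h₀ x v v)) : DilatationLE h₀ h₁ id K := by
  have key : ∀ x (u v : E 2), √(metricAt h₁ x u u) * √(metricAt h₀ x v v) ≤
      K * (√(metricAt h₁ x v v) * √(metricAt h₀ x u u)) := by
    intro x u v
    by_cases hu : u = 0
    · simp [hu]
    by_cases hv : v = 0
    · simp [hv]
    have h1 := h x u v hu hv
    have p1 := (metricAt_isInner h₁ x).pos v hv
    have p0 := (metricAt_isInner h₀ x).pos v hv
    have p1' := (metricAt_isInner h₁ x).pos u hu
    rw [← mul_div_assoc, div_le_div_iff₀ p1 p0] at h1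
    rw [← Real.sqrt_mul p1'.le, ← Real.sqrt_mul p1.le, ← Real.sqrt_sq hK,
      ← Real.sqrt_mul (sq_nonneg K)]
    refine Real.sqrt_le_sqrt (h1.trans_eq ?_)
    ring
  intro x u v
  rw [mfderiv_id]
  exact key x u v

end Teichmueller

section Surface

variable {M : Type*} [TopologicalSpace M] [ChartedSpace (E 3) M] [IsManifold (𝓡 3) ∞ M]
  {S : Type*} [TopologicalSpace S] [ChartedSpace (E 2) S] [IsManifold (𝓡 2) ∞ S]
  {f : S → M} {ν : (x : S) → TangentSpace (𝓡 3) (f x)}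
  (hf : IsImmersedSurface f) (hν : IsTransverseOrientation f ν)

/-- The metrics of the conformal structures at infinity. -/
def infBil (g : RMetric 3 M) (f : S → M) (ν : (x : S) → TangentSpace (𝓡 3) (f x)) (x : S) : Bil 2 :=
  (metricAt g (f x)).bilinearComp (stretch g f ν 1 x) (stretch g f ν 1 x)

lemma infBil_isInner {g : RMetric 3 M} {x : S} (h : Function.Injective (stretch g f ν 1 x)) :
    IsInner (infBil g f ν x) :=
  ⟨fun _ _ => (metricAt_isInner g (f x)).symm _ _, fun _ hu => (metricAt_isInner g (f x)).pos _
    fun h0 => hu (h (h0.trans (map_zero _).symm))⟩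

lemma infSq_pos_of_injective {g : RMetric 3 M} {x : S}
    (h : Function.Injective (stretch g f ν 1 x)) {u : E 2} (hu : u ≠ 0) : 0 < infSq g f ν x u := by
  rw [infSq_eq]
  exact (infBil_isInner h).pos u hu

include hf hν

/-- A smooth family of conformal structures at infinity exists. -/
lemma exists_conformalStructureAtInfinity [T2Space M] {δ : ℝ} (hδ : 0 < δ) {g : ℝ → RMetric 3 M}
    (hg : IsSmoothFamilyOn (Ioo (-δ) δ) g)
    (hh : ∀ t ∈ Ioo (-δ) δ, IsHyperbolicMetric (g t))
    (hc : ∀ t ∈ Ioo (-δ) δ, IsCompleteMetric (g t))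
    (hinj : ∀ t ∈ Ioo (-δ) δ, ∀ τ ∈ Icc (0 : ℝ) 1, ∀ x, Function.Injective (stretch (g t) f ν τ x)) :
    ∃ h : ℝ → RMetric 2 S, IsSmoothFamilyOn (Ioo (-δ) δ) h ∧
      ∀ t ∈ Ioo (-δ) δ, IsConformalStructureAtInfinity (g t) f ν (h t) := by
  classical
  -- The family must consist of metrics for every real t, but the form at infinity is known to be
  -- definite only on the interval. Outside it the value at t = 0 is used.
  set θ : ℝ → ℝ := fun t => if t ∈ Ioo (-δ) δ then t else 0 with hθdef
  have hθ : ∀ t, θ t ∈ Ioo (-δ) δ := by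
    intro t
    by_cases ht : t ∈ Ioo (-δ) δ
    · simpa only [hθdef, if_pos ht] using ht
    · simp only [hθdef, if_neg ht]
      exact ⟨by linarith, hδ⟩
  have hθt : ∀ t ∈ Ioo (-δ) δ, θ t = t := fun t ht => if_pos ht
  have hsm : ∀ t ∈ Ioo (-δ) δ, ∀ (x : S) u v, ContDiffAt ℝ ∞ (fun q : ℝ × E 2 =>
      infBil (g q.1) f ν ((extChartAt (𝓡 2) x).symm q.2) (dchartInv x q.2 u) (dchartInv x q.2 v))
      (t, extChartAt (𝓡 2) x x) := fun t ht x u v =>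
    contDiffAt_infCoord hf hν isOpen_Ioo hg hh ht (coordDomain_self f x) u v
  let h : ℝ → RMetric 2 S := fun t => rmetricOf (infBil (g (θ t)) f ν)
    (fun x => infBil_isInner (hinj _ (hθ t) 1 ⟨zero_le_one, le_rfl⟩ x))
    (fun x u v => ContDiffAt.comp (g := fun q : ℝ × E 2 =>
      infBil (g q.1) f ν ((extChartAt (𝓡 2) x).symm q.2) (dchartInv x q.2 u) (dchartInv x q.2 v))
      (f := fun y => (θ t, y)) _ (hsm _ (hθ t) x u v) (contDiffAt_const.prodMk contDiffAt_id))
  have hmet : ∀ t ∈ Ioo (-δ) δ, ∀ x, metricAt (h t) x = infBil (g t) f ν x := by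
    intro t ht x
    change infBil (g (θ t)) f ν x = _
    rw [hθt t ht]
  refine ⟨h, isSmoothFamilyOn_of fun t ht x u v => ?_, fun t ht => ?_⟩
  · refine (hsm t ht x u v).congr_of_eventuallyEq ?_
    filter_upwards [(continuousAt_fst (p := (t, extChartAt (𝓡 2) x x))).eventually
      (isOpen_Ioo.mem_nhds ht)] with q hq
    rw [hmet q.1 hq]
  · refine isConformalStructureAtInfinity_of hf hν (hh t ht) (hc t ht) (fun x τ hτ u hu => ?_)
      fun x u => ?_
    · refine hinj t ht τ hτ x (Eq.trans ?_ (map_zero _).symm)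
      rw [stretch_apply, hu, map_zero]
    · rw [hmet t ht, infSq_eq]
      rfl

/-- The speed in Teichmüller space of the conformal structures at infinity. -/
lemma teichSpeed_le [CompactSpace S] {δ : ℝ} (hδ : 0 < δ) {g : ℝ → RMetric 3 M}
    (hg : IsSmoothFamilyOn (Ioo (-δ) δ) g)
    (hh : ∀ t ∈ Ioo (-δ) δ, IsHyperbolicMetric (g t))
    (hinj : ∀ t ∈ Ioo (-δ) δ, ∀ τ ∈ Icc (0 : ℝ) 1, ∀ x, Function.Injective (stretch (g t) f ν τ x))
    {h : ℝ → RMetric 2 S}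
    (hinf : ∀ᶠ t in 𝓝 (0 : ℝ), IsConformalStructureAtInfinity (g t) f ν (h t)) {c' c : ℝ}
    (hc0 : 0 ≤ c') (hc : c' < c)
    (hd : ∀ x u, ∃ Q' : ℝ, HasDerivAt (fun s => infSq (g s) f ν x u) Q' 0 ∧
      |Q'| ≤ c' * infSq (g 0) f ν x u) : teichSpeed h ≤ ENNReal.ofReal (c / 2) := by
  have h0 : (0 : ℝ) ∈ Ioo (-δ) δ := ⟨by linarith, hδ⟩
  have hone : (1 : ℝ) ∈ Icc (0 : ℝ) 1 := ⟨zero_le_one, le_rfl⟩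
  have hev := eventually_abs_deriv_infSq_le hf hν isOpen_Ioo hg hh h0
    (fun x u hu => infSq_pos_of_injective (hinj 0 h0 1 hone x) hu) hc hd
  obtain ⟨r, hr, hball⟩ := Metric.mem_nhds_iff.1
    (Filter.inter_mem (Filter.inter_mem hev hinf) (isOpen_Ioo.mem_nhds h0))
  rw [Real.ball_eq_Ioo, zero_sub, zero_add] at hball
  -- The metrics h t are fixed only up to a positive factor at each point, so all that can be
  -- transferred to `infSq` is ratios, which is what dilatation sees.
  have hratio : ∀ t ∈ Ioo (-r) r, ∀ x (u v : E 2), v ≠ 0 →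
      metricAt (h t) x u u / metricAt (h t) x v v =
        infSq (g t) f ν x u / infSq (g t) f ν x v := by
    intro t ht x u v hv
    have ht' := hball ht
    refine IsConformalStructureAtInfinity.ratio_eq ht'.1.2 hf hν (hh t ht'.2) (fun w hw => ?_) u hv
    refine hinj t ht'.2 1 hone x (Eq.trans ?_ (map_zero _).symm)
    rw [stretch_apply, one_smul, hw, map_zero]
  have h0r : (0 : ℝ) ∈ Ioo (-r) r := ⟨by linarith, hr⟩
  have hdist : ∀ t ∈ Ioo (-r) r, teichDist (h 0) (h t) ≤ ENNReal.ofReal (c / 2 * |t|) := by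
    intro t ht
    have hct : 0 ≤ c * |t| := mul_nonneg (hc0.trans hc.le) (abs_nonneg t)
    -- Numerator and denominator each change by a factor at most exp(c|t|), so ratios of squared
    -- lengths change by at most K² with K = exp(c|t|); half of log K is c|t|/2.
    have h1 := teichDist_le_of_refl (K := Real.exp (c * |t|)) (h₀ := h 0) (h₁ := h t)
      (Real.one_le_exp hct) (dilatationLE_id (Real.exp_pos _).le fun x u v hu hv => ?_)
    · rw [Real.log_exp] at h1
      exact h1.trans_eq (congrArg ENNReal.ofReal (by ring))
    · rw [hratio t ht x u v hv, hratio 0 h0r x u v hv]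
      have hu' := le_exp_mul_of_abs_deriv_le (q := fun s => infSq (g s) f ν x u) (c := c) (δ := r)
        (fun s hs => (hball hs).1.1 x u) ht
      have hv' := le_exp_mul_of_abs_deriv_le (q := fun s => infSq (g s) f ν x v) (c := c) (δ := r)
        (fun s hs => (hball hs).1.1 x v) ht
      have p0 := infSq_pos_of_injective (ν := ν) (hinj 0 h0 1 hone x) hv
      have pt := infSq_pos_of_injective (ν := ν) (hinj t (hball ht).2 1 hone x) hv
      have q0 := infSq_pos_of_injective (ν := ν) (hinj 0 h0 1 hone x) hu
      rw [← mul_div_assoc, div_le_div_iff₀ pt p0]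
      have he := Real.exp_pos (c * |t|)
      calc infSq (g t) f ν x u * infSq (g 0) f ν x v
          ≤ (Real.exp (c * |t|) * infSq (g 0) f ν x u) *
            (Real.exp (c * |t|) * infSq (g t) f ν x v) :=
            mul_le_mul hu'.1 hv'.2 p0.le (mul_pos he q0).le
        _ = _ := by ring
  refine limsup_le_of_le (by isBoundedDefault) ?_
  have hnear : ∀ᶠ t in 𝓝[≠] (0 : ℝ), t ∈ Ioo (-r) r :=
    nhdsWithin_le_nhds (isOpen_Ioo.mem_nhds h0r)
  filter_upwards [hnear, self_mem_nhdsWithin] with t ht hne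
  refine ENNReal.div_le_of_le_mul ((hdist t ht).trans_eq ?_)
  rw [ENNReal.ofReal_mul (by linarith)]

end Surface

end HypSurf

end

/-! ### The theorem -/

theorem proposition5p4 (k : ℝ) (hk : 0 < k) :
    ∃ C : ℝ≥0, ∀ (M : Type*) [TopologicalSpace M] [T2Space M] [ChartedSpace (HypSurf.E 3) M]
      [IsManifold (𝓡 3) ∞ M]
      (S : Type*) [TopologicalSpace S] [T2Space S] [CompactSpace S] [ChartedSpace (HypSurf.E 2) S]
      [IsManifold (𝓡 2) ∞ S]
      (ε : ℝ) (_ : 0 < ε) (g : ℝ → HypSurf.RMetric 3 M)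
      (_ : HypSurf.IsSmoothFamilyOn (Ioo (-ε) ε) g)
      (_ : ∀ t ∈ Ioo (-ε) ε, HypSurf.IsHyperbolicMetric (g t) ∧ HypSurf.IsCompleteMetric (g t))
      (f : S → M) (ν : (x : S) → TangentSpace (𝓡 3) (f x))
      (_ : HypSurf.IsImmersedSurface f) (_ : HypSurf.IsTransverseOrientation f ν)
      (_ : ∀ (x : S) (l : ℝ), Module.End.HasEigenvalue (HypSurf.shapeOperator (g 0) f ν x) l →
        l ∈ Icc (-1 + 1 / k) k),
      (∃ δ : ℝ, 0 < δ ∧ ∃ h : ℝ → HypSurf.RMetric 2 S,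
        HypSurf.IsSmoothFamilyOn (Ioo (-δ) δ) h ∧
        ∀ t ∈ Ioo (-δ) δ, HypSurf.IsConformalStructureAtInfinity (g t) f ν (h t)) ∧
      ∀ h : ℝ → HypSurf.RMetric 2 S,
        (∀ᶠ t in 𝓝 (0 : ℝ), HypSurf.IsConformalStructureAtInfinity (g t) f ν (h t)) →
        HypSurf.teichSpeed h ≤
          C * max (HypSurf.strainNorm g 0 (range f)) (HypSurf.strainGradNorm g 0 (range f)) := by
  -- Half of 8 + 12k, the bound on the logarithmic derivative of the squared lengths.
  refine ⟨(4 + 6 * k).toNNReal, ?_⟩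
  intro M _ _ _ _ S _ _ _ _ _ ε hε g hg hh f ν hf hν hev
  have h0ε : (0 : ℝ) ∈ Ioo (-ε) ε := ⟨by linarith, hε⟩
  have hhyp : ∀ t ∈ Ioo (-ε) ε, HypSurf.IsHyperbolicMetric (g t) := fun t ht => (hh t ht).1
  have hev' : ∀ (x : S) (l : ℝ), Module.End.HasEigenvalue (HypSurf.shapeOperator (g 0) f ν x) l →
      -1 + 1 / k ≤ l := fun x l hl => (hev x l hl).1
  have hinj := HypSurf.eventually_stretch_injective hf hν isOpen_Ioo hg hhyp h0ε
    fun τ hτ x => HypSurf.stretch_injective_of_eigenvalue hf hk (hev' x) hτ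
  obtain ⟨δ, hδ, hball⟩ := Metric.mem_nhds_iff.1
    (Filter.inter_mem hinj (isOpen_Ioo.mem_nhds h0ε))
  rw [Real.ball_eq_Ioo, zero_sub, zero_add] at hball
  have hgδ : HypSurf.IsSmoothFamilyOn (Ioo (-δ) δ) g :=
    ContMDiffOn.mono hg (prod_mono (fun t ht => (hball ht).2) le_rfl)
  refine ⟨⟨δ, hδ, HypSurf.exists_conformalStructureAtInfinity hf hν hδ hgδ
    (fun t ht => hhyp t (hball ht).2) (fun t ht => (hh t (hball ht).2).2)
    fun t ht => (hball ht).1⟩, fun h hinf => ?_⟩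
  set N := max (HypSurf.strainNorm g 0 (range f)) (HypSurf.strainGradNorm g 0 (range f)) with hN
  have hC : 0 < 4 + 6 * k := by positivity
  -- An infinite norm makes the right side infinite, because the constant is positive; otherwise N
  -- is replaced by a real number.
  by_cases hNtop : N = ⊤
  · rw [hNtop, ENNReal.mul_top (by simpa using hC)]
    exact le_top
  have hNr : N = ENNReal.ofReal N.toReal := (ENNReal.ofReal_toReal hNtop).symm
  have hd : ∀ x u, ∃ Q' : ℝ, HasDerivAt (fun s => HypSurf.infSq (g s) f ν x u) Q' 0 ∧
      |Q'| ≤ (8 + 12 * k) * N.toReal * HypSurf.infSq (g 0) f ν x u := fun x u =>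
    HypSurf.exists_hasDerivAt_infSq hf hν isOpen_Ioo hg hhyp h0ε ENNReal.toReal_nonneg hk.le
      ((le_max_left _ _).trans_eq hNr) ((le_max_right _ _).trans_eq hNr)
      (HypSurf.norm_le_stretch hf hν (hhyp 0 h0ε) hk (hev' x) u)
  have hfin : ((4 + 6 * k).toNNReal : ℝ≥0∞) * N = ENNReal.ofReal ((4 + 6 * k) * N.toReal) := by
    rw [ENNReal.ofReal_mul hC.le, ← hNr]
    rfl
  rw [hfin]
  -- The derivative bound extends to times near 0 only with a strictly larger constant; the slack 2η
  -- in it costs η in the speed, and η is arbitrary.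
  refine ENNReal.le_of_forall_pos_le_add fun η hη _ => ?_
  have hη' : (0 : ℝ) < η := hη
  have h1 := HypSurf.teichSpeed_le hf hν hδ hgδ (fun t ht => hhyp t (hball ht).2)
    (fun t ht => (hball ht).1) hinf (c := (8 + 12 * k) * N.toReal + 2 * η)
    (by positivity) (by linarith) hd
  refine h1.trans_eq ?_
  rw [← ENNReal.ofReal_coe_nnreal, ← ENNReal.ofReal_add (by positivity) hη'.le]
  congr 1
  ring
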